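/- Definitions. For a word $w\in\Sigma^+$ let $i_k(w)$ and $t_k(w)$ be the prefix and the suffix of $w$ of length $k$ (or $w$ itself if $|w|<k$), and let $F_k(w)$ be the set of segments (contiguous subwords) of $w$ of length $k$. A semigroup $S$ is *right [left] locally testable* if for some $k\ge 1$ there are a finite alphabet $\Sigma$ and a surjective morphism $\varphi:\Sigma^+\to S$ such that $u\varphi=v\varphi$ for all $u,v\in\Sigma^+$ with $i_{k-1}(u)=i_{k-1}(v)$, $t_{k-1}(u)=t_{k-1}(v)$, $F_k(u)=F_k(v)$ and such that the order of first appearance of these segments in prefixes [suffixes] is the same in $u$ and in $v$. $S$ is *locally idempotent* if for every idempotent $e\in S$ every element of $eSe$ is idempotent. Let $\Gamma$ be the transition graph of a deterministic finite automaton (from every node there is at most one edge with a given label); its *transition semigroup* consists of the partial maps of the set of nodes induced by nonempty words. Algorithms are programs of a random access machine whose cells hold natural numbers, with addition, truncated subtraction, multiplication, integer division and indirect addressing, under the uniform cost criterion: every operation takes one unit of time, and every cell that is accessed takes one unit of space. Theorem. 1. There is an algorithm that, given the multiplication table of a finite semigroup $S$ with $k\ge1$ elements, decides in $O(k^2)$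 time and space whether $S$ is right locally testable; likewise for left local testability. 2. There are algorithms that, given the transition graph $\Gamma$ (number of nodes and list of labelled edges) of a deterministic finite automaton, with $n=$ number of nodes $+$ number of labelled edges and at least one node, decide (a) in $O(n^2)$ time and space whether the transition semigroup of $\Gamma$ is right locally testable; (b) in $O(n^3)$ time and space whether the transition semigroup of $\Gamma$ is left locally testable; (c) in $O(n^3)$ time and space whether the transition semigroup of $\Gamma$ is locally idempotent. -/

import Mathlib

/-! ### Words, right and left local testability of a semigroup -/

namespace LocalTestability

/-- The list of letters of a nonempty word. -/
def letters {α : Type} (w : FreeSemigroup α) : List α := w.head :: w.tail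

/-- `i_k(w)`: the prefix of `w` of length `k`, or `w` itself if `w` is shorter than `k`. -/
def prefixWord {α : Type} (k : ℕ) (w : FreeSemigroup α) : List α := (letters w).take k

/-- `t_k(w)`: the suffix of `w` of length `k`, or `w` itself if `w` is shorter than `k`. -/
def suffixWord {α : Type} (k : ℕ) (w : FreeSemigroup α) : List α :=
  (letters w).drop ((letters w).length - k)

/-- `F_k(w)`: the set of segments (contiguous subwords) of `w` of length `k`. -/
def segments {α : Type} (k : ℕ) (w : FreeSemigroup α) : Set (List α) :=
  {x | x.length = k ∧ x <:+: letters w}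

/-- Some prefix of `w` contains the segment `x` but not the segment `y`: reading `w` from the
left, `x` appears before `y`. -/
def AppearsBeforeInPrefixes {α : Type} (w : FreeSemigroup α) (x y : List α) : Prop :=
  ∃ p : List α, p <+: letters w ∧ x <:+: p ∧ ¬ y <:+: p

/-- Some suffix of `w` contains the segment `x` but not the segment `y`: reading `w` from the
right, `x` appears before `y`. -/
def AppearsBeforeInSuffixes {α : Type} (w : FreeSemigroup α) (x y : List α) : Prop :=
  ∃ s : List α, s <:+ letters w ∧ x <:+: s ∧ ¬ y <:+: s

/-- `u` and `v` have the same prefix and the same suffix of length `k - 1`, the same segments of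
length `k`, and the same order of first appearance of these segments in prefixes. -/
def RightEquivalent {α : Type} (k : ℕ) (u v : FreeSemigroup α) : Prop :=
  prefixWord (k - 1) u = prefixWord (k - 1) v ∧
  suffixWord (k - 1) u = suffixWord (k - 1) v ∧
  segments k u = segments k v ∧
  ∀ x ∈ segments k u, ∀ y ∈ segments k u,
    (AppearsBeforeInPrefixes u x y ↔ AppearsBeforeInPrefixes v x y)

/-- The same with the order of first appearance of the segments in suffixes. -/
def LeftEquivalent {α : Type} (k : ℕ) (u v : FreeSemigroup α) : Prop :=
  prefixWord (k - 1) u = prefixWord (k - 1) v ∧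
  suffixWord (k - 1) u = suffixWord (k - 1) v ∧
  segments k u = segments k v ∧
  ∀ x ∈ segments k u, ∀ y ∈ segments k u,
    (AppearsBeforeInSuffixes u x y ↔ AppearsBeforeInSuffixes v x y)

/-- A semigroup is right `k`-testable if it is a quotient `φ : Σ⁺ → S` of the free semigroup over
some (finite) alphabet such that right equivalent words have equal images. -/
def RightTestable (k : ℕ) (S : Type) [Semigroup S] : Prop :=
  ∃ (A : Type) (_ : Finite A) (φ : FreeSemigroup A →ₙ* S), Function.Surjective φ ∧
    ∀ u v : FreeSemigroup A, RightEquivalent k u v → φ u = φ v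

/-- Left `k`-testable semigroups. -/
def LeftTestable (k : ℕ) (S : Type) [Semigroup S] : Prop :=
  ∃ (A : Type) (_ : Finite A) (φ : FreeSemigroup A →ₙ* S), Function.Surjective φ ∧
    ∀ u v : FreeSemigroup A, LeftEquivalent k u v → φ u = φ v

/-- A semigroup is right locally testable if it is right `k`-testable for some `k ≥ 1`. -/
def RightLocallyTestable (S : Type) [Semigroup S] : Prop := ∃ k : ℕ, 1 ≤ k ∧ RightTestable k S

/-- A semigroup is left locally testable if it is left `k`-testable for some `k ≥ 1`. -/
def LeftLocallyTestable (S : Type) [Semigroup S] : Prop := ∃ k : ℕ, 1 ≤ k ∧ LeftTestable k S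

/-- `S` is locally idempotent: for every idempotent `e`, every element of `eSe` is idempotent. -/
def LocallyIdempotent (S : Type) [Semigroup S] : Prop :=
  ∀ e : S, IsIdempotentElem e → ∀ s : S, IsIdempotentElem (e * s * e)

/-! ### Transition graphs and transition semigroups -/

/-- Partial maps of `V` into itself, acting on the right. -/
def PartialMap (V : Type) : Type := V → Option V

/-- The product `f * g` is "first `f`, then `g`". -/
instance (V : Type) : Semigroup (PartialMap V) where
  mul f g := fun p => (f p).bind g
  mul_assoc f g h := funext fun p => Option.bind_assoc (f p) g h

/-- The transition graph of a deterministic finite automaton: the nodes and the letters are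
numbered, and `step p σ` is the end of the edge labelled `σ` that leaves the node `p`, if there is
such an edge. -/
structure TransitionGraph where
  nodes : ℕ
  alphabet : ℕ
  step : Fin nodes → Fin alphabet → Option (Fin nodes)

namespace TransitionGraph

/-- The partial map of the set of nodes induced by a letter. -/
def letterMap (G : TransitionGraph) (σ : Fin G.alphabet) : PartialMap (Fin G.nodes) :=
  fun p => G.step p σ

/-- The transition semigroup: all partial maps induced by nonempty words. -/
def transitionSemigroup (G : TransitionGraph) : Subsemigroup (PartialMap (Fin G.nodes)) :=
  Subsemigroup.closure (Set.range G.letterMap)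

/-- `L` lists every labelled edge `p → q` with label `σ` of the graph, as `(p, σ, q)`, exactly
once, in some order. -/
def IsEdgeList (G : TransitionGraph) (L : List (Fin G.nodes × Fin G.alphabet × Fin G.nodes)) :
    Prop :=
  L.Nodup ∧ ∀ p σ q, (p, σ, q) ∈ L ↔ G.step p σ = some q

/-- The input that describes the graph: the number of nodes, the number of edges, and for every
edge its beginning, its label and its end. -/
def encode (G : TransitionGraph) (L : List (Fin G.nodes × Fin G.alphabet × Fin G.nodes)) :
    List ℕ :=
  G.nodes :: L.length :: L.flatMap fun x => [(x.1 : ℕ), (x.2.1 : ℕ), (x.2.2 : ℕ)]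

end TransitionGraph

/-- The input that describes a finite semigroup whose elements are numbered by `ν`: the number of
elements, and the multiplication table row by row. -/
def encodeSemigroup {S : Type} [Semigroup S] {k : ℕ} (ν : Fin k ≃ S) : List ℕ :=
  k :: (List.finRange k).flatMap fun i =>
    (List.finRange k).map fun j => ((ν.symm (ν i * ν j) : Fin k) : ℕ)

end LocalTestability

/-! ### Random access machines with the uniform cost criterion

The memory is an infinite array of cells which hold natural numbers.  Programs are built from
assignments (with indirect addressing and the four arithmetical operations), tests and loops.
Every operation, every memory access, every assignment and every test takes one unit of time, and
every cell that is accessed takes one unit of space. -/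

namespace RAM

/-- The memory: the contents of the cells `0, 1, 2, …`. -/
abbrev Memory : Type := ℕ → ℕ

/-- Expressions: constants, the contents of the cell with a computed address, and arithmetical
operations (truncated subtraction, integer division). -/
inductive Expression : Type
  | const (c : ℕ)
  | cell (a : Expression)
  | add (a b : Expression)
  | sub (a b : Expression)
  | mul (a b : Expression)
  | div (a b : Expression)

namespace Expression

/-- The value of an expression. -/
def eval (m : Memory) : Expression → ℕ
  | const c => c
  | cell a => m (a.eval m)
  | add a b => a.eval m + b.eval m
  | sub a b => a.eval m - b.eval m
  | mul a b => a.eval m * b.eval m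
  | div a b => a.eval m / b.eval m

/-- The time needed for evaluation: one unit for every constant, memory access and operation. -/
def cost : Expression → ℕ
  | const _ => 1
  | cell a => a.cost + 1
  | add a b => a.cost + b.cost + 1
  | sub a b => a.cost + b.cost + 1
  | mul a b => a.cost + b.cost + 1
  | div a b => a.cost + b.cost + 1

/-- The cells that are read in the evaluation. -/
def cells (m : Memory) : Expression → Finset ℕ
  | const _ => ∅
  | cell a => insert (a.eval m) (a.cells m)
  | add a b => a.cells m ∪ b.cells m
  | sub a b => a.cells m ∪ b.cells m
  | mul a b => a.cells m ∪ b.cells m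
  | div a b => a.cells m ∪ b.cells m

end Expression

/-- Programs. `store a e` writes the value of `e` into the cell whose address is the value of `a`;
`branch e P Q` runs `P` if the value of `e` is nonzero, and `Q` otherwise; `loop e P` runs `P` as
long as the value of `e` is nonzero. -/
inductive Program : Type
  | skip
  | store (a e : Expression)
  | seq (P Q : Program)
  | branch (e : Expression) (P Q : Program)
  | loop (e : Expression) (P : Program)

/-- `Run P m t A m'`: the program `P`, started with the memory `m`, halts after `t` units of time
with the memory `m'`, and `A` is the set of the cells that it has accessed. -/
inductive Run : Program → Memory → ℕ → Finset ℕ → Memory → Prop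
  | skip (m : Memory) : Run Program.skip m 1 ∅ m
  | store (a e : Expression) (m : Memory) :
      Run (Program.store a e) m (a.cost + e.cost + 1) (insert (a.eval m) (a.cells m ∪ e.cells m))
        (Function.update m (a.eval m) (e.eval m))
  | seq {P Q : Program} {m m' m'' : Memory} {t t' : ℕ} {A A' : Finset ℕ} :
      Run P m t A m' → Run Q m' t' A' m'' → Run (Program.seq P Q) m (t + t') (A ∪ A') m''
  | branch_true {e : Expression} {P Q : Program} {m m' : Memory} {t : ℕ} {A : Finset ℕ} :
      e.eval m ≠ 0 → Run P m t A m' →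
      Run (Program.branch e P Q) m (e.cost + 1 + t) (e.cells m ∪ A) m'
  | branch_false {e : Expression} {P Q : Program} {m m' : Memory} {t : ℕ} {A : Finset ℕ} :
      e.eval m = 0 → Run Q m t A m' →
      Run (Program.branch e P Q) m (e.cost + 1 + t) (e.cells m ∪ A) m'
  | loop_true {e : Expression} {P : Program} {m m' m'' : Memory} {t t' : ℕ} {A A' : Finset ℕ} :
      e.eval m ≠ 0 → Run P m t A m' → Run (Program.loop e P) m' t' A' m'' →
      Run (Program.loop e P) m (e.cost + 1 + t + t') (e.cells m ∪ A ∪ A') m''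
  | loop_false {e : Expression} {P : Program} {m : Memory} :
      e.eval m = 0 → Run (Program.loop e P) m (e.cost + 1) (e.cells m) m

/-- The memory at the start: the input stands in the first cells, all other cells hold `0`. -/
def initialMemory (input : List ℕ) : Memory := fun i => input.getD i 0

/-- On the given input the program halts within `T` units of time, accesses at most `T` cells, and
leaves in cell `0` the answer to the question whether `Q` holds (`1` for yes, `0` for no). -/
def Answers (P : Program) (input : List ℕ) (Q : Prop) (T : ℕ) : Prop :=
  ∃ (t : ℕ) (A : Finset ℕ) (m : Memory), Run P (initialMemory input) t A m ∧
    t ≤ T ∧ A.card ≤ T ∧ (Q → m 0 = 1) ∧ (¬ Q → m 0 = 0)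

/-- Runs are deterministic: time, space and result are determined by program and memory. -/
theorem Run.deterministic {P : Program} {m m₁ m₂ : Memory} {t₁ t₂ : ℕ} {A₁ A₂ : Finset ℕ}
    (h₁ : Run P m t₁ A₁ m₁) (h₂ : Run P m t₂ A₂ m₂) : t₁ = t₂ ∧ A₁ = A₂ ∧ m₁ = m₂ := by
  induction h₁ generalizing t₂ A₂ m₂ with
  | skip => cases h₂; exact ⟨rfl, rfl, rfl⟩
  | store => cases h₂; exact ⟨rfl, rfl, rfl⟩
  | seq _ _ ih ih' =>
    cases h₂ with
    | seq k k' =>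
      obtain ⟨rfl, rfl, rfl⟩ := ih k
      obtain ⟨rfl, rfl, rfl⟩ := ih' k'
      exact ⟨rfl, rfl, rfl⟩
  | branch_true h _ ih =>
    cases h₂ with
    | branch_true _ k => obtain ⟨rfl, rfl, rfl⟩ := ih k; exact ⟨rfl, rfl, rfl⟩
    | branch_false h' _ => exact absurd h' h
  | branch_false h _ ih =>
    cases h₂ with
    | branch_true h' _ => exact absurd h h'
    | branch_false _ k => obtain ⟨rfl, rfl, rfl⟩ := ih k; exact ⟨rfl, rfl, rfl⟩
  | loop_true h _ _ ih ih' =>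
    cases h₂ with
    | loop_true _ k k' =>
      obtain ⟨rfl, rfl, rfl⟩ := ih k
      obtain ⟨rfl, rfl, rfl⟩ := ih' k'
      exact ⟨rfl, rfl, rfl⟩
    | loop_false h' => exact absurd h' h
  | loop_false h =>
    cases h₂ with
    | loop_true h' _ _ => exact absurd h h'
    | loop_false _ => exact ⟨rfl, rfl, rfl⟩

end RAM

/-!
Right and left local testability of a finite semigroup are characterized by identities in its local
monoids, and the identities are translated into conditions that a machine can check in the required
time.

*Algebra.* A finite semigroup `S` is right locally testable if and only if every local monoid `eSe`
satisfies `xyx = xy` (`rightLocallyTestable_iff`). If a word `E` for `e` is long enough, then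
`E s E t E` and `E s E t E s E` are right equivalent, which gives the identity. Conversely, let `c`
be a word that is longer than the number of elements. Two of its prefixes have the same value, so an
idempotent can be inserted in `c`, and therefore the words that lead from `c` back to `c` obey the
identity `xyx = xy` (`val_loops`). Hence a continuation of a word that consists of segments that
have occurred before can be undone (`exists_return`), and its effect depends only on its last
letters (`val_append_eq_of_coterminal`). An induction over the order in which new segments appear
(`val_eq_of_prefix`) shows that right equivalent words have the same value. Left testability is the
same property of the opposite semigroup and amounts to `xyx = yx` (`leftLocallyTestable_iff`).

*Multiplication tables.* The identity `xyx = xy` in `eSe` says that `eSe` is a band in which two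
elements that generate the same right ideal are equal (`locallyLeftRegular_iff_idempotents`). A
representative of the right ideal of each idempotent is computed once, in quadratic time; then each
`eSe` is inspected in linear time, with one mark for each right ideal.

*Transition graphs.* The identities become conditions on nodes that are fixed by a common word and
on paths between pairs of nodes (`locallyIdempotent_iff`, `locallyRightRegular_iff`,
`locallyLeftRegular_iff`). For left testability and local idempotency, these are conditions on the
reachability of triples of states, a graph of cubic size. For right testability, the condition is
expressed by reachability in a graph on pairs of states, with an additional vertex that stands for
failure, which has quadratic size (`locallyLeftRegular_iff_testStep`).

*Transitive closure in linear time.* The cells of the machine hold arbitrarily large numbers, and an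
operation takes one unit of time. So a whole matrix is packed into one number, as the value of a
polynomial in two large bases. After a change of bases, which is a division with remainder by a
difference of the bases, the product of two matrices is a digit of a product of numbers
(`pack_product`). Repeated squaring yields `A (1 + A) ^ n` for the adjacency matrix `A`, in a time
that is linear in the numbers of vertices and edges (`closure_spec`).

*Programs.* The algorithms are written in a small structured language with arrays and bounded loops,
whose rules (`RAM.Code.Spec`) bound the number of steps along with the correctness; a translation
into programs of the machine preserves the time up to a constant (`RAM.Code.answers`).
-/

namespace LocalTestability

/-! ### Local identities and testability of finite semigroups -/

section Value

variable {A S : Type} [Semigroup S]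

/-- The value of a word under a map of the letters into `S`, in the monoid `S` with an adjoined
unit; the empty word has the value `1`. -/
def val (f : A → S) (w : List A) : WithOne S := (w.map fun a => (f a : WithOne S)).prod

@[simp] lemma val_append (f : A → S) (v w : List A) : val f (v ++ w) = val f v * val f w := by
  simp [val]

@[simp] lemma val_cons (f : A → S) (a : A) (w : List A) :
    val f (a :: w) = (f a : WithOne S) * val f w := by
  simp [val]

@[simp] lemma letters_mul (u v : FreeSemigroup A) : letters (u * v) = letters u ++ letters v := rfl

lemma letters_injective : Function.Injective (letters : FreeSemigroup A → List A) := by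
  rintro ⟨a, l⟩ ⟨b, m⟩ h
  simp only [letters, List.cons.injEq] at h
  rw [h.1, h.2]

lemma exists_letters_eq {l : List A} (h : l ≠ []) : ∃ w : FreeSemigroup A, letters w = l := by
  cases l with
  | nil => exact absurd rfl h
  | cons a l => exact ⟨⟨a, l⟩, rfl⟩

lemma coe_map_eq_val (φ : FreeSemigroup A →ₙ* S) (w : FreeSemigroup A) :
    ((φ w : S) : WithOne S) = val (fun a => φ (FreeSemigroup.of a)) (letters w) := by
  induction w using FreeSemigroup.recOnMul with
  | ih1 a => simp [letters, val]
  | ih2 a w ha hw => rw [map_mul, WithOne.coe_mul, ha, hw, letters_mul, val_append]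

lemma exists_val_eq (f : A → S) {w : List A} (h : w ≠ []) : ∃ s : S, val f w = s := by
  obtain ⟨u, rfl⟩ := exists_letters_eq h
  exact ⟨FreeSemigroup.lift f u, by rw [coe_map_eq_val]; rfl⟩

end Value

/-- Every element of a finite semigroup has an idempotent power. -/
lemma exists_idempotent_pow {S : Type} [Semigroup S] [Finite S] (s : S) :
    ∃ (e : S) (m : ℕ), IsIdempotentElem e ∧ (e : WithOne S) = (s : WithOne S) ^ (m + 1) := by
  have hfin : Finite (WithOne S) := inferInstanceAs (Finite (Option S))
  obtain ⟨i, j, hij, h⟩ : ∃ i j : ℕ, i < j ∧ (s : WithOne S) ^ i = (s : WithOne S) ^ j := by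
    obtain ⟨i, j, hne, h⟩ := Finite.exists_ne_map_eq_of_infinite fun n : ℕ => (s : WithOne S) ^ n
    rcases lt_or_gt_of_ne hne with h' | h'
    · exact ⟨i, j, h', h⟩
    · exact ⟨j, i, h', h.symm⟩
  obtain ⟨d, rfl⟩ := Nat.exists_eq_add_of_lt hij
  -- From the exponent `i` on, the powers are periodic with the period `d + 1`.
  have hper : ∀ n k : ℕ, i ≤ n → (s : WithOne S) ^ (n + k * (d + 1)) = (s : WithOne S) ^ n := by
    intro n k hn
    induction k with
    | zero => simp
    | succ k ih =>
      obtain ⟨t, rfl⟩ := Nat.exists_eq_add_of_le hn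
      rw [← ih, show i + t + (k + 1) * (d + 1) = (i + d + 1) + (t + k * (d + 1)) by ring, pow_add,
        ← h, ← pow_add, ← add_assoc]
  have hpos : ∀ n : ℕ, ∃ e : S, (e : WithOne S) = (s : WithOne S) ^ (n + 1) := by
    intro n
    induction n with
    | zero => exact ⟨s, by simp⟩
    | succ n ih => obtain ⟨e, he⟩ := ih; exact ⟨e * s, by rw [WithOne.coe_mul, he, ← pow_succ]⟩
  obtain ⟨e, he⟩ := hpos (i * (d + 1) + d)
  refine ⟨e, _, ?_, he⟩
  apply WithOne.coe_inj.1
  rw [WithOne.coe_mul, he, ← pow_add,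
    show i * (d + 1) + d + 1 + (i * (d + 1) + d + 1)
      = (i * (d + 1) + d + 1) + (i + 1) * (d + 1) by ring]
  exact hper _ _ (by nlinarith)

/-- The identity `xyx = xy` in every local monoid `eSe`. -/
def LocallyLeftRegular (S : Type) [Semigroup S] : Prop :=
  ∀ e : S, IsIdempotentElem e → ∀ s t : S,
    (e * s * e) * (e * t * e) * (e * s * e) = (e * s * e) * (e * t * e)

/-- The identity `xyx = yx` in every local monoid `eSe`. -/
def LocallyRightRegular (S : Type) [Semigroup S] : Prop :=
  ∀ e : S, IsIdempotentElem e → ∀ s t : S,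
    (e * s * e) * (e * t * e) * (e * s * e) = (e * t * e) * (e * s * e)

section Segments

variable {A : Type}

/-- A segment of a word that is not longer by more than one letter than a middle part `c` does not
stretch over `c`. -/
lemma infix_append_of_overlap {x X c Y : List A} (hx : x.length ≤ c.length + 1)
    (h : x <:+: X ++ c ++ Y) : x <:+: X ++ c ∨ x <:+: c ++ Y := by
  obtain ⟨s, t, h⟩ := h
  rcases le_or_gt (s.length + x.length) (X.length + c.length) with hl | hl
  · left
    have h1 : s ++ x <+: X ++ c := by
      apply List.prefix_of_prefix_length_le (l₃ := X ++ c ++ Y)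
      · exact ⟨t, h⟩
      · exact ⟨Y, rfl⟩
      · simpa using hl
    exact List.IsInfix.trans ⟨s, [], by simp⟩ h1.isInfix
  · right
    have h1 : x ++ t <:+ c ++ Y := by
      apply List.suffix_of_suffix_length_le (l₃ := X ++ c ++ Y)
      · exact ⟨s, by rw [← h]; simp⟩
      · exact ⟨X, by simp⟩
      · have := congrArg List.length h
        simp only [List.length_append] at this ⊢
        omega
    exact List.IsInfix.trans ⟨[], t, by simp⟩ h1.isInfix

lemma drop_append_suffix (X : List A) {c : List A} {n : ℕ} (h : n ≤ c.length) :
    (X ++ c).drop ((X ++ c).length - n) = c.drop (c.length - n) := by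
  rw [List.length_append, show X.length + c.length - n = X.length + (c.length - n) by omega,
    List.drop_append]
  simp

/-- All segments of length `n + 1` of `v` are segments of `u`. -/
def SegmentsSubset (n : ℕ) (v u : List A) : Prop :=
  ∀ x : List A, x.length = n + 1 → x <:+: v → x <:+: u

lemma SegmentsSubset.trans {n : ℕ} {u v w : List A} (h : SegmentsSubset n u v)
    (h' : SegmentsSubset n v w) : SegmentsSubset n u w :=
  fun x hx hu => h' x hx (h x hx hu)

lemma SegmentsSubset.of_infix {n : ℕ} {u v : List A} (h : u <:+: v) : SegmentsSubset n u v :=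
  fun _ _ hu => hu.trans h

lemma SegmentsSubset.append {n : ℕ} {P c Q u : List A} (hc : c.length = n)
    (h : SegmentsSubset n (P ++ c) u) (h' : SegmentsSubset n (c ++ Q) u) :
    SegmentsSubset n (P ++ c ++ Q) u := fun x hx hxi =>
  (infix_append_of_overlap (by omega) hxi).elim (h x hx) (h' x hx)

lemma eq_append_of_length_le {n : ℕ} {w : List A} (h : n ≤ w.length) :
    ∃ P c : List A, w = P ++ c ∧ c.length = n :=
  ⟨w.take (w.length - n), w.drop (w.length - n), by simp, by simp; omega⟩

/-- The shortest prefix with given segments; its last segment has not occurred before. -/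
lemma exists_shortest_prefix {n : ℕ} {p : List A} (hp : n < p.length) :
    ∃ (P f : List A) (a : A) (Q : List A), p = P ++ f ++ [a] ++ Q ∧ f.length = n ∧
      SegmentsSubset n p (P ++ f ++ [a]) ∧ ¬ f ++ [a] <:+: P ++ f := by
  induction p using List.reverseRecOn with
  | nil => simp at hp
  | append_singleton p a ih =>
    obtain ⟨P, f, rfl, hf⟩ : ∃ P f : List A, p = P ++ f ∧ f.length = n :=
      eq_append_of_length_le (by simpa [Nat.lt_succ_iff] using hp)
    by_cases hnew : f ++ [a] <:+: P ++ f
    · have hlt : n < (P ++ f).length := by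
        have := hnew.length_le
        simp only [List.length_append, List.length_singleton] at this ⊢
        omega
      obtain ⟨P', f', a', Q, h1, h2, h3, h4⟩ := ih hlt
      refine ⟨P', f', a', Q ++ [a], by rw [h1]; simp, h2, SegmentsSubset.trans ?_ h3, h4⟩
      exact .append hf (fun x _ h => h) fun x hx h => by
        have : x = f ++ [a] := h.eq_of_length (by simp [hx, hf])
        exact this ▸ hnew
    · exact ⟨P, f, a, [], by simp, hf, fun x _ h => h, hnew⟩

end Segments

/-- If right equivalent words have equal images, then the local monoids satisfy `xyx = xy`: the
words `E s E t E` and `E s E t E s E` are right equivalent as soon as `E` is long. -/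
theorem RightTestable.locallyLeftRegular {S : Type} [Semigroup S] {k : ℕ} (hk : 1 ≤ k)
    (h : RightTestable k S) : LocallyLeftRegular S := by
  obtain ⟨A, -, φ, hsurj, hφ⟩ := h
  intro e he s t
  obtain ⟨ue, hue⟩ := hsurj e
  obtain ⟨us, rfl⟩ := hsurj s
  obtain ⟨ut, rfl⟩ := hsurj t
  -- A word for `e` of length at least `k`.
  obtain ⟨E, hE, hlen⟩ : ∃ E : FreeSemigroup A, φ E = e ∧ k ≤ (letters E).length := by
    clear hk hφ
    induction k with
    | zero => exact ⟨ue, hue, by simp⟩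
    | succ k ih =>
      obtain ⟨E, hE, hl⟩ := ih
      refine ⟨E * ue, by rw [map_mul, hE, hue, he.eq], ?_⟩
      rw [letters_mul, List.length_append]
      have : 1 ≤ (letters ue).length := by simp [letters]
      omega
  have key := hφ (E * us * E * ut * E) (E * us * E * ut * E * us * E) ?_
  · simp only [map_mul, hE] at key
    calc (e * φ us * e) * (e * φ ut * e) * (e * φ us * e)
        = e * φ us * (e * e) * φ ut * (e * e) * φ us * e := by simp only [mul_assoc]
      _ = e * φ us * e * φ ut * e * φ us * e := by rw [he.eq]
      _ = e * φ us * e * φ ut * e := key.symm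
      _ = e * φ us * (e * e) * φ ut * e := by rw [he.eq]
      _ = _ := by simp only [mul_assoc]
  set L := letters E with hL
  set s := letters us
  set t := letters ut
  have hu : letters (E * us * E * ut * E) = L ++ s ++ L ++ t ++ L := by simp [← hL, s, t]
  have hv : letters (E * us * E * ut * E * us * E) = L ++ s ++ L ++ t ++ L ++ s ++ L := by
    simp [← hL, s, t]
  have hpre : L ++ s ++ L ++ t ++ L <+: L ++ s ++ L ++ t ++ L ++ s ++ L :=
    ⟨s ++ L, by simp⟩
  have hseg : ∀ x : List A, x.length = k →
      (x <:+: L ++ s ++ L ++ t ++ L ↔ x <:+: L ++ s ++ L ++ t ++ L ++ s ++ L) := by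
    intro x hx
    refine ⟨fun hxu => hxu.trans hpre.isInfix, fun hxv => ?_⟩
    have hxv' : x <:+: (L ++ s ++ L ++ t) ++ L ++ (s ++ L) := by simpa using hxv
    rcases infix_append_of_overlap (by omega) hxv' with h | h
    · exact h
    · exact h.trans ⟨[], t ++ L, by simp⟩
  refine ⟨?_, ?_, ?_, ?_⟩
  · simp only [prefixWord, hu, hv, List.append_assoc]
    rw [List.take_append_of_le_length (by omega), List.take_append_of_le_length (by omega)]
  · simp only [suffixWord, hu, hv]
    rw [drop_append_suffix _ (by omega), drop_append_suffix _ (by omega)]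
  · ext x
    simp only [segments, hu, hv, Set.mem_ofPred_eq]
    exact and_congr_right fun hx => hseg x hx
  · intro x _ y hy
    simp only [segments, hu, Set.mem_ofPred_eq] at hy
    simp only [AppearsBeforeInPrefixes, hu, hv]
    constructor
    · rintro ⟨p, hp, h⟩
      exact ⟨p, hp.trans hpre, h⟩
    · rintro ⟨p, hp, hxp, hyp⟩
      refine ⟨p, ?_, hxp, hyp⟩
      rcases List.prefix_or_prefix_of_prefix hp hpre with h' | h'
      · exact h'
      · exact absurd (hy.2.trans h'.isInfix) hyp

section LeftRegular

variable {S : Type} [Semigroup S]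

/-- Two loops at a word `c` that is longer than the number of elements satisfy the identity
`xyx = xy`: two prefixes of `c` have the same value, so an idempotent can be inserted in `c`, and
the loops act as elements of its local monoid. -/
lemma val_loops [Finite S] (hloc : LocallyLeftRegular S) {c : List S}
    (hc : Nat.card S < c.length) {Q Q' : List S} (hQ : c <:+ c ++ Q) (hQ' : c <:+ c ++ Q')
    (P : List S) :
    val id (P ++ c ++ Q ++ Q' ++ Q) = val id (P ++ c ++ Q ++ Q') := by
  have hfin : Finite (WithOne S) := inferInstanceAs (Finite (Option S))
  have hcard : Nat.card (WithOne S) = Nat.card S + 1 := by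
    have := Fintype.ofFinite S
    change Nat.card (Option S) = _
    rw [Nat.card_eq_fintype_card, Nat.card_eq_fintype_card, Fintype.card_option]
  -- Two prefixes of `c` have the same value.
  obtain ⟨c₁, c₂, c₃, rfl, hc₂, hval⟩ : ∃ c₁ c₂ c₃ : List S, c = c₁ ++ c₂ ++ c₃ ∧ c₂ ≠ [] ∧
      val id c₁ * val id c₂ = val id c₁ := by
    obtain ⟨i, j, hne, h⟩ : ∃ i j : Fin (c.length + 1), i ≠ j ∧
        val id (c.take i) = val id (c.take j) := by
      have := Fintype.ofFinite (WithOne S)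
      apply Fintype.exists_ne_map_eq_of_card_lt
        (fun i : Fin (c.length + 1) => val id (c.take (i : ℕ)))
      rw [Nat.card_eq_fintype_card] at hcard
      rw [hcard, Fintype.card_fin]
      omega
    wlog hij : i < j generalizing i j
    · exact this j i hne.symm h.symm (lt_of_le_of_ne (not_lt.1 hij) hne.symm)
    have hij' : (i : ℕ) < j := hij
    have hj := j.2
    have htake : c.take j = c.take i ++ (c.drop i).take (j - i) := by
      rw [← List.take_add]; congr 1; omega
    refine ⟨c.take i, (c.drop i).take (j - i), c.drop j, ?_, ?_, ?_⟩
    · rw [← htake, List.take_append_drop]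
    · intro h0
      have := congrArg List.length h0
      simp only [List.length_take, List.length_drop, List.length_nil] at this
      omega
    · rw [← val_append, ← htake, h]
  obtain ⟨s, hs⟩ := exists_val_eq id hc₂
  obtain ⟨e, m, he, hem⟩ := exists_idempotent_pow s
  have habs : ∀ a : WithOne S, a * val id c₁ * e = a * val id c₁ := by
    intro a
    rw [hem, ← hs, mul_assoc]
    congr 1
    generalize m + 1 = n
    induction n with
    | zero => simp
    | succ n ih => rw [pow_succ, ← mul_assoc, ih, hval]
  have hee : (e : WithOne S) * e = e := by rw [← WithOne.coe_mul, he.eq]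
  have hlocal : ∀ a b : WithOne S, (e * a * e) * (e * b * e) * (e * a * e)
      = (e * a * e) * (e * b * e) := by
    intro a b
    rcases eq_or_ne a 1 with rfl | ha
    · simp only [mul_one, hee, mul_assoc]
    obtain ⟨a, rfl⟩ := WithOne.ne_one_iff_exists.1 ha
    rcases eq_or_ne b 1 with rfl | hb
    · have := hloc e he a e
      rw [he.eq, he.eq] at this
      simp only [mul_one, hee]
      exact_mod_cast this
    obtain ⟨b, rfl⟩ := WithOne.ne_one_iff_exists.1 hb
    exact_mod_cast hloc e he a b
  -- A loop `Q` at `c` is conjugate to a word `Z` between two places where `e` may be inserted.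
  have hloop : ∀ Q : List S, c₁ ++ c₂ ++ c₃ <:+ c₁ ++ c₂ ++ c₃ ++ Q →
      ∃ (Z R : List S), R ++ (c₁ ++ c₂ ++ c₃) = c₁ ++ c₂ ++ c₃ ++ Q ∧
        c₂ ++ c₃ ++ Q = Z ++ (c₂ ++ c₃) ∧ R ++ c₁ = c₁ ++ Z := by
    rintro Q ⟨R, hR⟩
    have h1 : c₁ <+: R ++ c₁ := by
      apply List.prefix_of_prefix_length_le (l₃ := c₁ ++ c₂ ++ c₃ ++ Q)
      · exact ⟨c₂ ++ c₃ ++ Q, by simp⟩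
      · exact ⟨c₂ ++ c₃, by rw [← hR]; simp⟩
      · simp
    obtain ⟨Z, hZ⟩ := h1
    refine ⟨Z, R, hR, ?_, hZ.symm⟩
    have : c₁ ++ (c₂ ++ c₃ ++ Q) = c₁ ++ (Z ++ (c₂ ++ c₃)) := by
      rw [← List.append_assoc c₁ Z, hZ]
      simpa using hR.symm
    exact List.append_cancel_left this
  have hstep : ∀ (Q Z R : List S), R ++ (c₁ ++ c₂ ++ c₃) = c₁ ++ c₂ ++ c₃ ++ Q →
      c₂ ++ c₃ ++ Q = Z ++ (c₂ ++ c₃) → R ++ c₁ = c₁ ++ Z → ∀ a : WithOne S,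
      a * val id (c₁ ++ Z) = a * val id c₁ * (e * val id Z * e) ∧
      val id (c₂ ++ c₃ ++ Q) = val id Z * val id (c₂ ++ c₃) := by
    intro Q Z R _ h2 h3 a
    refine ⟨?_, by rw [h2, val_append]⟩
    have h4 : a * val id (c₁ ++ Z) * e = a * val id (c₁ ++ Z) := by
      rw [← h3, val_append, ← mul_assoc, habs]
    calc a * val id (c₁ ++ Z) = a * val id (c₁ ++ Z) * e := h4.symm
      _ = a * val id c₁ * val id Z * e := by simp only [val_append, mul_assoc]
      _ = a * val id c₁ * e * val id Z * e := by rw [habs]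
      _ = _ := by simp only [mul_assoc]
  obtain ⟨Z, R, h1, h2, h3⟩ := hloop Q hQ
  obtain ⟨Z', R', h1', h2', h3'⟩ := hloop Q' hQ'
  have hZ : ∀ a, a * val id c₁ * val id Z = a * val id c₁ * (e * val id Z * e) := fun a => by
    have := (hstep Q Z R h1 h2 h3 a).1
    rwa [val_append, ← mul_assoc] at this
  have hZ' : ∀ a, a * val id c₁ * val id Z' = a * val id c₁ * (e * val id Z' * e) := fun a => by
    have := (hstep Q' Z' R' h1' h2' h3' a).1
    rwa [val_append, ← mul_assoc] at this
  have hR : ∀ a, a * val id c₁ * val id Z = a * val id R * val id c₁ := fun a => by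
    rw [mul_assoc, mul_assoc, ← val_append, ← val_append, h3]
  have hR' : ∀ a, a * val id c₁ * val id Z' = a * val id R' * val id c₁ := fun a => by
    rw [mul_assoc, mul_assoc, ← val_append, ← val_append, h3']
  have e2 : val id (c₂ ++ c₃) * val id Q = val id Z * val id (c₂ ++ c₃) := by
    rw [← val_append, h2, val_append]
  have e2' : val id (c₂ ++ c₃) * val id Q' = val id Z' * val id (c₂ ++ c₃) := by
    rw [← val_append, h2', val_append]
  set a := val id P
  set k₁ := val id c₁
  set k := val id (c₂ ++ c₃)
  set x := (e : WithOne S) * val id Z * e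
  set y := (e : WithOne S) * val id Z' * e
  have hc' : val id (P ++ (c₁ ++ c₂ ++ c₃)) = a * k₁ * k := by
    simp only [a, k₁, k, val_append, mul_assoc]
  have t1 : a * k₁ * k * val id Q = a * k₁ * x * k := by
    rw [mul_assoc (a * k₁), e2, ← mul_assoc, hZ]
  have t2 : a * k₁ * x * k * val id Q' = a * k₁ * x * y * k := by
    rw [← hZ, hR, mul_assoc (a * val id R * k₁), e2', ← mul_assoc, hZ']
  have t3 : a * k₁ * x * y * k * val id Q = a * k₁ * x * y * x * k := by
    rw [← hZ, hR, ← hZ', hR', mul_assoc (a * val id R * val id R' * k₁), e2, ← mul_assoc, hZ]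
  rw [val_append, val_append, val_append, hc', t1, t2, t3]
  have := hlocal (val id Z) (val id Z')
  change x * y * x = x * y at this
  calc a * k₁ * x * y * x * k = a * k₁ * (x * y * x) * k := by simp only [mul_assoc]
    _ = a * k₁ * x * y * k := by rw [this, ← mul_assoc (a * k₁)]

/-- A continuation `Q` of `P ++ c` that adds no new segments can be undone: a further word leads
back to `c` and to the value of `P ++ c`, again without new segments. -/
lemma exists_return [Finite S] (hloc : LocallyLeftRegular S) {n : ℕ} (hn : Nat.card S < n)
    (Q : List S) : ∀ (P c : List S), c.length = n →
    SegmentsSubset n (P ++ c ++ Q) (P ++ c) →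
    ∃ B : List S, c <:+ P ++ c ++ Q ++ B ∧ val id (P ++ c ++ Q ++ B) = val id (P ++ c) ∧
      SegmentsSubset n (P ++ c ++ Q ++ B) (P ++ c) := by
  induction Q with
  | nil =>
    exact fun P c _ _ =>
      ⟨[], by simp, by simp, by simp only [List.append_nil]; exact fun x _ h => h⟩
  | cons a Q ih =>
    intro P c hc hold
    -- Read one letter, and return: the letter was read after `c` before.
    obtain ⟨P₁, P₂, hP⟩ : c ++ [a] <:+: P ++ c :=
      hold _ (by simp [hc]) ⟨P, Q, by simp⟩
    have hcQ : c ++ (a :: P₂) <:+ P ++ c := ⟨P₁, by rw [← hP]; simp⟩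
    have hloop : c <:+ c ++ (a :: P₂) :=
      List.suffix_of_suffix_length_le (List.suffix_append _ _) hcQ (by simp)
    have hP' : P ++ c = P₁ ++ c ++ (a :: P₂) := by rw [← hP]; simp
    have hval₂ : val id (P ++ c ++ (a :: P₂)) = val id (P ++ c) := by
      have h0 := val_loops hloc (hc ▸ hn) hloop (Q' := []) (by simp) P₁
      simp only [List.append_nil] at h0
      rw [hP', h0]
    -- Then read the other letters.
    obtain ⟨P', c', hPc, hc'⟩ : ∃ P' c' : List S, P ++ c ++ [a] = P' ++ c' ∧ c'.length = n :=
      eq_append_of_length_le (by simp; omega)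
    have hsub : SegmentsSubset n (P' ++ c' ++ Q) (P' ++ c') := by
      rw [← hPc]
      refine SegmentsSubset.trans (v := P ++ c) ?_ (.of_infix ⟨[], [a], by simp⟩)
      simpa using hold
    obtain ⟨B, hB1, hB2, hB3⟩ := ih P' c' hc' hsub
    rw [← hPc] at hB1 hB2 hB3
    have hre : P ++ c ++ (a :: Q) ++ (B ++ P₂) = P ++ c ++ [a] ++ Q ++ B ++ P₂ := by simp
    obtain ⟨X, hX⟩ := hB1
    -- The word `P₂` is read after `c'`, as before.
    have hc'P : c <:+ c' ++ P₂ := by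
      have h1 : c <:+ P ++ c ++ [a] ++ P₂ := by
        have := hloop.trans (List.suffix_append P (c ++ (a :: P₂)))
        simpa using this
      refine List.suffix_of_suffix_length_le h1 ⟨P', ?_⟩ (by simp; omega)
      rw [hPc]; simp
    have hP₂ : SegmentsSubset n (P ++ c ++ [a] ++ P₂) (P ++ c) := by
      have h1 : SegmentsSubset n (P ++ c ++ (a :: P₂)) (P ++ c) :=
        .append hc (fun x _ h => h) (.of_infix hcQ.isInfix)
      simpa using h1
    refine ⟨B ++ P₂, ?_, ?_, ?_⟩
    · rw [hre, ← hX]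
      exact hc'P.trans ⟨X, by simp⟩
    · rw [hre, val_append, hB2, ← val_append, ← hval₂]
      simp
    · rw [hre, ← hX]
      refine .append hc' ?_ ?_
      · rw [hX]
        refine hB3.trans ?_
        refine SegmentsSubset.trans (.of_infix ?_) hP₂
        exact ⟨[], P₂, by simp⟩
      · refine SegmentsSubset.trans (.of_infix ⟨P', [], ?_⟩) hP₂
        rw [hPc]; simp

/-- A continuation `Q` that adds no new segments and returns to `c` does not change the value: with
the word `B` that undoes it, the identity equates the effects of `QBQ` and `QB`, and as `QB` has no
effect, neither has `Q`. -/
lemma val_append_loop [Finite S] (hloc : LocallyLeftRegular S) {n : ℕ} (hn : Nat.card S < n)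
    {P c Q : List S} (hc : c.length = n) (hold : SegmentsSubset n (P ++ c ++ Q) (P ++ c))
    (hQ : c <:+ P ++ c ++ Q) : val id (P ++ c ++ Q) = val id (P ++ c) := by
  obtain ⟨B, hB1, hB2, hB3⟩ := exists_return hloc hn Q P c hc hold
  have hQ' : c <:+ c ++ Q :=
    List.suffix_of_suffix_length_le hQ ⟨P, by simp⟩ (by simp)
  have hB' : c <:+ c ++ B := by
    obtain ⟨X, hX⟩ := hQ
    rw [← hX] at hB1
    exact List.suffix_of_suffix_length_le hB1 ⟨X, by simp⟩ (by simp)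
  have h := val_loops hloc (hc ▸ hn) hQ' hB' P
  rw [hB2, val_append _ _ Q, hB2, ← val_append] at h
  exact h

/-- The value of a word that is followed by segments that have occurred before depends only on the
last letters of the extension. -/
lemma val_append_eq_of_coterminal [Finite S] (hloc : LocallyLeftRegular S) {n : ℕ}
    (hn : Nat.card S < n) {P c Q Q' d : List S} (hc : c.length = n) (hd : d.length = n)
    (hQ : SegmentsSubset n (P ++ c ++ Q) (P ++ c)) (hQ' : SegmentsSubset n (P ++ c ++ Q') (P ++ c))
    (hdQ : d <:+ P ++ c ++ Q) (hdQ' : d <:+ P ++ c ++ Q') :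
    val id (P ++ c ++ Q) = val id (P ++ c ++ Q') := by
  obtain ⟨B, ⟨X, hX⟩, hB2, hB3⟩ := exists_return hloc hn Q P c hc hQ
  obtain ⟨Y, hY⟩ := hdQ
  have hdc : d <:+ c ++ Q' := List.suffix_of_suffix_length_le hdQ' ⟨P, by simp⟩ (by simp; omega)
  have h := val_append_loop hloc hn (P := Y) (c := d) (Q := B ++ Q') hd ?_ ?_
  · rw [hY, ← List.append_assoc, val_append, hB2, ← val_append] at h
    exact h.symm
  · rw [hY, ← List.append_assoc, ← hX]
    refine .append hc ?_ ?_
    · rw [hX]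
      exact hB3.trans (.of_infix ⟨[], Q, by simp⟩)
    · refine SegmentsSubset.trans (.of_infix ⟨P, [], by simp⟩)
        (hQ'.trans (.of_infix ⟨[], Q, by simp⟩))
  · rw [hY, ← List.append_assoc, ← hX]
    exact hdc.trans ⟨X, by simp⟩

/-- Prefixes of right equivalent words with the same segments and the same end have the same
value. -/
lemma val_eq_of_prefix [Finite S] (hloc : LocallyLeftRegular S) {n : ℕ} (hn : Nat.card S < n)
    {u v : List S} (hpre : u.take n = v.take n)
    (hord : ∀ x y : List S, x.length = n + 1 → y.length = n + 1 → x <:+: u → y <:+: u →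
      (∃ p, p <+: u ∧ x <:+: p ∧ ¬ y <:+: p) → ∃ p, p <+: v ∧ x <:+: p ∧ ¬ y <:+: p) :
    ∀ (N : ℕ) (p q c : List S), p.length ≤ N → c.length = n → p <+: u → q <+: v →
      SegmentsSubset n p q → SegmentsSubset n q p → c <:+ p → c <:+ q → val id p = val id q := by
  intro N
  induction N with
  | zero =>
    intro p q c hp hc _ _ _ _ hcp _
    have := hcp.length_le
    omega
  | succ N ih =>
    intro p q c hpN hc hpu hqv hpq hqp hcp hcq
    have hpl := hcp.length_le
    have hql := hcq.length_le
    -- A word of length `> n` has segments.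
    have hnon : ∀ p q : List S, n ≤ p.length → SegmentsSubset n q p → p.length = n →
        q.length ≤ n := by
      intro p q _ hqp hp
      by_contra hq
      push Not at hq
      have := (hqp (q.take (n + 1)) (by simp; omega) (List.take_prefix _ _).isInfix).length_le
      simp only [List.length_take] at this
      omega
    rcases eq_or_lt_of_le (hc ▸ hpl : n ≤ p.length) with hpn | hpn
    · have hqn : q.length = n :=
        le_antisymm (hnon p q hpn.le hqp hpn.symm) (hc ▸ hql)
      congr 1
      rw [List.prefix_iff_eq_take.1 hpu, List.prefix_iff_eq_take.1 hqv, ← hpn, hqn, hpre]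
    have hqn : n < q.length := by
      by_contra hq
      have := hnon q p (hc ▸ hql) hpq (le_antisymm (not_lt.1 hq) (hc ▸ hql))
      omega
    obtain ⟨P, f, a, Q, rfl, hf, hsub, hnew⟩ := exists_shortest_prefix hpn
    obtain ⟨P', f', a', Q', rfl, hf', hsub', hnew'⟩ := exists_shortest_prefix hqn
    have hfa : (f ++ [a]).length = n + 1 := by simp [hf]
    have hfa' : (f' ++ [a']).length = n + 1 := by simp [hf']
    have hpu' : P ++ f ++ [a] <+: u := (List.prefix_append _ _).trans hpu
    have hqv' : P' ++ f' ++ [a'] <+: v := (List.prefix_append _ _).trans hqv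
    have hi : f' ++ [a'] <:+: P ++ f ++ [a] :=
      hsub _ hfa' (hqp _ hfa' ⟨P', Q', by simp⟩)
    -- The last segment to appear is the same in both words.
    have heq : f' ++ [a'] = f ++ [a] := by
      by_contra hne
      have h1 : f' ++ [a'] <:+: P ++ f := by
        rcases infix_append_of_overlap (by omega) hi with h | h
        · exact h
        · exact absurd (h.eq_of_length (by omega)) hne
      obtain ⟨r, hr, hr1, hr2⟩ := hord _ _ hfa' hfa (hi.trans hpu'.isInfix)
        (List.IsInfix.trans ⟨P, [], by simp⟩ hpu'.isInfix)
        ⟨P ++ f, (List.prefix_append _ _).trans hpu', h1, hnew⟩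
      apply hr2
      have h2 : f ++ [a] <:+: P' ++ f' ++ [a'] :=
        hsub' _ hfa (hpq _ hfa ⟨P, Q, by simp⟩)
      rcases List.prefix_or_prefix_of_prefix hr hqv' with h3 | h3
      · rcases List.prefix_concat_iff.1 h3 with h4 | h4
        · rw [h4]; exact h2
        · exact absurd (hr1.trans h4.isInfix) hnew'
      · exact h2.trans h3.isInfix
    obtain ⟨rfl, ha⟩ := List.append_inj' heq rfl
    obtain rfl : a' = a := by simpa using ha
    -- The shorter prefixes have the same value by induction.
    have hstep : ∀ P P' : List S, SegmentsSubset n (P ++ f' ++ [a']) (P' ++ f' ++ [a']) →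
        ¬ f' ++ [a'] <:+: P ++ f' → SegmentsSubset n (P ++ f') (P' ++ f') := by
      intro P P' h h0 x hx hxi
      rcases infix_append_of_overlap (by omega)
        (h x hx (hxi.trans (List.prefix_append _ _).isInfix)) with h1 | h1
      · exact h1
      · rw [h1.eq_of_length (by omega)] at hxi
        exact absurd hxi h0
    have hPP' : SegmentsSubset n (P ++ f' ++ [a']) (P' ++ f' ++ [a']) :=
      SegmentsSubset.trans (.of_infix (List.prefix_append _ _).isInfix) (hpq.trans hsub')
    have hP'P : SegmentsSubset n (P' ++ f' ++ [a']) (P ++ f' ++ [a']) :=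
      SegmentsSubset.trans (.of_infix (List.prefix_append _ _).isInfix) (hqp.trans hsub)
    have hval : val id (P ++ f') = val id (P' ++ f') := by
      refine ih _ _ f' ?_ hf' ((List.prefix_append _ _).trans hpu')
        ((List.prefix_append _ _).trans hqv') (hstep _ _ hPP' hnew) (hstep _ _ hP'P hnew')
        (List.suffix_append _ _) (List.suffix_append _ _)
      simp only [List.length_append, List.length_singleton] at hpN ⊢
      omega
    have hval' : val id (P ++ f' ++ [a']) = val id (P' ++ f' ++ [a']) := by
      rw [val_append, hval, ← val_append]
    -- What follows consists of old segments.
    obtain ⟨b, d, hbd, hd⟩ : ∃ b d : List S, f' ++ [a'] = b ++ d ∧ d.length = n :=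
      eq_append_of_length_le (by omega)
    have hre : ∀ P Q : List S, P ++ f' ++ [a'] ++ Q = P ++ b ++ d ++ Q := by
      intro P Q
      rw [List.append_assoc P, hbd]; simp
    have hre0 : ∀ P : List S, P ++ f' ++ [a'] = P ++ b ++ d := by
      intro P
      rw [List.append_assoc P, hbd]; simp
    rw [hre, hre] at *
    rw [hre0, hre0] at *
    have hQ' : SegmentsSubset n (P ++ b ++ d ++ Q') (P ++ b ++ d) := by
      refine .append hd (fun x _ h => h) ?_
      refine SegmentsSubset.trans (.of_infix ⟨P' ++ b, [], by simp⟩) (hqp.trans hsub)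
    have hcQ' : c <:+ P ++ b ++ d ++ Q' := by
      have : c <:+ d ++ Q' :=
        List.suffix_of_suffix_length_le hcq ⟨P' ++ b, by simp⟩ (by simp; omega)
      exact this.trans ⟨P ++ b, by simp⟩
    rw [val_append_eq_of_coterminal hloc hn hd hc hsub hQ' hcp hcQ', val_append, hval',
      ← val_append]

/-- A finite semigroup whose local monoids satisfy `xyx = xy` is right locally testable, with
itself as the alphabet. -/
theorem LocallyLeftRegular.rightLocallyTestable [Finite S] (hloc : LocallyLeftRegular S) :
    RightLocallyTestable S := by
  set n := Nat.card S + 1 with hn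
  refine ⟨n + 1, by omega, S, inferInstance, FreeSemigroup.lift id,
    fun s => ⟨FreeSemigroup.of s, by simp⟩, ?_⟩
  rintro u v ⟨hpre, hsuf, hseg, hord⟩
  simp only [prefixWord, suffixWord, Nat.add_sub_cancel] at hpre hsuf
  have hseg' : ∀ x : List S, x.length = n + 1 → (x <:+: letters u ↔ x <:+: letters v) := by
    intro x hx
    have := Set.ext_iff.1 hseg x
    simpa [segments, hx] using this
  -- Short words are determined by their prefixes.
  have hshort : ∀ u v : List S, (∀ x : List S, x.length = n + 1 → (x <:+: u ↔ x <:+: v)) →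
      u.length ≤ n → v.length ≤ n := by
    intro u v h hu
    by_contra hv
    push Not at hv
    have := ((h (v.take (n + 1)) (by simp; omega)).2 (List.take_prefix _ _).isInfix).length_le
    simp only [List.length_take] at this
    omega
  rcases le_or_gt (letters u).length n with hu | hu
  · have hv := hshort _ _ hseg' hu
    rw [List.take_of_length_le hu, List.take_of_length_le hv] at hpre
    rw [letters_injective hpre]
  have hv : n < (letters v).length := by
    by_contra hv
    exact absurd (hshort _ _ (fun x hx => (hseg' x hx).symm) (not_lt.1 hv)) (by omega)
  apply WithOne.coe_inj.1
  rw [coe_map_eq_val, coe_map_eq_val]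
  refine val_eq_of_prefix hloc (n := n) (by omega) hpre ?_ _ (letters u) (letters v)
    ((letters u).drop ((letters u).length - n)) le_rfl (by simp; omega) List.prefix_rfl
    List.prefix_rfl (fun x hx => (hseg' x hx).1) (fun x hx => (hseg' x hx).2)
    (List.drop_suffix _ _) (hsuf ▸ List.drop_suffix _ _)
  intro x y hx hy hxu hyu h
  exact (hord x ⟨hx, hxu⟩ y ⟨hy, hyu⟩).1 h

end LeftRegular

/-- Right local testability of a finite semigroup is an identity in the local monoids. -/
theorem rightLocallyTestable_iff (S : Type) [Semigroup S] [Finite S] :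
    RightLocallyTestable S ↔ LocallyLeftRegular S :=
  ⟨fun ⟨_, hk, h⟩ => h.locallyLeftRegular hk, fun h => h.rightLocallyTestable⟩

/-! #### Reversal of words -/

section Reversal

open MulOpposite

variable {S : Type} [Semigroup S]

/-- The words read from right to left. -/
noncomputable def reverseWord {A : Type} (w : FreeSemigroup A) : FreeSemigroup A :=
  (exists_letters_eq (l := (letters w).reverse) (by simp [letters])).choose

@[simp] lemma letters_reverseWord {A : Type} (w : FreeSemigroup A) :
    letters (reverseWord w) = (letters w).reverse :=
  (exists_letters_eq (l := (letters w).reverse) (by simp [letters])).choose_spec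

lemma infix_reverse_iff {A : Type} (x y : List A) : x <:+: y.reverse ↔ x.reverse <:+: y := by
  rw [← List.reverse_infix, List.reverse_reverse]

/-- The reversal of words exchanges prefixes with suffixes, and thereby left with right equivalence.
-/
lemma leftEquivalent_iff {A : Type} (k : ℕ) (u v : FreeSemigroup A) :
    LeftEquivalent k u v ↔ RightEquivalent k (reverseWord u) (reverseWord v) := by
  have hpre : ∀ (j : ℕ) (w : FreeSemigroup A),
      prefixWord j (reverseWord w) = (suffixWord j w).reverse := by
    intro j w
    simp [prefixWord, suffixWord, List.take_reverse]
  have hsuf : ∀ (j : ℕ) (w : FreeSemigroup A),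
      suffixWord j (reverseWord w) = (prefixWord j w).reverse := by
    intro j w
    simp only [prefixWord, suffixWord, letters_reverseWord, List.drop_reverse, List.length_reverse]
    congr 1
    rcases le_total j (letters w).length with h | h
    · rw [Nat.sub_sub_self h]
    · rw [Nat.sub_eq_zero_of_le h, List.take_of_length_le h, List.take_of_length_le (by omega)]
  have hseg : ∀ (w : FreeSemigroup A) (x : List A),
      x ∈ segments k (reverseWord w) ↔ x.reverse ∈ segments k w := by
    intro w x
    simp [segments, infix_reverse_iff]
  have happ : ∀ (w : FreeSemigroup A) (x y : List A),
      AppearsBeforeInPrefixes (reverseWord w) x y ↔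
        AppearsBeforeInSuffixes w x.reverse y.reverse := by
    intro w x y
    constructor
    · rintro ⟨p, hp, hx, hy⟩
      refine ⟨p.reverse, ?_, by simpa using hx, by simpa using hy⟩
      rw [← List.reverse_prefix]
      simpa using hp
    · rintro ⟨p, hp, hx, hy⟩
      refine ⟨p.reverse, by simpa using hp, ?_, ?_⟩
      · rwa [infix_reverse_iff]
      · rwa [infix_reverse_iff]
  simp only [LeftEquivalent, RightEquivalent, hpre, hsuf, List.reverse_inj, happ, hseg]
  constructor
  · rintro ⟨h1, h2, h3, h4⟩
    exact ⟨h2, h1, Set.ext fun x => by rw [hseg, hseg, h3], fun x hx y hy => h4 _ hx _ hy⟩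
  · rintro ⟨h1, h2, h3, h4⟩
    refine ⟨h2, h1, Set.ext fun x => ?_, fun x hx y hy => ?_⟩
    · have := Set.ext_iff.1 h3 x.reverse
      rwa [hseg, hseg, List.reverse_reverse] at this
    · have := h4 x.reverse (by simpa using hx) y.reverse (by simpa using hy)
      simpa using this

lemma reverseWord_reverseWord {A : Type} (w : FreeSemigroup A) :
    reverseWord (reverseWord w) = w := letters_injective (by simp)

lemma reverseWord_mul {A : Type} (u v : FreeSemigroup A) :
    reverseWord (u * v) = reverseWord v * reverseWord u := letters_injective (by simp)

theorem leftTestable_iff_op (k : ℕ) : LeftTestable k S ↔ RightTestable k Sᵐᵒᵖ := by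
  constructor
  · rintro ⟨A, hA, φ, hφ, h⟩
    refine ⟨A, hA, ⟨fun w => op (φ (reverseWord w)), fun u v => ?_⟩, fun s => ?_, fun u v huv => ?_⟩
    · simp [reverseWord_mul]
    · obtain ⟨w, hw⟩ := hφ s.unop
      exact ⟨reverseWord w, by simp [reverseWord_reverseWord, hw]⟩
    · refine congrArg op (h _ _ ?_)
      rw [leftEquivalent_iff, reverseWord_reverseWord, reverseWord_reverseWord]
      exact huv
  · rintro ⟨A, hA, φ, hφ, h⟩
    refine ⟨A, hA, ⟨fun w => unop (φ (reverseWord w)), fun u v => ?_⟩, fun s => ?_,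
      fun u v huv => ?_⟩
    · simp [reverseWord_mul]
    · obtain ⟨w, hw⟩ := hφ (op s)
      exact ⟨reverseWord w, by simp [reverseWord_reverseWord, hw]⟩
    · exact congrArg unop (h _ _ ((leftEquivalent_iff k u v).1 huv))

theorem leftLocallyTestable_iff_op : LeftLocallyTestable S ↔ RightLocallyTestable Sᵐᵒᵖ := by
  simp only [LeftLocallyTestable, RightLocallyTestable, leftTestable_iff_op]

theorem leftLocallyTestable_iff (S : Type) [Semigroup S] [Finite S] :
    LeftLocallyTestable S ↔ LocallyRightRegular S := by
  have : Finite Sᵐᵒᵖ := Finite.of_equiv S opEquiv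
  rw [leftLocallyTestable_iff_op, rightLocallyTestable_iff]
  constructor
  · intro h e he s t
    have := congrArg unop (h (op e) (congrArg op he.eq) (op s) (op t))
    simpa [mul_assoc] using this
  · intro h e he s t
    apply unop_injective
    have := h (unop e) (congrArg unop he.eq) (unop s) (unop t)
    simpa [mul_assoc] using this

end Reversal

end LocalTestability

namespace LocalTestability

/-! ### Transition semigroups and paths in powers of the transition graph -/

/-- A finite semigroup contains an idempotent with every property of `s` that is preserved by
multiplication with `s`. -/
lemma exists_idempotent_of_closed {S : Type} [Semigroup S] [Finite S] (s : S) :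
    ∃ e : S, IsIdempotentElem e ∧
      ∀ Q : S → Prop, Q s → (∀ t, Q t → Q (t * s)) → Q e := by
  obtain ⟨e, m, he, hem⟩ := exists_idempotent_pow s
  refine ⟨e, he, fun Q h1 h2 => ?_⟩
  clear he
  induction m generalizing e with
  | zero =>
    rw [zero_add, pow_one, WithOne.coe_inj] at hem
    rwa [hem]
  | succ m ih =>
    obtain ⟨t, ht⟩ : ∃ t : S, (t : WithOne S) = (s : WithOne S) ^ (m + 1) := by
      clear ih hem
      induction m with
      | zero => exact ⟨s, by simp⟩
      | succ m ih =>
        obtain ⟨t, ht⟩ := ih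
        exact ⟨t * s, by rw [WithOne.coe_mul, ht, ← pow_succ]⟩
    rw [pow_succ, ← ht, ← WithOne.coe_mul, WithOne.coe_inj] at hem
    rw [hem]
    exact h2 t (ih t ht)

namespace TransitionGraph

variable (G : TransitionGraph)

instance : Finite G.transitionSemigroup :=
  have : Finite (PartialMap (Fin G.nodes)) :=
    inferInstanceAs (Finite (Fin G.nodes → Option (Fin G.nodes)))
  inferInstance

/-- The node that is reached after reading a letter; `none` stands for a dead state. -/
def next (a : Option (Fin G.nodes)) (σ : Fin G.alphabet) : Option (Fin G.nodes) :=
  a.bind fun p => G.step p σ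

/-- The node that is reached after reading a word. -/
def read (a : Option (Fin G.nodes)) (w : List (Fin G.alphabet)) : Option (Fin G.nodes) :=
  w.foldl G.next a

variable {G}

@[simp] lemma read_nil (a : Option (Fin G.nodes)) : G.read a [] = a := rfl

@[simp] lemma read_cons (a : Option (Fin G.nodes)) (σ : Fin G.alphabet)
    (w : List (Fin G.alphabet)) : G.read a (σ :: w) = G.read (G.next a σ) w := rfl

@[simp] lemma read_append (a : Option (Fin G.nodes)) (v w : List (Fin G.alphabet)) :
    G.read a (v ++ w) = G.read (G.read a v) w := List.foldl_append ..

@[simp] lemma read_none (w : List (Fin G.alphabet)) : G.read none w = none := by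
  induction w with
  | nil => rfl
  | cons σ w ih => exact ih

/-- The action of the transition semigroup on the nodes and the dead state. -/
def apply (a : Option (Fin G.nodes)) (s : G.transitionSemigroup) : Option (Fin G.nodes) :=
  a.bind s.1

@[simp] lemma apply_none (s : G.transitionSemigroup) : apply none s = none := rfl

lemma apply_mul (a : Option (Fin G.nodes)) (s t : G.transitionSemigroup) :
    apply a (s * t) = apply (apply a s) t := by
  cases a with
  | none => rfl
  | some p => rfl

lemma ext_apply {s t : G.transitionSemigroup} (h : ∀ p, apply (some p) s = apply (some p) t) :
    s = t := Subtype.ext (funext h)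

/-- Every element of the transition semigroup is the action of a nonempty word. -/
lemma exists_word (s : G.transitionSemigroup) :
    ∃ w : List (Fin G.alphabet), w ≠ [] ∧ ∀ a, apply a s = G.read a w := by
  obtain ⟨s, hs⟩ := s
  induction hs using Subsemigroup.closure_induction with
  | mem s hs =>
    obtain ⟨σ, rfl⟩ := hs
    exact ⟨[σ], by simp, fun a => rfl⟩
  | mul s t hs ht ihs iht =>
    obtain ⟨v, hv, hv'⟩ := ihs
    obtain ⟨w, hw, hw'⟩ := iht
    refine ⟨v ++ w, by simp [hv], fun a => ?_⟩
    rw [read_append, ← hv', ← hw', ← apply_mul]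
    rfl

/-- Every nonempty word acts as an element of the transition semigroup. -/
lemma exists_element {w : List (Fin G.alphabet)} (hw : w ≠ []) :
    ∃ s : G.transitionSemigroup, ∀ a, apply a s = G.read a w := by
  have hletter : ∀ σ, ∃ s : G.transitionSemigroup, ∀ a, apply a s = G.next a σ := fun σ =>
    ⟨⟨G.letterMap σ, Subsemigroup.subset_closure ⟨σ, rfl⟩⟩, fun a => rfl⟩
  induction w with
  | nil => exact absurd rfl hw
  | cons σ w ih =>
    obtain ⟨s, hs⟩ := hletter σ
    rcases eq_or_ne w [] with rfl | hw'
    · exact ⟨s, hs⟩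
    · obtain ⟨t, ht⟩ := ih hw'
      exact ⟨s * t, fun a => by rw [apply_mul, hs, ht, read_cons]⟩

/-- An idempotent that fixes all states at which a given nonempty word has a loop, so that loops can
be replaced by idempotents. -/
lemma exists_idempotent_fixing {w : List (Fin G.alphabet)} (hw : w ≠ []) :
    ∃ e : G.transitionSemigroup, IsIdempotentElem e ∧ ∀ a, G.read a w = a → apply a e = a := by
  obtain ⟨s, hs⟩ := exists_element hw
  obtain ⟨e, he, h⟩ := exists_idempotent_of_closed s
  refine ⟨e, he, h (fun e => ∀ a, G.read a w = a → apply a e = a) (fun a ha => by rw [hs, ha])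
    fun t ht a ha => by rw [apply_mul, ht a ha, hs, ha]⟩

lemma apply_apply_of_idempotent {e : G.transitionSemigroup} (he : IsIdempotentElem e)
    (a : Option (Fin G.nodes)) : apply (apply a e) e = apply a e := by
  rw [← apply_mul, he.eq]

variable (G)

/-- Some nonempty word fixes the three states. -/
def Loop (a b c : Option (Fin G.nodes)) : Prop :=
  ∃ w : List (Fin G.alphabet), w ≠ [] ∧ G.read a w = a ∧ G.read b w = b ∧ G.read c w = c

/-- Some word leads from the first state of the first pair to the first state of the second pair,
and likewise for the second states. -/
def PairPath (a b a' b' : Option (Fin G.nodes)) : Prop :=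
  ∃ w : List (Fin G.alphabet), G.read a w = a' ∧ G.read b w = b'

/-- The second state can be reached from the first. -/
def Reaches (a b : Option (Fin G.nodes)) : Prop := ∃ w : List (Fin G.alphabet), G.read a w = b

variable {G}

/-- The transition semigroup is locally idempotent iff there is no word that leads from `p` to `q`
and from `q` to `r ≠ q`, where some word loops at `p`, at `q` and at `r`. -/
theorem locallyIdempotent_iff : LocallyIdempotent G.transitionSemigroup ↔
    ∀ (p q : Fin G.nodes) (r : Option (Fin G.nodes)), G.Loop (some p) (some q) r →
      G.PairPath (some p) (some q) (some q) r → r = some q := by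
  constructor
  · rintro h p q r ⟨v, hv, hp, hq, hr⟩ ⟨w, hw, hw'⟩
    rcases eq_or_ne w [] with rfl | hne
    · rw [read_nil] at hw'
      exact hw'.symm
    obtain ⟨e, he, hfix⟩ := exists_idempotent_fixing hv
    obtain ⟨s, hs⟩ := exists_element hne
    have h1 : apply (some p) (e * s * e) = some q := by
      rw [apply_mul, apply_mul, hfix _ hp, hs, hw, hfix _ hq]
    have h2 : apply (some q) (e * s * e) = r := by
      rw [apply_mul, apply_mul, hfix _ hq, hs, hw', hfix _ hr]
    have h3 := congrArg (apply (some p)) (h e he s).eq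
    rwa [apply_mul, h1, h2] at h3
  · intro h e he s
    apply ext_apply
    intro p₀
    obtain ⟨v, hv, hve⟩ := exists_word e
    obtain ⟨w, hw, hws⟩ := exists_word s
    rw [apply_mul]
    have hfix : ∀ a, apply a (e * s * e) = G.read (apply a e) (w ++ v) := fun a => by
      rw [apply_mul, apply_mul, hws, hve, read_append]
    have hidem : ∀ a, G.read (apply a (e * s * e)) v = apply a (e * s * e) := fun a => by
      rw [← hve, apply_mul, apply_apply_of_idempotent he]
    rcases hq : apply (some p₀) (e * s * e) with _ | q
    · rfl
    have hqe : apply (some q) e = some q := by rw [hve, ← hq, hidem]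
    rcases hp : apply (some p₀) e with _ | p
    · rw [hfix, hp, read_none] at hq
      exact absurd hq (by simp)
    refine h p q _ ⟨v, hv, ?_, ?_, hidem _⟩ ⟨w ++ v, ?_, ?_⟩
    · rw [← hp, ← hve, apply_apply_of_idempotent he]
    · rw [← hve, hqe]
    · rw [← hq, hfix, hp]
    · rw [hfix, hqe]

/-- The second condition excludes an element `x` with `p ↦ q` and `r ↦ r` and an element `y` with
`p ↦ r` and `q ↦ q` in a local monoid; for these, `xyx` maps `p` to `q`, and `yx` maps `p` to `r`.
-/
theorem locallyRightRegular_iff : LocallyRightRegular G.transitionSemigroup ↔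
    LocallyIdempotent G.transitionSemigroup ∧
    ∀ (p q : Fin G.nodes) (r : Option (Fin G.nodes)), G.Loop (some p) (some q) r →
      G.PairPath (some p) r (some q) r → G.PairPath (some q) (some p) (some q) r →
      r = some q := by
  constructor
  · intro h
    have hidem : LocallyIdempotent G.transitionSemigroup := by
      intro e he s
      have := h e he s e
      have h1 : e * e * e = e := by rw [he.eq, he.eq]
      have h2 : e * s * e * e = e * s * e := by rw [mul_assoc, he.eq]
      have h3 : e * (e * s * e) = e * s * e := by rw [← mul_assoc, ← mul_assoc, he.eq]
      rwa [h1, h2, h3] at this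
    refine ⟨hidem, ?_⟩
    rintro p q r ⟨v, hv, hp, hq, hr⟩ ⟨w, hw, hw'⟩ ⟨u, hu, hu'⟩
    rcases eq_or_ne w [] with rfl | hw0
    · rw [read_nil] at hw
      rw [hw, hu] at hu'
      exact hu'.symm
    rcases eq_or_ne u [] with rfl | hu0
    · rw [read_nil] at hu'
      rw [← hu', hw] at hw'
      exact hu'.symm.trans hw'.symm
    obtain ⟨e, he, hfix⟩ := exists_idempotent_fixing hv
    obtain ⟨s, hs⟩ := exists_element hw0
    obtain ⟨t, ht⟩ := exists_element hu0
    have x1 : apply (some p) (e * s * e) = some q := by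
      rw [apply_mul, apply_mul, hfix _ hp, hs, hw, hfix _ hq]
    have x2 : apply r (e * s * e) = r := by
      rw [apply_mul, apply_mul, hfix _ hr, hs, hw', hfix _ hr]
    have y1 : apply (some p) (e * t * e) = r := by
      rw [apply_mul, apply_mul, hfix _ hp, ht, hu', hfix _ hr]
    have y2 : apply (some q) (e * t * e) = some q := by
      rw [apply_mul, apply_mul, hfix _ hq, ht, hu, hfix _ hq]
    have x3 : apply (some q) (e * s * e) = some q := by
      rw [← x1, ← apply_mul, (hidem e he s).eq]
    have := congrArg (apply (some p)) (h e he s t)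
    rw [apply_mul _ (e * s * e * (e * t * e)), apply_mul _ (e * s * e) (e * t * e),
      apply_mul _ (e * t * e) (e * s * e), x1, y2, x3, y1, x2] at this
    exact this.symm
  · rintro ⟨hidem, h⟩ e he s t
    obtain ⟨v, hv, hve⟩ := exists_word e
    obtain ⟨ws, -, hws⟩ := exists_word s
    obtain ⟨wt, -, hwt⟩ := exists_word t
    have hx := (hidem e he s).eq
    have hex : e * (e * s * e) = e * s * e := by rw [← mul_assoc, ← mul_assoc, he.eq]
    have hey : e * (e * t * e) = e * t * e := by rw [← mul_assoc, ← mul_assoc, he.eq]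
    have hxe : e * s * e * e = e * s * e := by rw [mul_assoc, he.eq]
    have hxy := (hidem e he (t * e * s)).eq
    have hyx : e * (t * e * s) * e = (e * t * e) * (e * s * e) := by
      calc e * (t * e * s) * e = e * t * e * s * e := by simp only [mul_assoc]
        _ = e * t * (e * e) * s * e := by rw [he.eq]
        _ = _ := by simp only [mul_assoc]
    rw [hyx] at hxy
    obtain ⟨wx, hwx⟩ : ∃ w, ∀ a, apply a (e * s * e) = G.read a w := by
      obtain ⟨w, -, hw⟩ := exists_word (e * s * e); exact ⟨w, hw⟩
    obtain ⟨wy, hwy⟩ : ∃ w, ∀ a, apply a (e * t * e) = G.read a w := by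
      obtain ⟨w, -, hw⟩ := exists_word (e * t * e); exact ⟨w, hw⟩
    set x := e * s * e
    set y := e * t * e
    clear_value x y
    -- The elements `yx` and `xyx` are idempotents, and both fix the images of `p₀` under `yx` and `xyx`.
    apply ext_apply
    intro p₀
    have hp₀ : ∀ z : G.transitionSemigroup, e * z = z →
        apply (some p₀) z = apply (apply (some p₀) e) z := fun z hz => by rw [← apply_mul, hz]
    have hfixe : ∀ a, apply a e = G.read a v := hve
    rw [hp₀ (x * y * x) (by rw [← mul_assoc, ← mul_assoc, hex]), hp₀ (y * x) (by
      rw [← mul_assoc, hey])]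
    rcases hp : apply (some p₀) e with _ | p
    · rfl
    have hpe : G.read (some p) v = some p := by
      rw [← hfixe, ← hp, apply_apply_of_idempotent he]
    have hend : ∀ z : G.transitionSemigroup, ∀ a, G.read (apply a (z * x)) v = apply a (z * x) := by
      intro z a
      rw [← hfixe, ← apply_mul, mul_assoc, hxe]
    have hα := hend y (some p)
    have hβ := hend (x * y) (some p)
    have e1 : y * x * (x * y * x) = y * x := by
      calc y * x * (x * y * x) = y * (x * x) * y * x := by simp only [mul_assoc]
        _ = (y * x) * (y * x) := by rw [hx]; simp only [mul_assoc]
        _ = y * x := hxy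
    have e2 : x * y * x * (y * x) = x * y * x := by
      rw [mul_assoc x y x, mul_assoc x, hxy]
    have hw1 : ∀ a, apply a (y * x) = G.read a (wy ++ wx) := fun a => by
      rw [apply_mul, hwy, hwx, read_append]
    have hw2 : ∀ a, apply a (x * y * x) = G.read a (wx ++ wy ++ wx) := fun a => by
      rw [apply_mul, apply_mul, hwx, hwy, hwx, read_append, read_append]
    rcases hα' : apply (some p) (y * x) with _ | α
    · rcases hβ' : apply (some p) (x * y * x) with _ | β
      · rfl
      · have := h p β none ⟨v, hv, hpe, by rw [← hβ', hβ], by simp⟩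
          ⟨wx ++ wy ++ wx, by rw [← hw2, hβ'], by simp⟩
          ⟨wy ++ wx, by rw [← hw1, ← hβ', ← apply_mul, e2], by rw [← hw1, hα']⟩
        exact this.symm
    · refine h p α _ ⟨v, hv, hpe, by rw [← hα', hα], hβ⟩
        ⟨wy ++ wx, by rw [← hw1, hα'], by rw [← hw1, ← apply_mul, e2]⟩
        ⟨wx ++ wy ++ wx, by rw [← hw2, ← hα', ← apply_mul, e1], by rw [← hw2]⟩

/-- The conditions concern nodes `p` and `q` that are fixed by a common word: if each can be reached
from the other, they are equal; and if `q` can be reached after reading a word from `p`, then it can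
be reached after reading this word from `q`. -/
theorem locallyLeftRegular_iff : LocallyLeftRegular G.transitionSemigroup ↔
    (∀ p q : Fin G.nodes, G.Loop (some p) (some q) none → G.Reaches (some p) (some q) →
      G.Reaches (some q) (some p) → p = q) ∧
    (∀ p q : Fin G.nodes, G.Loop (some p) (some q) none → ∀ w,
      G.Reaches (G.read (some p) w) (some q) → G.Reaches (G.read (some q) w) (some q)) := by
  constructor
  · intro h
    constructor
    · rintro p q ⟨v, hv, hp, hq, -⟩ ⟨w, hw⟩ ⟨u, hu⟩
      rcases eq_or_ne w [] with rfl | hw0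
      · exact Option.some_injective _ hw
      rcases eq_or_ne u [] with rfl | hu0
      · exact (Option.some_injective _ hu).symm
      obtain ⟨e, he, hfix⟩ := exists_idempotent_fixing hv
      obtain ⟨s, hs⟩ := exists_element hw0
      obtain ⟨t, ht⟩ := exists_element hu0
      have x1 : apply (some p) (e * s * e) = some q := by
        rw [apply_mul, apply_mul, hfix _ hp, hs, hw, hfix _ hq]
      have y1 : apply (some q) (e * t * e) = some p := by
        rw [apply_mul, apply_mul, hfix _ hq, ht, hu, hfix _ hp]
      have := congrArg (apply (some p)) (h e he s t)
      rw [apply_mul _ (e * s * e * (e * t * e)), apply_mul _ (e * s * e) (e * t * e), x1, y1,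
        x1] at this
      exact (Option.some_injective _ this).symm
    · rintro p q ⟨v, hv, hp, hq, -⟩ w ⟨z, hz⟩
      rcases eq_or_ne (w ++ z) [] with h0 | hw0
      · obtain ⟨rfl, rfl⟩ := List.append_eq_nil_iff.1 h0
        exact ⟨[], rfl⟩
      obtain ⟨e, he, hfix⟩ := exists_idempotent_fixing hv
      obtain ⟨s, hs⟩ := exists_element hw0
      obtain ⟨u, -, hu⟩ := exists_word e
      have x1 : apply (some p) (e * s * e) = some q := by
        rw [apply_mul, apply_mul, hfix _ hp, hs, read_append, hz, hfix _ hq]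
      have e1 : apply (some q) (e * e * e) = some q := by
        rw [he.eq, he.eq, hfix _ hq]
      have := congrArg (apply (some p)) (h e he s e)
      rw [apply_mul _ (e * s * e * (e * e * e)), apply_mul _ (e * s * e) (e * e * e), x1, e1,
        apply_mul, apply_mul, hfix _ hq, hs, read_append] at this
      refine ⟨z ++ u, ?_⟩
      rw [read_append, ← hu, this]
  · rintro ⟨h1, h2⟩ e he s t
    obtain ⟨v, hv, hve⟩ := exists_word e
    have hex : e * (e * s * e) = e * s * e := by rw [← mul_assoc, ← mul_assoc, he.eq]
    have hxe : e * s * e * e = e * s * e := by rw [mul_assoc, he.eq]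
    have hye : e * t * e * e = e * t * e := by rw [mul_assoc, he.eq]
    obtain ⟨wx, -, hwx⟩ := exists_word (e * s * e)
    obtain ⟨wy, -, hwy⟩ := exists_word (e * t * e)
    set x := e * s * e
    set y := e * t * e
    clear_value x y
    apply ext_apply
    intro p₀
    rcases hq : apply (some p₀) (x * y) with _ | q
    · rw [apply_mul, hq, apply_none]
    rcases hp : apply (some p₀) e with _ | p
    · rw [← hex, mul_assoc, apply_mul, hp, apply_none] at hq
      exact absurd hq (by simp)
    have hpq : apply (some p) (x * y) = some q := by
      rw [← hq, ← hp, ← apply_mul, ← mul_assoc, hex]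
    have hpe : apply (some p) e = some p := by rw [← hp, apply_apply_of_idempotent he]
    have hqe : apply (some q) e = some q := by rw [← hq, ← apply_mul, mul_assoc, hye]
    rw [apply_mul, hq]
    have hpath := h2 p q ⟨v, hv, by rw [← hve, hpe], by rw [← hve, hqe], by simp⟩ wx
      ⟨wy, by rw [← hwx, ← hwy, ← apply_mul, hpq]⟩
    rw [← hwx] at hpath
    rcases hr : apply (some q) x with _ | r
    · obtain ⟨w, hw⟩ := hpath
      rw [hr, read_none] at hw
      exact absurd hw (by simp)
    have hre : apply (some r) e = some r := by rw [← hr, ← apply_mul, hxe]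
    rw [hr] at hpath
    rw [h1 q r ⟨v, hv, by rw [← hve, hqe], by rw [← hve, hre], by simp⟩ ⟨wx, by rw [← hwx, hr]⟩
      hpath]

end TransitionGraph

end LocalTestability

namespace RAM

/-! ### A structured language and its translation into programs -/

/-- Terms over the input and over arrays, which are named by the elements of `R`. -/
inductive Term (R : Type) : Type
  | const (c : ℕ)
  | input (a : Term R)
  | cell (j : R) (i : Term R)
  | add (a b : Term R)
  | sub (a b : Term R)
  | mul (a b : Term R)
  | div (a b : Term R)

/-- The contents of the arrays. -/
abbrev Store (R : Type) : Type := R → ℕ → ℕ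

/-- Structured programs: assignments `j[i] := e`, sequences, tests (of a number against `0`), and
loops in which the cell `j[0]` runs through the numbers below the initial value of a term. -/
inductive Code (R : Type) : Type
  | skip
  | set (j : R) (i e : Term R)
  | seq (P Q : Code R)
  | ite (e : Term R) (P Q : Code R)
  | loop (j : R) (n : Term R) (P : Code R)

/-- The value of a term; the input is followed by zeros. -/
def Term.eval {R : Type} (I : List ℕ) (s : Store R) : Term R → ℕ
  | const c => c
  | input a => I.getD (a.eval I s) 0
  | cell j i => s j (i.eval I s)
  | add a b => a.eval I s + b.eval I s
  | sub a b => a.eval I s - b.eval I s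
  | mul a b => a.eval I s * b.eval I s
  | div a b => a.eval I s / b.eval I s

section Semantics

variable {R : Type} [DecidableEq R]

/-- The store after writing `v` into the cell `j[i]`. -/
def Store.set (s : Store R) (j : R) (i v : ℕ) : Store R :=
  fun j' i' => if j' = j ∧ i' = i then v else s j' i'

/-- The result of applying `f 0`, then `f 1`, up to `f (n - 1)`. -/
def iter {α : Type} (f : ℕ → α → α) : ℕ → α → α
  | 0, s => s
  | n + 1, s => f n (iter f n s)

namespace Code

/-- The store after the execution of a structured program. -/
def run (I : List ℕ) : Code R → Store R → Store R
  | skip, s => s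
  | set j i e, s => s.set j (i.eval I s) (e.eval I s)
  | seq P Q, s => Q.run I (P.run I s)
  | ite e P Q, s => if e.eval I s ≠ 0 then P.run I s else Q.run I s
  | loop j n P, s => iter (fun i s => P.run I (s.set j 0 i)) (n.eval I s) s

/-- The number of elementary steps of a structured program. -/
def ticks (I : List ℕ) : Code R → Store R → ℕ
  | skip, _ => 1
  | set _ _ _, _ => 1
  | seq P Q, s => P.ticks I s + Q.ticks I (P.run I s)
  | ite e P Q, s => 1 + if e.eval I s ≠ 0 then P.ticks I s else Q.ticks I s
  | loop j n P, s => 1 + ∑ i ∈ Finset.range (n.eval I s),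
      (1 + P.ticks I ((iter (fun i s => P.run I (s.set j 0 i)) i s).set j 0 i))

/-- The arrays that a structured program may change. -/
def writes : Code R → List R
  | skip => []
  | set j _ _ => [j]
  | seq P Q => P.writes ++ Q.writes
  | ite _ P Q => P.writes ++ Q.writes
  | loop j _ P => j :: P.writes

lemma run_of_notMem_writes (I : List ℕ) (P : Code R) (s : Store R) {j : R} (hj : j ∉ P.writes) :
    P.run I s j = s j := by
  induction P generalizing s with
  | skip => rfl
  | set k i e =>
    funext n
    simp only [writes, List.mem_singleton] at hj
    simp [run, Store.set, hj]
  | seq P Q ihP ihQ =>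
    simp only [writes, List.mem_append, not_or] at hj
    rw [run, ihQ _ hj.2, ihP _ hj.1]
  | ite e P Q ihP ihQ =>
    simp only [writes, List.mem_append, not_or] at hj
    rw [run]
    split
    · exact ihP _ hj.1
    · exact ihQ _ hj.2
  | loop k n P ih =>
    simp only [writes, List.mem_cons, not_or] at hj
    rw [run]
    generalize n.eval I s = n
    induction n with
    | zero => rfl
    | succ n ihn =>
      rw [iter, ih _ hj.2]
      funext i
      simp [Store.set, hj.1, ihn]

/-- `P` needs at most `T` steps from the store `s`, and then `Q` holds. -/
def Spec (I : List ℕ) (P : Code R) (s : Store R) (T : ℕ) (Q : Store R → Prop) : Prop :=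
  P.ticks I s ≤ T ∧ Q (P.run I s)

variable {I : List ℕ}

/-- The rule of consequence. Arrays that `P` does not write keep their contents; this may be used in
the derivation of the new postcondition. -/
lemma Spec.mono {P : Code R} {s : Store R} {T T' : ℕ} {Q Q' : Store R → Prop}
    (h : P.Spec I s T Q) (hT : T ≤ T')
    (hQ : ∀ s', (∀ j, j ∉ P.writes → s' j = s j) → Q s' → Q' s') : P.Spec I s T' Q' :=
  ⟨h.1.trans hT, hQ _ (fun _ hj => run_of_notMem_writes I P s hj) h.2⟩

lemma Spec.skip {s : Store R} {Q : Store R → Prop} (h : Q s) : Code.skip.Spec I s 1 Q :=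
  ⟨le_rfl, h⟩

lemma Spec.set {j : R} {i e : Term R} {s : Store R} {Q : Store R → Prop}
    (h : Q (s.set j (i.eval I s) (e.eval I s))) : (Code.set j i e).Spec I s 1 Q :=
  ⟨le_rfl, h⟩

/-- The rule for sequences; the second program may rely on the arrays that the first one does not
write. -/
lemma Spec.seq {P P' : Code R} {s : Store R} {T T' : ℕ} {Q Q' : Store R → Prop}
    (h : P.Spec I s T Q)
    (h' : ∀ s', (∀ j, j ∉ P.writes → s' j = s j) → Q s' → P'.Spec I s' T' Q') :
    (P.seq P').Spec I s (T + T') Q' := by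
  have := h' _ (fun _ hj => run_of_notMem_writes I P s hj) h.2
  exact ⟨add_le_add h.1 this.1, this.2⟩

lemma Spec.ite {e : Term R} {P P' : Code R} {s : Store R} {T : ℕ} {Q : Store R → Prop}
    (h : e.eval I s ≠ 0 → P.Spec I s T Q) (h' : e.eval I s = 0 → P'.Spec I s T Q) :
    (Code.ite e P P').Spec I s (1 + T) Q := by
  rcases eq_or_ne (e.eval I s) 0 with he | he
  · exact ⟨by simpa [ticks, he] using (h' he).1, by simpa [run, he] using (h' he).2⟩
  · exact ⟨by simpa [ticks, he] using (h he).1, by simpa [run, he] using (h he).2⟩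

/-- The rule for loops, with an invariant `Inv i` that holds before the round number `i`. -/
lemma Spec.loop {j : R} {n : Term R} {P : Code R} {s : Store R} (Inv : ℕ → Store R → Prop)
    (N T : ℕ) (hn : n.eval I s = N) (h0 : Inv 0 s)
    (hstep : ∀ i < N, ∀ s', (∀ k, k ∉ (Code.loop j n P).writes → s' k = s k) → Inv i s' →
      P.Spec I (s'.set j 0 i) T (Inv (i + 1))) :
    (Code.loop j n P).Spec I s (1 + N * (1 + T)) (Inv N) := by
  subst hn
  have hframe : ∀ i k, k ∉ (Code.loop j n P).writes →
      iter (fun i s => P.run I (s.set j 0 i)) i s k = s k := by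
    intro i k hk
    have := run_of_notMem_writes I (Code.loop j (.const i) P) s (j := k) hk
    exact this
  have hinv : ∀ i ≤ n.eval I s, Inv i (iter (fun i s => P.run I (s.set j 0 i)) i s) := by
    intro i
    induction i with
    | zero => exact fun _ => h0
    | succ i ih =>
      intro hi
      exact (hstep i (by omega) _ (hframe i) (ih (by omega))).2
  refine ⟨?_, hinv _ le_rfl⟩
  rw [ticks]
  refine Nat.add_le_add_left ?_ 1
  calc _ ≤ ∑ i ∈ Finset.range (n.eval I s), (1 + T) := by
        refine Finset.sum_le_sum fun i hi => Nat.add_le_add_left ?_ 1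
        have hi' := Finset.mem_range.1 hi
        exact (hstep i hi' _ (hframe i) (hinv i hi'.le)).1
    _ = _ := by simp

end Code

end Semantics

section Compile

variable {R : Type} [Fintype R]

/-- The number of a register. -/
noncomputable def registerIndex (j : R) : ℕ := Fintype.equivFin R j

/-- The address of the cell `j[i]`, in a layout where the arrays are interleaved in every second
cell after the address `b`, the value of `B`. -/
noncomputable def addressOf (B : Expression) (j : R) (i : Expression) : Expression :=
  .add B (.mul (.const 2) (.add (.mul (.const (Fintype.card R)) i) (.const (registerIndex j))))

/-- The address of the `d`-th of the cells that control the loops. -/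
def controlAddress (B : Expression) (d : ℕ) : Expression := .add B (.const (2 * d + 1))

/-- The translation of terms. The first factor in the case of the input is `1` for addresses
below `b` and `0` for the others. -/
noncomputable def Term.compile (B : Expression) : Term R → Expression
  | const c => .const c
  | input a => .mul (.sub (.const 1) (.sub (.add (a.compile B) (.const 1)) B)) (.cell (a.compile B))
  | cell j i => .cell (addressOf B j (i.compile B))
  | add a b => .add (a.compile B) (b.compile B)
  | sub a b => .sub (a.compile B) (b.compile B)
  | mul a b => .mul (a.compile B) (b.compile B)
  | div a b => .div (a.compile B) (b.compile B)

/-- The translation of structured programs; `d` is the number of surrounding loops. A loop keeps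
its counter and its bound in two control cells. -/
noncomputable def Code.compile (B : Expression) : Code R → ℕ → Program
  | skip, _ => .skip
  | set j i e, _ => .store (addressOf B j (i.compile B)) (e.compile B)
  | seq P Q, d => .seq (P.compile B d) (Q.compile B d)
  | ite e P Q, d => .branch (e.compile B) (P.compile B d) (Q.compile B d)
  | loop j n P, d =>
    .seq (.store (controlAddress B (2 * d + 1)) (n.compile B)) <|
    .seq (.store (controlAddress B (2 * d)) (.const 0)) <|
    .loop (.sub (.cell (controlAddress B (2 * d + 1))) (.cell (controlAddress B (2 * d)))) <|
    .seq (.store (addressOf B j (.const 0)) (.cell (controlAddress B (2 * d)))) <|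
    .seq (P.compile B (d + 1)) <|
    .store (controlAddress B (2 * d)) (.add (.cell (controlAddress B (2 * d))) (.const 1))

/-- A bound for the time of one step of a structured program. -/
noncomputable def Code.weight (B : Expression) : Code R → ℕ
  | skip => 1
  | set j i e => (addressOf B j (i.compile B)).cost + (e.compile B).cost + 1
  | seq P Q => P.weight B + Q.weight B
  | ite e P Q => (e.compile B).cost + 1 + P.weight B + Q.weight B
  | loop j n P =>
    (n.compile B).cost + 10 * B.cost + (addressOf B j (.const 0)).cost + 50 + P.weight B

/-- The memory `m` holds the input, the arrays and the control cells. -/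
structure Represents (I : List ℕ) (h : ℕ → ℕ) (s : Store R) (m : Memory) : Prop where
  input : ∀ a < I.length, m a = I.getD a 0
  cell : ∀ (j : R) (i : ℕ), m (I.length + 2 * (Fintype.card R * i + registerIndex j)) = s j i
  control : ∀ d, m (I.length + (2 * d + 1)) = h d

/-- The expression `B` has the value `I.length` as long as the input is not overwritten. -/
def IsBase (B : Expression) (I : List ℕ) : Prop :=
  ∀ m : Memory, (∀ a < I.length, m a = I.getD a 0) → B.eval m = I.length

variable {B : Expression} {I : List ℕ} {h : ℕ → ℕ} {s : Store R} {m : Memory}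

lemma registerIndex_lt (j : R) : registerIndex j < Fintype.card R := (Fintype.equivFin R j).2

lemma address_injective {j j' : R} {i i' : ℕ}
    (h : Fintype.card R * i + registerIndex j = Fintype.card R * i' + registerIndex j') :
    j = j' ∧ i = i' := by
  have hj := registerIndex_lt j
  have hj' := registerIndex_lt j'
  have hi : i = i' := by
    have h1 := congrArg (· / Fintype.card R) h
    simp only [Nat.mul_add_div (Nat.zero_lt_of_lt hj), Nat.div_eq_of_lt hj,
      Nat.div_eq_of_lt hj'] at h1
    simpa using h1
  subst hi
  have : registerIndex j = registerIndex j' := by omega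
  exact ⟨(Fintype.equivFin R).injective (Fin.ext this), rfl⟩

lemma Represents.eval_address (hm : Represents I h s m) (hB : IsBase B I) (j : R)
    (i : Expression) : (addressOf B j i).eval m
      = I.length + 2 * (Fintype.card R * i.eval m + registerIndex j) := by
  simp [addressOf, Expression.eval, hB m hm.input]

lemma Represents.eval_controlAddress (hm : Represents I h s m) (hB : IsBase B I) (d : ℕ) :
    (controlAddress B d).eval m = I.length + (2 * d + 1) := by
  simp [controlAddress, Expression.eval, hB m hm.input]

lemma Represents.eval_compile (hm : Represents I h s m) (hB : IsBase B I) (e : Term R) :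
    (e.compile B).eval m = e.eval I s := by
  induction e with
  | const c => rfl
  | input a ih =>
    simp only [Term.compile, Expression.eval, Term.eval, ih, hB m hm.input]
    rcases lt_or_ge (a.eval I s) I.length with ha | ha
    · rw [hm.input _ ha, Nat.sub_eq_zero_of_le ha]
      simp
    · rw [List.getD_eq_default _ _ ha, Nat.sub_eq_zero_of_le (by omega), zero_mul]
  | cell j i ih => rw [Term.compile, Expression.eval, hm.eval_address hB, ih, hm.cell, Term.eval]
  | add a b iha ihb => simp only [Term.compile, Expression.eval, Term.eval, iha, ihb]
  | sub a b iha ihb => simp only [Term.compile, Expression.eval, Term.eval, iha, ihb]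
  | mul a b iha ihb => simp only [Term.compile, Expression.eval, Term.eval, iha, ihb]
  | div a b iha ihb => simp only [Term.compile, Expression.eval, Term.eval, iha, ihb]

lemma Represents.set [DecidableEq R] (hm : Represents I h s m) (j : R) (i v : ℕ) :
    Represents I h (s.set j i v)
      (Function.update m (I.length + 2 * (Fintype.card R * i + registerIndex j)) v) where
  input a ha := by rw [Function.update_of_ne (by omega), hm.input a ha]
  cell j' i' := by
    simp only [Store.set]
    by_cases hji : j' = j ∧ i' = i
    · obtain ⟨rfl, rfl⟩ := hji
      simp
    · rw [Function.update_of_ne, hm.cell, if_neg hji]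
      intro hne
      exact hji (address_injective (by omega))
  control d := by rw [Function.update_of_ne (by omega), hm.control]

lemma Represents.setControl (hm : Represents I h s m) (d v : ℕ) :
    Represents I (Function.update h d v) s (Function.update m (I.length + (2 * d + 1)) v) where
  input a ha := by rw [Function.update_of_ne (by omega), hm.input a ha]
  cell j i := by rw [Function.update_of_ne (by omega), hm.cell]
  control d' := by
    by_cases hd : d' = d
    · subst hd; simp
    · rw [Function.update_of_ne (by omega), hm.control, Function.update_of_ne hd]

lemma initialMemory_represents (I : List ℕ) :
    Represents I (fun _ => 0) (fun (_ : R) _ => 0) (initialMemory I) where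
  input a _ := rfl
  cell j i := List.getD_eq_default _ _ (by omega)
  control d := List.getD_eq_default _ _ (by omega)

/-- The translated program computes what the structured program says, in a time that is
proportional to the number of steps. -/
theorem Code.exists_run [DecidableEq R] (hB : IsBase B I) (P : Code R) :
    ∀ (d : ℕ) (h : ℕ → ℕ) (s : Store R) (m : Memory), Represents I h s m →
      ∃ (t : ℕ) (A : Finset ℕ) (m' : Memory) (h' : ℕ → ℕ),
        Run (P.compile B d) m t A m' ∧ Represents I h' (P.run I s) m' ∧
        (∀ i < 2 * d, h' i = h i) ∧ t ≤ P.weight B * P.ticks I s := by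
  induction P with
  | skip =>
    intro d h s m hm
    exact ⟨_, _, _, h, Run.skip m, hm, fun _ _ => rfl, by simp [weight, ticks]⟩
  | set j i e =>
    intro d h s m hm
    refine ⟨_, _, _, h, Run.store _ _ m, ?_, fun _ _ => rfl, by simp [weight, ticks]⟩
    rw [hm.eval_address hB, hm.eval_compile hB, hm.eval_compile hB]
    exact hm.set j _ _
  | seq P Q ihP ihQ =>
    intro d h s m hm
    obtain ⟨t₁, A₁, m₁, h₁, r₁, hm₁, hh₁, ht₁⟩ := ihP d h s m hm
    obtain ⟨t₂, A₂, m₂, h₂, r₂, hm₂, hh₂, ht₂⟩ := ihQ d h₁ _ m₁ hm₁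
    refine ⟨_, _, _, h₂, Run.seq r₁ r₂, hm₂, fun i hi => (hh₂ i hi).trans (hh₁ i hi), ?_⟩
    simp only [weight, ticks]
    nlinarith [Nat.zero_le (P.weight B * Q.ticks I (P.run I s)),
      Nat.zero_le (Q.weight B * P.ticks I s)]
  | ite e P Q ihP ihQ =>
    intro d h s m hm
    have hev := hm.eval_compile hB e
    rcases eq_or_ne (e.eval I s) 0 with he | he
    · obtain ⟨t₁, A₁, m₁, h₁, r₁, hm₁, hh₁, ht₁⟩ := ihQ d h s m hm
      refine ⟨_, _, _, h₁, Run.branch_false (by rw [hev, he]) r₁, by simpa [run, he] using hm₁,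
        hh₁, ?_⟩
      simp only [weight, ticks, he, ne_eq, not_true_eq_false, if_false]
      nlinarith [Nat.zero_le (P.weight B * Q.ticks I s), Nat.zero_le (P.weight B),
        Nat.zero_le (((e.compile B).cost + 1) * Q.ticks I s)]
    · obtain ⟨t₁, A₁, m₁, h₁, r₁, hm₁, hh₁, ht₁⟩ := ihP d h s m hm
      refine ⟨_, _, _, h₁, Run.branch_true (by rw [hev]; exact he) r₁,
        by simpa [run, he] using hm₁, hh₁, ?_⟩
      simp only [weight, ticks, he, ne_eq, not_false_eq_true, if_true]
      nlinarith [Nat.zero_le (Q.weight B * P.ticks I s), Nat.zero_le (Q.weight B),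
        Nat.zero_le (((e.compile B).cost + 1) * P.ticks I s)]
  | loop j n P ih =>
    intro d h s m hm
    set N := n.eval I s with hN
    set f : ℕ → Store R → Store R := fun i s => P.run I (s.set j 0 i) with hf
    set w := 10 * B.cost + (addressOf B j (.const 0)).cost + 40 with hw
    -- The rounds from the number `i` on.
    have hloop : ∀ (k i : ℕ) (h : ℕ → ℕ) (m : Memory), i + k = N → h (2 * d) = i →
        h (2 * d + 1) = N → Represents I h (iter f i s) m →
        ∃ (t : ℕ) (A : Finset ℕ) (m' : Memory) (h' : ℕ → ℕ),
          Run (.loop (.sub (.cell (controlAddress B (2 * d + 1)))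
              (.cell (controlAddress B (2 * d)))) <|
            .seq (.store (addressOf B j (.const 0)) (.cell (controlAddress B (2 * d)))) <|
            .seq (P.compile B (d + 1)) <|
            .store (controlAddress B (2 * d)) (.add (.cell (controlAddress B (2 * d)))
              (.const 1))) m t A m' ∧
          Represents I h' (iter f N s) m' ∧ (∀ i < 2 * d, h' i = h i) ∧
          t ≤ 2 * B.cost + 10 + ∑ l ∈ Finset.range k,
            (w + P.weight B * P.ticks I ((iter f (i + l) s).set j 0 (i + l))) := by
      intro k
      induction k with
      | zero =>
        intro i h m hik hi hN' hm
        obtain rfl : i = N := by omega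
        refine ⟨_, _, _, h, Run.loop_false ?_, hm, fun _ _ => rfl, ?_⟩
        · simp only [Expression.eval, hm.eval_controlAddress hB, hm.control, hi, hN']
          omega
        · simp [Expression.cost, controlAddress]
          omega
      | succ k ihk =>
        intro i h m hik hi hN' hm
        have hcond : Expression.eval m (.sub (.cell (controlAddress B (2 * d + 1)))
            (.cell (controlAddress B (2 * d)))) ≠ 0 := by
          simp only [Expression.eval, hm.eval_controlAddress hB, hm.control, hi, hN']
          omega
        have r₁ := Run.store (addressOf B j (.const 0)) (.cell (controlAddress B (2 * d))) m
        have hm₁ := hm.set j 0 i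
        simp only [hm.eval_address hB, Expression.eval, hm.eval_controlAddress hB, hm.control,
          hi] at r₁
        obtain ⟨t₂, A₂, m₂, h₂, r₂, hm₂, hh₂, ht₂⟩ := ih (d + 1) _ _ _ hm₁
        have r₃ := Run.store (controlAddress B (2 * d))
          (.add (.cell (controlAddress B (2 * d))) (.const 1)) m₂
        have hm₃ := hm₂.setControl (2 * d) (i + 1)
        have hi₂ : h₂ (2 * d) = i := by rw [hh₂ _ (by omega), hi]
        simp only [Expression.eval, hm₂.eval_controlAddress hB, hm₂.control, hi₂] at r₃
        obtain ⟨t₄, A₄, m₄, h₄, r₄, hm₄, hh₄, ht₄⟩ := ihk (i + 1) _ _ (by omega)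
          (by simp) (by rw [Function.update_of_ne (by omega), hh₂ _ (by omega), hN']) hm₃
        refine ⟨_, _, _, h₄, Run.loop_true hcond (Run.seq r₁ (Run.seq r₂ r₃)) r₄, hm₄, ?_, ?_⟩
        · intro l hl
          rw [hh₄ l hl, Function.update_of_ne (by omega), hh₂ l (by omega)]
        · rw [Finset.sum_range_succ']
          have hsum : ∑ l ∈ Finset.range k, (w + P.weight B * P.ticks I
              ((iter f (i + 1 + l) s).set j 0 (i + 1 + l)))
              = ∑ l ∈ Finset.range k, (w + P.weight B * P.ticks I
              ((iter f (i + (l + 1)) s).set j 0 (i + (l + 1)))) := by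
            refine Finset.sum_congr rfl fun l _ => ?_
            rw [show i + 1 + l = i + (l + 1) by ring]
          rw [hsum] at ht₄
          simp only [add_zero, Expression.cost, controlAddress] at ht₂ ht₄ ⊢
          omega
    have r₁ := Run.store (controlAddress B (2 * d + 1)) (n.compile B) m
    have hm₁ := hm.setControl (2 * d + 1) N
    rw [hm.eval_controlAddress hB, hm.eval_compile hB] at r₁
    have r₂ := Run.store (controlAddress B (2 * d)) (.const 0)
      (Function.update m (I.length + (2 * (2 * d + 1) + 1)) N)
    have hm₂ := hm₁.setControl (2 * d) 0
    rw [hm₁.eval_controlAddress hB] at r₂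
    obtain ⟨t₃, A₃, m₃, h₃, r₃, hm₃, hh₃, ht₃⟩ := hloop N 0 _ _ (by omega) (by simp)
      (by rw [Function.update_of_ne (by omega)]; simp) hm₂
    refine ⟨_, _, _, h₃, Run.seq r₁ (Run.seq r₂ r₃), hm₃, ?_, ?_⟩
    · intro i hi
      rw [hh₃ i hi, Function.update_of_ne (by omega), Function.update_of_ne (by omega)]
    · simp only [weight, ticks]
      have hsum : ∑ l ∈ Finset.range N, (w + P.weight B * P.ticks I ((iter f (0 + l) s).set j 0
          (0 + l))) ≤ (w + P.weight B) * ∑ l ∈ Finset.range N,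
            (1 + P.ticks I ((iter f l s).set j 0 l)) := by
        rw [Finset.mul_sum]
        refine Finset.sum_le_sum fun l _ => ?_
        rw [zero_add]
        nlinarith [Nat.zero_le (w * P.ticks I ((iter f l s).set j 0 l)), Nat.zero_le (P.weight B)]
      rw [← hN]
      generalize ∑ l ∈ Finset.range N, (1 + P.ticks I ((iter f l s).set j 0 l)) = U at hsum ⊢
      generalize ∑ l ∈ Finset.range N, (w + P.weight B * P.ticks I ((iter f (0 + l) s).set j 0
          (0 + l))) = U' at hsum ht₃
      have h1 : (w + P.weight B) * U ≤ ((n.compile B).cost + 10 * B.cost +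
          (addressOf B j (.const 0)).cost + 50 + P.weight B) * U :=
        Nat.mul_le_mul_right _ (by omega)
      rw [mul_add, mul_one]
      simp only [Expression.cost, controlAddress]
      omega

lemma Expression.card_cells_le (m : Memory) (e : Expression) : (e.cells m).card ≤ e.cost := by
  induction e with
  | const c => simp [cells]
  | cell a ih => exact (Finset.card_insert_le _ _).trans (by simpa [cost] using ih)
  | add a b iha ihb => exact (Finset.card_union_le _ _).trans (by simp only [cost]; omega)
  | sub a b iha ihb => exact (Finset.card_union_le _ _).trans (by simp only [cost]; omega)
  | mul a b iha ihb => exact (Finset.card_union_le _ _).trans (by simp only [cost]; omega)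
  | div a b iha ihb => exact (Finset.card_union_le _ _).trans (by simp only [cost]; omega)

/-- A program does not access more cells than it makes steps. -/
lemma Run.card_le {P : Program} {m m' : Memory} {t : ℕ} {A : Finset ℕ} (h : Run P m t A m') :
    A.card ≤ t := by
  induction h with
  | skip => simp
  | store a e m =>
    have h1 := Finset.card_insert_le (a.eval m) (a.cells m ∪ e.cells m)
    have h2 := Finset.card_union_le (a.cells m) (e.cells m)
    have h3 := a.card_cells_le m
    have h4 := e.card_cells_le m
    omega
  | seq _ _ ih ih' => exact (Finset.card_union_le _ _).trans (add_le_add ih ih')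
  | @branch_true e P Q m m' t A _ _ ih =>
    have h1 := Finset.card_union_le (e.cells m) A
    have h2 := e.card_cells_le m
    omega
  | @branch_false e P Q m m' t A _ _ ih =>
    have h1 := Finset.card_union_le (e.cells m) A
    have h2 := e.card_cells_le m
    omega
  | @loop_true e P m m' m'' t t' A A' _ _ _ ih ih' =>
    have h1 := Finset.card_union_le (e.cells m ∪ A) A'
    have h2 := Finset.card_union_le (e.cells m) A
    have h3 := e.card_cells_le m
    omega
  | @loop_false e P m _ =>
    have h3 := e.card_cells_le m
    omega

lemma Answers.mono {P : Program} {Q : Prop} {T T' : ℕ} (h : Answers P I Q T) (hT : T ≤ T') :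
    Answers P I Q T' := by
  obtain ⟨t, A, m, r, ht, hA, hQ⟩ := h
  exact ⟨t, A, m, r, ht.trans hT, hA.trans hT, hQ⟩

/-- The program that executes `P` and then copies the register `out` to the cell `0`. -/
noncomputable def Code.program (B : Expression) (out : R) (P : Code R) : Program :=
  .seq (P.compile B 0) (.store (.const 0) (.cell (addressOf B out (.const 0))))

/-- A structured program that leaves the answer to a question in a register can be translated into a
program that answers the question, with proportional time and space. -/
theorem Code.answers [DecidableEq R] (hB : IsBase B I) (P : Code R) (out : R) (Q : Prop) (T : ℕ)
    (h : P.Spec I (fun _ _ => 0) T fun s => (Q → s out 0 = 1) ∧ (¬ Q → s out 0 = 0)) :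
    Answers (P.program B out) I Q ((P.weight B + B.cost + 20) * (T + 1)) := by
  obtain ⟨t, A, m, h', r, hm, -, ht⟩ :=
    Code.exists_run hB P 0 _ _ _ (initialMemory_represents (R := R) I)
  have r' := Run.seq r (Run.store (.const 0) (.cell (addressOf B out (.const 0))) m)
  refine ⟨_, _, _, r', ?_, ?_, ?_⟩
  · have h1 : P.weight B * P.ticks I (fun _ _ => 0) ≤ P.weight B * T :=
      Nat.mul_le_mul_left _ h.1
    simp only [Expression.cost, addressOf]
    nlinarith [Nat.zero_le (B.cost * T), Nat.zero_le (P.weight B)]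
  · refine r'.card_le.trans ?_
    have h1 : P.weight B * P.ticks I (fun _ _ => 0) ≤ P.weight B * T :=
      Nat.mul_le_mul_left _ h.1
    simp only [Expression.cost, addressOf]
    nlinarith [Nat.zero_le (B.cost * T), Nat.zero_le (P.weight B)]
  · simp only [Expression.eval, Function.update_self, hm.eval_address hB, hm.cell]
    exact h.2

end Compile

end RAM

namespace RAM

/-! ### Matrices packed into numbers -/

/-- The digits of a number in base `y`. -/
lemma digit_eq {y : ℕ} : ∀ (s T : ℕ) (c : ℕ → ℕ), s < T → (∀ t < T, c t < y) →
    (∑ t ∈ Finset.range T, c t * y ^ t) / y ^ s % y = c s := by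
  intro s
  induction s with
  | zero =>
    intro T c hs hc
    obtain ⟨T, rfl⟩ := Nat.exists_eq_add_of_lt hs
    rw [zero_add, Finset.sum_range_succ']
    simp only [pow_zero, mul_one, Nat.div_one, pow_succ, ← mul_assoc]
    rw [← Finset.sum_mul, mul_comm, Nat.mul_add_mod, Nat.mod_eq_of_lt (hc 0 (by omega))]
  | succ s ih =>
    intro T c hs hc
    obtain ⟨T, rfl⟩ := Nat.exists_eq_add_of_lt hs
    have hy : 0 < y := Nat.zero_lt_of_lt (hc 0 (by omega))
    rw [Finset.sum_range_succ', pow_succ', ← Nat.div_div_eq_div_mul]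
    have hdiv : (∑ t ∈ Finset.range (s + 1 + T), c (t + 1) * y ^ (t + 1) + c 0 * y ^ 0) / y
        = ∑ t ∈ Finset.range (s + 1 + T), c (t + 1) * y ^ t := by
      simp only [pow_zero, mul_one, pow_succ, ← mul_assoc]
      rw [← Finset.sum_mul, mul_comm, Nat.mul_add_div hy, Nat.div_eq_of_lt (hc 0 (by omega)),
        add_zero]
    rw [hdiv]
    exact ih _ (fun t => c (t + 1)) (by omega) fun t ht => hc _ (by omega)

section Packing

variable {N : ℕ}

/-- The number that holds the matrix `M` in the bases `x` and `z`; the row `i` has the weight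
`x ^ φ i`. -/
def pack (φ : ℕ → ℕ) (M : Matrix (Fin N) (Fin N) ℕ) (x z : ℕ) : ℕ :=
  ∑ p : Fin N × Fin N, M p.1 p.2 * (x ^ φ p.1 * z ^ (p.2 : ℕ))

/-- The sum of all entries. -/
def total (M : Matrix (Fin N) (Fin N) ℕ) : ℕ := ∑ p : Fin N × Fin N, M p.1 p.2

lemma pack_add (φ : ℕ → ℕ) (M M' : Matrix (Fin N) (Fin N) ℕ) (x z : ℕ) :
    pack φ (M + M') x z = pack φ M x z + pack φ M' x z := by
  simp [pack, add_mul, Finset.sum_add_distrib]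

/-- The first base is replaced by a smaller one by taking a remainder. -/
lemma pack_mod_left {φ : ℕ → ℕ} {M : Matrix (Fin N) (Fin N) ℕ} {x x' z : ℕ} (hx : x' ≤ x)
    (h : pack φ M x' z < x - x') : pack φ M x z % (x - x') = pack φ M x' z := by
  have hmod : x ≡ x' [MOD x - x'] := ((Nat.modEq_iff_dvd' hx).2 dvd_rfl).symm
  have : pack φ M x z ≡ pack φ M x' z [MOD x - x'] :=
    Nat.ModEq.sum fun p _ => ((hmod.pow _).mul_right _).mul_left _
  exact Eq.trans this (Nat.mod_eq_of_lt h)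

/-- The second base is replaced by a smaller one by taking a remainder. -/
lemma pack_mod_right {φ : ℕ → ℕ} {M : Matrix (Fin N) (Fin N) ℕ} {x z z' : ℕ} (hz : z' ≤ z)
    (h : pack φ M x z' < z - z') : pack φ M x z % (z - z') = pack φ M x z' := by
  have hmod : z ≡ z' [MOD z - z'] := ((Nat.modEq_iff_dvd' hz).2 dvd_rfl).symm
  have : pack φ M x z ≡ pack φ M x z' [MOD z - z'] :=
    Nat.ModEq.sum fun p _ => ((hmod.pow _).mul_left _).mul_left _
  exact Eq.trans this (Nat.mod_eq_of_lt h)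

/-- A packed matrix is small compared with high powers of a bound `g` for the bases. -/
lemma pack_le {φ : ℕ → ℕ} {M : Matrix (Fin N) (Fin N) ℕ} {x z g R : ℕ} (hx : x ≤ g) (hz : z ≤ g)
    (hg : 1 ≤ g) (hφ : ∀ i < N, φ i ≤ R) : pack φ M x z ≤ total M * g ^ (R + N) := by
  rw [pack, total, Finset.sum_mul]
  refine Finset.sum_le_sum fun p _ => Nat.mul_le_mul_left _ ?_
  rw [pow_add]
  exact Nat.mul_le_mul
    ((Nat.pow_le_pow_left hx _).trans (Nat.pow_le_pow_right hg (hφ _ p.1.2)))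
    ((Nat.pow_le_pow_left hz _).trans (Nat.pow_le_pow_right hg p.2.2.le))

/-- The coefficient of `y ^ t` in the product of two packed matrices, where the second base of the
first one and the first base of the second one are `y`, and the rows of the second one are
reversed. -/
def productCoefficient (φ : ℕ → ℕ) (R : ℕ) (M M' : Matrix (Fin N) (Fin N) ℕ) (x z t : ℕ) : ℕ :=
  ∑ p : Fin N × Fin N, ∑ q : Fin N × Fin N,
    if (p.2 : ℕ) + (R - q.1) = t then M p.1 p.2 * M' q.1 q.2 * (x ^ φ p.1 * z ^ (q.2 : ℕ)) else 0

/-- The product of two packed matrices, as a polynomial in the common base `y`. -/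
lemma pack_mul_pack {φ : ℕ → ℕ} {R : ℕ} (hR : N ≤ R) (M M' : Matrix (Fin N) (Fin N) ℕ)
    (x y z : ℕ) : pack φ M x y * pack (fun i => R - i) M' y z
      = ∑ t ∈ Finset.range (2 * R + 1), productCoefficient φ R M M' x z t * y ^ t := by
  simp only [pack, productCoefficient, Finset.sum_mul]
  rw [Finset.sum_comm]
  refine Finset.sum_congr rfl fun p _ => ?_
  rw [Finset.mul_sum, Finset.sum_comm]
  refine Finset.sum_congr rfl fun q _ => ?_
  simp only [ite_mul, zero_mul]
  rw [Finset.sum_ite_eq, if_pos]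
  · rw [pow_add]; ring
  · have := p.2.2
    rw [Finset.mem_range]; omega

/-- The coefficient of `y ^ R` collects the terms with equal inner indices, as the exponents of `y`
are `j` and `R - j'`. -/
lemma productCoefficient_self {φ : ℕ → ℕ} {R : ℕ} (hR : N ≤ R) (M M' : Matrix (Fin N) (Fin N) ℕ)
    (x z : ℕ) : productCoefficient φ R M M' x z R = pack φ (M * M') x z := by
  have hiff : ∀ j j' : Fin N, ((j : ℕ) + (R - j') = R) ↔ j = j' := by
    intro j j'
    have := j'.2
    rw [Fin.ext_iff]; omega
  simp only [productCoefficient, pack, Fintype.sum_prod_type, hiff]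
  refine Finset.sum_congr rfl fun i _ => ?_
  calc _ = ∑ j : Fin N, ∑ k : Fin N, M i j * M' j k * (x ^ φ i * z ^ (k : ℕ)) := by
        refine Finset.sum_congr rfl fun j _ => ?_
        rw [Finset.sum_comm]
        refine Finset.sum_congr rfl fun k _ => ?_
        simp
    _ = _ := by
        rw [Finset.sum_comm]
        refine Finset.sum_congr rfl fun k _ => ?_
        rw [Matrix.mul_apply, Finset.sum_mul]

lemma productCoefficient_le {φ : ℕ → ℕ} {R : ℕ} (M M' : Matrix (Fin N) (Fin N) ℕ) {x z g : ℕ}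
    (hx : x ≤ g) (hz : z ≤ g) (hg : 1 ≤ g) (hφ : ∀ i < N, φ i ≤ R) (t : ℕ) :
    productCoefficient φ R M M' x z t ≤ total M * total M' * g ^ (R + N) := by
  rw [total, total, Finset.sum_mul_sum, Finset.sum_mul, productCoefficient]
  refine Finset.sum_le_sum fun p _ => ?_
  rw [Finset.sum_mul]
  refine Finset.sum_le_sum fun q _ => ?_
  split_ifs
  · refine Nat.mul_le_mul_left _ ?_
    rw [pow_add]
    exact Nat.mul_le_mul
      ((Nat.pow_le_pow_left hx _).trans (Nat.pow_le_pow_right hg (hφ _ p.1.2)))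
      ((Nat.pow_le_pow_left hz _).trans (Nat.pow_le_pow_right hg q.2.2.le))
  · exact Nat.zero_le _

lemma total_eq_pack (M : Matrix (Fin N) (Fin N) ℕ) : total M = pack (fun i => i) M 1 1 := by
  simp [total, pack]

lemma total_add (M M' : Matrix (Fin N) (Fin N) ℕ) : total (M + M') = total M + total M' := by
  simp [total, Finset.sum_add_distrib]

lemma total_mul_le (M M' : Matrix (Fin N) (Fin N) ℕ) : total (M * M') ≤ total M * total M' := by
  rw [total_eq_pack, ← productCoefficient_self le_rfl]
  simpa using productCoefficient_le M M' (g := 1) le_rfl le_rfl le_rfl (φ := fun i => i) (R := N)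
    (fun i hi => hi.le) N

lemma total_one : total (1 : Matrix (Fin N) (Fin N) ℕ) = N := by
  rw [total, Fintype.sum_prod_type]
  simp [Matrix.one_apply]

/-- A bound for packed matrices in the base `g`, if `g` exceeds the sums of the entries. -/
lemma pow_bound {g R S : ℕ} (hg : 2 ≤ g) (hR : N + 4 ≤ R) (hS : S ≤ g * g) :
    S * g ^ (R + N) + g < g ^ (R * R) := by
  have h1 : S * g ^ (R + N) ≤ g ^ (R + N + 2) := by
    rw [show g ^ (R + N + 2) = g * g * g ^ (R + N) by ring]
    exact Nat.mul_le_mul_right _ hS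
  have h2 : g ≤ g ^ (R + N + 2) := Nat.le_self_pow (by omega) g
  have h3 : g ^ (R + N + 2) + g ^ (R + N + 2) ≤ g ^ (R + N + 3) := by
    rw [pow_succ g (R + N + 2)]
    nlinarith [Nat.zero_le (g ^ (R + N + 2))]
  have h4 : g ^ (R + N + 3) < g ^ (R * R) :=
    Nat.pow_lt_pow_right (by omega) (by nlinarith)
  omega

/-- The product of packed matrices: bases are adjusted by remainders, and then the product of the
numbers is divided by `y ^ R`. -/
lemma pack_product {φ : ℕ → ℕ} {R : ℕ} {M M' : Matrix (Fin N) (Fin N) ℕ} {x y z x' z' : ℕ}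
    (hR : N + 4 ≤ R) (hφ : ∀ i < N, φ i ≤ R) (hx' : x' = z' ^ (R * R)) (hy : y = x' ^ (R * R))
    (hz : z = y ^ (R * R)) (hx : x = z ^ (R * R)) (hz' : 2 ≤ z') (hM : total M ≤ z')
    (hM' : total M' ≤ z') :
    (pack φ M x z % (x - x') % (z - y)) * (pack (fun i => R - i) M' x z % (x - y) % (z - z'))
      / y ^ R % y = pack φ (M * M') x' z' := by
  have hRR : R * R ≠ 0 := Nat.mul_ne_zero (by omega) (by omega)
  have h1 : z' ≤ x' := hx' ▸ Nat.le_self_pow hRR z'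
  have h2 : x' ≤ y := hy ▸ Nat.le_self_pow hRR x'
  have h3 : y ≤ z := hz ▸ Nat.le_self_pow hRR y
  have h4 : z ≤ x := hx ▸ Nat.le_self_pow hRR z
  have hrev : ∀ i < N, R - i ≤ R := fun i _ => Nat.sub_le _ _
  have e1 : pack φ M x z % (x - x') = pack φ M x' z := by
    refine pack_mod_left (by omega) ?_
    have := pack_le (M := M) (x := x') (z := z) (g := z) (by omega) le_rfl (by omega) hφ
    have := pow_bound (N := N) (g := z) (R := R) (S := total M) (by omega) hR (by nlinarith)
    rw [← hx] at this
    omega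
  have e2 : pack φ M x' z % (z - y) = pack φ M x' y := by
    refine pack_mod_right (by omega) ?_
    have := pack_le (M := M) (x := x') (z := y) (g := y) (by omega) le_rfl (by omega) hφ
    have := pow_bound (N := N) (g := y) (R := R) (S := total M) (by omega) hR (by nlinarith)
    rw [← hz] at this
    omega
  have e3 : pack (fun i => R - i) M' x z % (x - y) = pack (fun i => R - i) M' y z := by
    refine pack_mod_left (by omega) ?_
    have : pack (fun i => R - i) M' y z ≤ _ := pack_le (g := z) (by omega) le_rfl (by omega) hrev
    have := pow_bound (N := N) (g := z) (R := R) (S := total M') (by omega) hR (by nlinarith)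
    rw [← hx] at this
    omega
  have e4 : pack (fun i => R - i) M' y z % (z - z') = pack (fun i => R - i) M' y z' := by
    refine pack_mod_right (by omega) ?_
    have : pack (fun i => R - i) M' y z' ≤ _ :=
      pack_le (g := y) le_rfl (by omega) (by omega) hrev
    have := pow_bound (N := N) (g := y) (R := R) (S := total M') (by omega) hR (by nlinarith)
    rw [← hz] at this
    omega
  rw [e1, e2, e3, e4, pack_mul_pack (by omega), digit_eq R (2 * R + 1) _ (by omega),
    productCoefficient_self (by omega)]
  intro t _
  have := productCoefficient_le M M' (x := x') (z := z') (g := x') le_rfl h1 (by omega) hφ t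
  have := pow_bound (N := N) (g := x') (R := R) (S := total M * total M') (by omega) hR
    (Nat.mul_le_mul (hM.trans h1) (hM'.trans h1))
  rw [← hy] at this
  omega

/-- The entries of a packed matrix. -/
lemma pack_entry {R : ℕ} {M : Matrix (Fin N) (Fin N) ℕ} {x z : ℕ} (hR : N + 4 ≤ R)
    (hx : x = z ^ (R * R)) (hz : 2 ≤ z) (hM : total M < z) (i j : Fin N) :
    pack (fun i => i) M x z / x ^ (i : ℕ) % x / z ^ (j : ℕ) % z = M i j := by
  set row : ℕ → ℕ := fun i => if h : i < N then ∑ j : Fin N, M ⟨i, h⟩ j * z ^ (j : ℕ) else 0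
    with hrow
  set entry : ℕ → ℕ := fun j => if h : j < N then M i ⟨j, h⟩ else 0 with hentry
  have hpack : pack (fun i => i) M x z = ∑ t ∈ Finset.range N, row t * x ^ t := by
    rw [pack, Fintype.sum_prod_type, Finset.sum_range]
    refine Finset.sum_congr rfl fun i _ => ?_
    simp only [hrow, i.2, dif_pos, Finset.sum_mul]
    exact Finset.sum_congr rfl fun j _ => by ring
  have hrowi : row i = ∑ t ∈ Finset.range N, entry t * z ^ t := by
    simp only [hrow, i.2, dif_pos, Finset.sum_range, hentry]
    exact Finset.sum_congr rfl fun j _ => by simp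
  rw [hpack, digit_eq _ _ _ i.2, hrowi, digit_eq _ _ _ j.2]
  · simp [hentry]
  · intro t ht
    simp only [hentry, ht, dif_pos]
    refine lt_of_le_of_lt ?_ hM
    exact Finset.single_le_sum (f := fun p : Fin N × Fin N => M p.1 p.2) (fun _ _ => Nat.zero_le _)
      (Finset.mem_univ (i, ⟨t, ht⟩))
  · intro t ht
    simp only [hrow, ht, dif_pos]
    have h1 : ∑ j : Fin N, M ⟨t, ht⟩ j * z ^ (j : ℕ) ≤ total M * z ^ (R + N) := by
      calc ∑ j : Fin N, M ⟨t, ht⟩ j * z ^ (j : ℕ) ≤ ∑ j : Fin N, M ⟨t, ht⟩ j * z ^ (R + N) := by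
            refine Finset.sum_le_sum fun j _ => Nat.mul_le_mul_left _ ?_
            exact Nat.pow_le_pow_right (by omega) (by have := j.2; omega)
        _ = (∑ j : Fin N, M ⟨t, ht⟩ j) * z ^ (R + N) := by rw [Finset.sum_mul]
        _ ≤ total M * z ^ (R + N) := by
            refine Nat.mul_le_mul_right _ ?_
            rw [total, Fintype.sum_prod_type]
            exact Finset.single_le_sum (f := fun i : Fin N => ∑ j, M i j)
              (fun _ _ => Nat.zero_le _) (Finset.mem_univ _)
    have := pow_bound (N := N) (g := z) (R := R) (S := total M) hz hR (by nlinarith)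
    rw [← hx] at this
    omega

end Packing

section Paths

variable {N : ℕ}

/-- The adjacency matrix of a list of edges; multiple edges are counted. -/
def adjacency (N : ℕ) (E : List (ℕ × ℕ)) : Matrix (Fin N) (Fin N) ℕ :=
  fun i j => E.count ((i : ℕ), (j : ℕ))

lemma pack_adjacency (φ : ℕ → ℕ) {E : List (ℕ × ℕ)} (hE : ∀ e ∈ E, e.1 < N ∧ e.2 < N)
    (x z : ℕ) : pack φ (adjacency N E) x z = (E.map fun e => x ^ φ e.1 * z ^ e.2).sum := by
  induction E with
  | nil => simp [pack, adjacency]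
  | cons e E ih =>
    have he := hE e (by simp)
    rw [List.map_cons, List.sum_cons, ← ih fun e' he' => hE e' (by simp [he'])]
    have : adjacency N (e :: E) = Matrix.single ⟨e.1, he.1⟩ ⟨e.2, he.2⟩ 1 + adjacency N E := by
      ext i j
      simp only [adjacency, List.count_cons, Matrix.add_apply, Matrix.single_apply, Fin.ext_iff]
      rw [add_comm]
      congr 1
      refine if_congr ?_ rfl rfl
      simp [Prod.ext_iff]
    rw [this, pack_add]
    congr 1
    rw [pack, Finset.sum_eq_single (⟨e.1, he.1⟩, ⟨e.2, he.2⟩)]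
    · simp
    · intro p _ hp
      rw [Matrix.single_apply, if_neg, zero_mul]
      rintro ⟨h1, h2⟩
      exact hp (Prod.ext h1.symm h2.symm)
    · simp

lemma total_adjacency {E : List (ℕ × ℕ)} (hE : ∀ e ∈ E, e.1 < N ∧ e.2 < N) :
    total (adjacency N E) = E.length := by
  rw [total_eq_pack, pack_adjacency _ hE]
  simp

lemma pack_one (φ : ℕ → ℕ) (x z : ℕ) :
    pack φ (1 : Matrix (Fin N) (Fin N) ℕ) x z = ∑ i ∈ Finset.range N, x ^ φ i * z ^ i := by
  rw [pack, Fintype.sum_prod_type, Finset.sum_range]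
  refine Finset.sum_congr rfl fun i _ => ?_
  simp [Matrix.one_apply]

/-- The matrix `A (1 + A)ⁿ` describes the paths of positive length at most `n + 1`; for large `n`,
these are all connections by paths of positive length. -/
theorem adjacency_mul_pow_ne_zero_iff {E : List (ℕ × ℕ)} (hE : ∀ e ∈ E, e.1 < N ∧ e.2 < N) {n : ℕ}
    (hn : N ≤ n) (i j : Fin N) :
    (adjacency N E * (1 + adjacency N E) ^ n) i j ≠ 0 ↔
      Relation.TransGen (fun a b => (a, b) ∈ E) (i : ℕ) j := by
  classical
  set A := adjacency N E with hA
  have hAij : ∀ i j : Fin N, A i j ≠ 0 ↔ ((i : ℕ), (j : ℕ)) ∈ E := by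
    intro i j
    simp [hA, adjacency, List.count_eq_zero]
  have hstep : ∀ (n : ℕ) (j : Fin N), (A * (1 + A) ^ (n + 1)) i j ≠ 0 ↔
      (A * (1 + A) ^ n) i j ≠ 0 ∨ ∃ k : Fin N, (A * (1 + A) ^ n) i k ≠ 0 ∧ ((k : ℕ), (j : ℕ)) ∈ E
      := by
    intro n j
    rw [pow_succ, ← mul_assoc, mul_add, mul_one, Matrix.add_apply]
    generalize A * (1 + A) ^ n = B
    rw [Matrix.mul_apply, Ne, Nat.add_eq_zero_iff, not_and_or, Finset.sum_eq_zero_iff]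
    simp only [Finset.mem_univ, true_implies, not_forall, mul_eq_zero, not_or, ← hAij, Ne]
  constructor
  · clear hn
    induction n generalizing j with
    | zero =>
      intro h
      rw [pow_zero, mul_one, hAij] at h
      exact .single h
    | succ n ih =>
      intro h
      rcases (hstep n j).1 h with h | ⟨k, hk, hkj⟩
      · exact ih _ h
      · exact .tail (ih _ hk) hkj
  -- The sets of the vertices that are reached grow until they are stable.
  set T : ℕ → Finset (Fin N) := fun n => Finset.univ.filter fun j => (A * (1 + A) ^ n) i j ≠ 0
    with hT
  have hmem : ∀ n j, j ∈ T n ↔ (A * (1 + A) ^ n) i j ≠ 0 := by simp [hT]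
  have hmono : ∀ n, T n ⊆ T (n + 1) := fun n j hj => by
    rw [hmem] at hj ⊢
    exact (hstep n j).2 (Or.inl hj)
  have hstable : ∀ n, T (n + 1) = T n → T (n + 2) = T (n + 1) := by
    intro n h
    ext j
    rw [hmem, hmem, hstep (n + 1), hstep n]
    have : ∀ k, (A * (1 + A) ^ (n + 1)) i k ≠ 0 ↔ (A * (1 + A) ^ n) i k ≠ 0 := fun k => by
      rw [← hmem, ← hmem, h]
    simp only [this]
    tauto
  have hcard : ∀ n, n + 1 ≤ (T n).card ∨ T (n + 1) = T n := by
    intro n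
    induction n with
    | zero =>
      rcases Finset.eq_empty_or_nonempty (T 0) with h0 | h0
      · right
        ext j
        have hall : ∀ k : Fin N, (A * (1 + A) ^ (0 : ℕ)) i k = 0 := fun k => by
          by_contra hk
          have := (hmem 0 k).2 hk
          rw [h0] at this
          simp at this
        rw [hmem, hmem, hstep]
        simp only [hall]
        simp
      · left
        simpa using h0.card_pos
    | succ n ih =>
      rcases eq_or_ne (T (n + 1)) (T n) with h | h
      · exact Or.inr (hstable n h)
      · rcases ih with ih | ih
        · left
          have := Finset.card_lt_card ((hmono n).ssubset_of_ne h.symm)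
          omega
        · exact absurd ih h
  have hfix : T (n + 1) = T n := by
    rcases hcard n with h | h
    · have := (T n).card_le_univ
      rw [Fintype.card_fin] at this
      omega
    · exact h
  have hzero : ∀ n, T 0 ⊆ T n := fun n => by
    induction n with
    | zero => exact subset_rfl
    | succ n ih => exact ih.trans (hmono n)
  intro h
  have key : ∀ b : ℕ, Relation.TransGen (fun a b => (a, b) ∈ E) (i : ℕ) b →
      ∃ hb : b < N, (⟨b, hb⟩ : Fin N) ∈ T n := by
    intro b hb
    induction hb with
    | single h =>
      refine ⟨(hE _ h).2, hzero n ?_⟩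
      rw [hmem, pow_zero, mul_one, hAij]
      exact h
    | tail _ h ih =>
      obtain ⟨hb, hbT⟩ := ih
      refine ⟨(hE _ h).2, ?_⟩
      rw [← hfix, hmem, hstep]
      exact Or.inr ⟨_, (hmem _ _).1 hbT, h⟩
  obtain ⟨_, hj⟩ := key j h
  exact (hmem _ _).1 hj

end Paths

end RAM

namespace RAM

/-! ### Transitive closure in linear time -/

section TermNotation

variable {R : Type}

instance (n : ℕ) : OfNat (Term R) n := ⟨.const n⟩

instance : Add (Term R) := ⟨.add⟩

instance : Sub (Term R) := ⟨.sub⟩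

instance : Mul (Term R) := ⟨.mul⟩

instance : Div (Term R) := ⟨.div⟩

/-- The remainder is expressed by the quotient; as the quotient by `0` is `0`, it agrees with the
remainder of natural numbers for all divisors. -/
instance : Mod (Term R) := ⟨fun a b => a - a / b * b⟩

variable (I : List ℕ) (s : Store R)

@[simp] lemma Term.eval_ofNat (n : ℕ) : (no_index (OfNat.ofNat n) : Term R).eval I s = n := rfl

@[simp] lemma Term.eval_add (a b : Term R) : (a + b).eval I s = a.eval I s + b.eval I s := rfl

@[simp] lemma Term.eval_sub (a b : Term R) : (a - b).eval I s = a.eval I s - b.eval I s := rfl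

@[simp] lemma Term.eval_mul (a b : Term R) : (a * b).eval I s = a.eval I s * b.eval I s := rfl

@[simp] lemma Term.eval_div (a b : Term R) : (a / b).eval I s = a.eval I s / b.eval I s := rfl

@[simp] lemma Term.eval_mod (a b : Term R) : (a % b).eval I s = a.eval I s % b.eval I s := by
  change a.eval I s - a.eval I s / b.eval I s * b.eval I s = _
  have := Nat.div_add_mod' (a.eval I s) (b.eval I s)
  omega

lemma Term.eval_input (a : Term R) : (Term.input a).eval I s = I.getD (a.eval I s) 0 :=
  rfl

variable {I s}

lemma Store.set_of_ne [DecidableEq R] {j k : R} (h : j ≠ k) (u v : ℕ) : s.set k u v j = s j := by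
  funext w
  simp [Store.set, h]

lemma Code.Spec.set_seq [DecidableEq R] {j : R} {i e : Term R} {P : Code R} {T : ℕ}
    {Q : Store R → Prop}
    (h : P.Spec I (s.set j (i.eval I s) (e.eval I s)) T Q) :
    ((Code.set j i e).seq P).Spec I s (1 + T) Q := by
  refine Spec.seq (Spec.set (Q := fun s' => s' = s.set j (i.eval I s) (e.eval I s)) rfl) ?_
  rintro _ - rfl
  exact h

end TermNotation

/-- The arrays of the programs. The first ones hold a directed graph that is given by
its number of vertices and its list of edges (`size`, `count`, `source`, `target`). -/
inductive Register : Type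
  | size | count | source | target
  | rank | radix | base | powX | powZ | baseX | baseZ | fwd | bwd | tmp | i | k
  | width | table | reach | p | q | r | e | rep | mark | out
  deriving DecidableEq

instance : Fintype Register where
  elems := {.size, .count, .source, .target, .rank, .radix, .base, .powX, .powZ, .baseX, .baseZ,
    .fwd, .bwd, .tmp, .i, .k, .width, .table, .reach, .p, .q, .r, .e, .rep, .mark, .out}
  complete j := by cases j <;> decide

namespace Register

/-- The first cell of an array. -/
def val (j : Register) : Term Register := .cell j 0

/-- A cell of an array. -/
def get (j : Register) (a : Term Register) : Term Register := .cell j a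

@[simp] lemma eval_val (I : List ℕ) (s : Store Register) (j : Register) :
    j.val.eval I s = s j 0 := rfl

@[simp] lemma eval_get (I : List ℕ) (s : Store Register) (j : Register) (a : Term Register) :
    (j.get a).eval I s = s j (a.eval I s) := rfl

end Register

open Register Code

variable {I : List ℕ}

/-- The tables of the powers of the numbers in `baseX` and `baseZ`. -/
def powerTables : Code Register :=
  .seq (.set powX 0 1) <| .seq (.set powZ 0 1) <|
  .loop i radix.val <|
    .seq (.set powX (i.val + 1) (powX.get i.val * baseX.val))
      (.set powZ (i.val + 1) (powZ.get i.val * baseZ.val))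

lemma powerTables_spec (s : Store Register) :
    powerTables.Spec I s (3 + s radix 0 * 3) fun s' =>
      ∀ u ≤ s radix 0, s' powX u = s baseX 0 ^ u ∧ s' powZ u = s baseZ 0 ^ u := by
  rw [powerTables, show 3 + s radix 0 * 3 = 1 + (1 + (1 + s radix 0 * (1 + 2))) by ring]
  refine Spec.set_seq (Spec.set_seq ?_)
  refine (Spec.loop (fun n s' => ∀ u ≤ n, s' powX u = s baseX 0 ^ u ∧ s' powZ u = s baseZ 0 ^ u)
    (s radix 0) 2 (by simp [Store.set]) (by simp [Store.set]) ?_)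
  intro n hn s' hs' hinv
  have hx := congrFun (hs' baseX (by simp [writes])) 0
  have hz := congrFun (hs' baseZ (by simp [writes])) 0
  simp only [Store.set, reduceCtorEq, false_and, if_false] at hx hz
  refine Spec.set_seq (Spec.set ?_)
  intro u hu
  rcases Nat.lt_or_ge n u with h | h
  · obtain rfl : u = n + 1 := by omega
    simp [Store.set, hx, hz, hinv n le_rfl, pow_succ]
  · have : u ≠ n + 1 := by omega
    simpa [Store.set, this] using hinv u h

/-- Computes a power `radix = 2 ^ rank` that exceeds `size + 3`. -/
def findRadix : Code Register :=
  .seq (.set rank 0 0) <| .seq (.set radix 0 1) <|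
  .loop i (size.val + 4) <|
    .ite (size.val + 4 - radix.val)
      (.seq (.set radix 0 (radix.val * 2)) (.set rank 0 (rank.val + 1))) (.set tmp 0 0)

lemma findRadix_spec (s : Store Register) :
    findRadix.Spec I s (3 + (s size 0 + 4) * 4) fun s' =>
      s' radix 0 = 2 ^ s' rank 0 ∧ s size 0 + 4 ≤ s' radix 0 ∧ s' radix 0 ≤ 2 * (s size 0 + 4) := by
  rw [findRadix,
    show 3 + (s size 0 + 4) * 4 = 1 + (1 + (1 + (s size 0 + 4) * (1 + (1 + 2)))) by ring]
  refine Spec.set_seq (Spec.set_seq ?_)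
  refine (Spec.loop (fun n s' => s' radix 0 = 2 ^ s' rank 0 ∧ (s size 0 + 4 ≤ s' radix 0 ∨
    s' rank 0 = n) ∧ s' radix 0 ≤ 2 * (s size 0 + 4))
    (s size 0 + 4) (1 + 2) (by simp [Store.set]) (by simp [Store.set]; omega) ?_).mono le_rfl ?_
  · intro n hn s' hs' ⟨h1, h2, h3⟩
    have hx := congrFun (hs' size (by simp [writes])) 0
    simp only [Store.set, reduceCtorEq, false_and, if_false] at hx
    refine Spec.ite ?_ ?_
    · intro h
      simp [Store.set, hx] at h
      refine Spec.set_seq (Spec.set ?_)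
      simp [Store.set, h1, pow_succ]
      omega
    · intro h
      simp [Store.set, hx] at h
      refine (Spec.set ?_).mono (T := 1) (by omega) fun _ _ h => h
      simp [Store.set, h1]
      omega
  · rintro s' - ⟨h1, h2, h3⟩
    refine ⟨h1, h2.elim id fun h => ?_, h3⟩
    rw [h1, h]
    exact Nat.lt_two_pow_self.le

/-- Replaces the number in the cell `base[a]` by its power with the exponent `radix = 2 ^ rank`, by
squaring. -/
def raise (a : Term Register) : Code Register :=
  .loop k rank.val (.set base a (base.get a * base.get a))

lemma raise_spec (s : Store Register) (a : Term Register) (n : ℕ)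
    (ha : ∀ s' : Store Register, (∀ j, j ∉ (raise a).writes → s' j = s j) → a.eval I s' = n) :
    (raise a).Spec I s (1 + s rank 0 * 2) fun s' =>
      ∀ u, s' base u = if u = n then s base n ^ 2 ^ s rank 0 else s base u := by
  rw [raise, show 1 + s rank 0 * 2 = 1 + s rank 0 * (1 + 1) by ring]
  refine Spec.loop (fun l s' => ∀ u, s' base u = if u = n then s base n ^ 2 ^ l else s base u)
    (s rank 0) 1 (by simp) (by simp) ?_
  intro l hl s' hs' hinv
  refine Spec.set ?_
  have : a.eval I (s'.set k 0 l) = n := by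
    refine ha _ fun j hj => ?_
    rw [← hs' j hj]
    simp only [raise, writes, List.mem_cons, not_or] at hj
    funext u
    simp [Store.set, hj.1]
  intro u
  simp only [Term.eval_mul, eval_get, this, Store.set, reduceCtorEq, false_and, if_false, hinv,
    true_and]
  split_ifs <;> simp_all [pow_succ, pow_mul]

/-- The tower of the bases. The cell `base[u]` holds `(size + count + 2) ^ radix ^ (u + 1)`; each of
the `rank` squarings of a matrix descends by six bases. -/
def findBases : Code Register :=
  .seq (.set base 0 (size.val + count.val + 2)) <| .seq (raise 0) <|
  .loop i (6 * rank.val + 2) <| .seq (.set base (i.val + 1) (base.get i.val)) (raise (i.val + 1))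

lemma findBases_spec (s : Store Register) (κ : ℕ) (hκ : s rank 0 = κ) :
    findBases.Spec I s (3 + κ * 2 + (6 * κ + 2) * (3 + κ * 2)) fun s' =>
      ∀ u ≤ 6 * κ + 2, s' base u = (s size 0 + s count 0 + 2) ^ ((2 ^ κ) ^ (u + 1)) := by
  subst hκ
  rw [findBases, show 3 + s rank 0 * 2 + (6 * s rank 0 + 2) * (3 + s rank 0 * 2) =
    1 + ((1 + s rank 0 * 2) + (1 + (6 * s rank 0 + 2) * (1 + (1 + (1 + s rank 0 * 2))))) by ring]
  refine Spec.set_seq (Spec.seq (raise_spec _ 0 0 fun s' _ => rfl) ?_)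
  intro s₁ hs₁ h₁
  have hr := congrFun (hs₁ rank (by simp [writes, raise])) 0
  simp only [Store.set, reduceCtorEq, false_and, if_false] at hr
  refine Spec.loop (fun l s' => ∀ u ≤ l, s' base u = (s size 0 + s count 0 + 2) ^
    ((2 ^ s rank 0) ^ (u + 1))) (6 * s rank 0 + 2) (1 + (1 + s rank 0 * 2)) (by simp [hr]) ?_ ?_
  · intro u hu
    obtain rfl : u = 0 := by omega
    rw [h₁]
    simp [Store.set]
  · intro l hl s' hs' hinv
    have hr' := congrFun (hs' rank (by simp [writes, raise])) 0
    refine Spec.set_seq ((raise_spec _ (i.val + 1) (l + 1) ?_).mono ?_ ?_)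
    · intro s'' hs''
      have := congrFun (hs'' i (by simp [writes, raise])) 0
      simpa [Store.set] using this
    · simp [Store.set, hr', hr]
    · intro s'' _ h u hu
      rw [h]
      rcases Nat.lt_or_ge l u with h | h
      · obtain rfl : u = l + 1 := by omega
        simp [Store.set, hr', hr, hinv l le_rfl, ← pow_mul, pow_succ]
      · have : u ≠ l + 1 := by omega
        simpa [Store.set, this] using hinv u h

/-- Packs the adjacency matrix `A` of the graph, and the matrix `1 + A` with reversed rows. -/
def packGraph : Code Register :=
  .seq (.set fwd 0 0) <| .seq (.set bwd 0 0) <|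
  .seq (.loop i count.val <|
    .seq (.set fwd 0 (fwd.val + powX.get (source.get i.val) * powZ.get (target.get i.val)))
      (.set bwd 0
        (bwd.val + powX.get (radix.val - source.get i.val) * powZ.get (target.get i.val)))) <|
  .loop i size.val <| .set bwd 0 (bwd.val + powX.get (radix.val - i.val) * powZ.get i.val)

/-- The list of the edges of the graph in the arrays `source` and `target`. -/
def edges (s : Store Register) : List (ℕ × ℕ) :=
  (List.range (s count 0)).map fun l => (s source l, s target l)

lemma packGraph_spec (s : Store Register) (N : ℕ) (x z : ℕ) (hN : s size 0 = N)
    (hR : N + 4 ≤ s radix 0) (hpow : ∀ u ≤ s radix 0, s powX u = x ^ u ∧ s powZ u = z ^ u)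
    (hE : ∀ e ∈ edges s, e.1 < N ∧ e.2 < N) :
    packGraph.Spec I s (4 + s count 0 * 3 + N * 2) fun s' =>
      s' fwd 0 = pack (fun l => l) (adjacency N (edges s)) x z ∧
      s' bwd 0 = pack (fun l => s radix 0 - l) (1 + adjacency N (edges s)) x z := by
  subst hN
  have hE' : ∀ l < s count 0, s source l < s size 0 ∧ s target l < s size 0 := fun l hl =>
    hE (s source l, s target l) (List.mem_map.2 ⟨l, List.mem_range.2 hl, rfl⟩)
  have hsum : ∀ φ : ℕ → ℕ, pack φ (adjacency (s size 0) (edges s)) x z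
      = ∑ l ∈ Finset.range (s count 0), x ^ φ (s source l) * z ^ s target l := by
    intro φ
    rw [pack_adjacency _ hE, edges, List.map_map]
    generalize s count 0 = m
    induction m with
    | zero => rfl
    | succ m ih => simp [List.range_succ, Finset.sum_range_succ, ih]
  rw [packGraph, show 4 + s count 0 * 3 + s size 0 * 2 =
    1 + (1 + ((1 + s count 0 * (1 + 2)) + (1 + s size 0 * (1 + 1)))) by ring]
  refine Spec.set_seq (Spec.set_seq ?_)
  refine Spec.seq (Spec.loop (fun n s' =>
    s' fwd 0 = ∑ l ∈ Finset.range n, x ^ s source l * z ^ s target l ∧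
    s' bwd 0 = ∑ l ∈ Finset.range n, x ^ (s radix 0 - s source l) * z ^ s target l)
    (s count 0) 2 (by simp [Store.set]) (by simp [Store.set]) ?_) ?_
  · intro n hn s' hs' ⟨h1, h2⟩
    have e1 := hs' powX (by simp [writes])
    have e2 := hs' powZ (by simp [writes])
    have e3 := hs' source (by simp [writes])
    have e4 := hs' target (by simp [writes])
    have e5 := hs' radix (by simp [writes])
    obtain ⟨a1, a2⟩ := hE' n hn
    refine Spec.set_seq (Spec.set ?_)
    simp only [Term.eval_add, Term.eval_mul, Term.eval_sub, eval_get, eval_val, Term.eval_ofNat,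
      Store.set, e1, e2, e3, e4, e5, reduceCtorEq, false_and, and_self, if_false, if_true, h1, h2,
      Finset.sum_range_succ]
    rw [(hpow (s source n) (by omega)).1, (hpow (s target n) (by omega)).2,
      (hpow (s radix 0 - s source n) (by omega)).1]
    simp
  · intro s₁ hs₁ ⟨h1, h2⟩
    have e1 := hs₁ powX (by simp [writes])
    have e2 := hs₁ powZ (by simp [writes])
    have e5 := hs₁ radix (by simp [writes])
    have e6 := hs₁ size (by simp [writes])
    refine (Spec.loop (fun n s' => s' fwd 0 = s₁ fwd 0 ∧
      s' bwd 0 = s₁ bwd 0 + ∑ l ∈ Finset.range n, x ^ (s radix 0 - l) * z ^ l)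
      (s size 0) 1 (by simp [Store.set, e6]) (by simp) ?_).mono le_rfl ?_
    · intro n hn s' hs' ⟨h3, h4⟩
      have e1' := hs' powX (by simp [writes])
      have e2' := hs' powZ (by simp [writes])
      have e5' := hs' radix (by simp [writes])
      refine Spec.set ?_
      simp only [Term.eval_add, Term.eval_mul, Term.eval_sub, eval_get, eval_val, Term.eval_ofNat,
        Store.set, e1, e2, e5, e1', e2', e5', reduceCtorEq, false_and, and_self, if_false,
        if_true, h3, h4, Finset.sum_range_succ]
      rw [(hpow n (by omega)).2, (hpow (s radix 0 - n) (by omega)).1]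
      simp [add_assoc]
    · rintro s₂ - ⟨h3, h4⟩
      rw [h3, h4, h1, h2, hsum, pack_add, pack_one, hsum, add_comm]
      exact ⟨rfl, rfl⟩

end RAM

namespace RAM

open Register Code

variable {I : List ℕ}

/-- One step of the computation of `A (1 + A) ^ (2 ^ t - 1)` and `(1 + A) ^ (2 ^ t)` by squaring,
for the packed matrices in `fwd` and `bwd`. The bases are `base[k + 2]` and `base[k]` before the
step and `base[k - 4]` and `base[k - 6]` after it; `base[k - 2]` is the base in which the product is
expanded, and `base[k - 1]` is its power with the exponent `radix`. -/
def squareStep : Code Register :=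
  .seq (.set k 0 (6 * (rank.val - i.val))) <|
  .seq (.set tmp 0 (bwd.val % (base.get (k.val + 2) - base.get (k.val - 2)) %
    (base.get k.val - base.get (k.val - 6)))) <|
  .seq (.set fwd 0 (fwd.val % (base.get (k.val + 2) - base.get (k.val - 4)) %
    (base.get k.val - base.get (k.val - 2)) * tmp.val / base.get (k.val - 1) %
      base.get (k.val - 2))) <|
  .set bwd 0 (bwd.val % (base.get (k.val + 2) - base.get (k.val - 4)) %
    (base.get k.val - base.get (k.val - 2)) * tmp.val / base.get (k.val - 1) %
      base.get (k.val - 2))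

/-- Computes the transitive closure of the graph in the arrays `source` and `target`. -/
def closure : Code Register :=
  .seq findRadix <| .seq findBases <|
  .seq (.set baseX 0 (base.get (6 * rank.val + 2))) <|
  .seq (.set baseZ 0 (base.get (6 * rank.val))) <|
  .seq powerTables <| .seq packGraph <|
  .seq (.loop i rank.val squareStep) <|
  .seq (.set baseX 0 (base.get 2)) <| .seq (.set baseZ 0 (base.get 0)) powerTables

/-- The entry in the row `u` and the column `v` of the matrix in `fwd`. After the execution of
`closure`, it vanishes if and only if no path of positive length leads from `u` to `v`. -/
def connected (u v : Term Register) : Term Register :=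
  fwd.val / powX.get u % baseX.val / powZ.get v % baseZ.val

/-- The sum of the entries of a matrix that occurs in the computation of the transitive closure
stays below the bases. -/
lemma total_pow_le {N : ℕ} (A B : Matrix (Fin N) (Fin N) ℕ) (S : ℕ) (hA : total A ≤ S)
    (hB : total B ≤ S) (t : ℕ) :
    total (A * B ^ (2 ^ t - 1)) ≤ S ^ 2 ^ t ∧ total (B ^ 2 ^ t) ≤ S ^ 2 ^ t := by
  have hpow : ∀ n, total (A * B ^ n) ≤ S ^ (n + 1) := by
    intro n
    induction n with
    | zero => simpa using hA
    | succ n ih =>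
      rw [pow_succ, ← mul_assoc, pow_succ S]
      exact (total_mul_le _ _).trans (Nat.mul_le_mul ih hB)
  have hpow' : ∀ n, total (B ^ (n + 1)) ≤ S ^ (n + 1) := by
    intro n
    induction n with
    | zero => simpa using hB
    | succ n ih =>
      rw [pow_succ, pow_succ S]
      exact (total_mul_le _ _).trans (Nat.mul_le_mul ih hB)
  have h1 := Nat.one_le_two_pow (n := t)
  have h := hpow (2 ^ t - 1)
  have h' := hpow' (2 ^ t - 1)
  rw [Nat.sub_add_cancel h1] at h h'
  exact ⟨h, h'⟩

/-- The matrix `A (1 + A) ^ (R - 1)` is computed by `κ` squarings, where `R = 2 ^ κ` exceeds the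
number of vertices. -/
lemma squares_spec (s : Store Register) (N κ R w : ℕ) (A : Matrix (Fin N) (Fin N) ℕ)
    (hκ : s rank 0 = κ) (hR : R = 2 ^ κ) (hN : N + 4 ≤ R) (hw : N + total A + 2 ≤ w)
    (hbase : ∀ u ≤ 6 * κ + 2, s base u = w ^ (R ^ (u + 1)))
    (hfwd : s fwd 0 = pack (fun l => l) A (s base (6 * κ + 2)) (s base (6 * κ)))
    (hbwd : s bwd 0 = pack (fun l => R - l) (1 + A) (s base (6 * κ + 2)) (s base (6 * κ))) :
    (Code.loop i rank.val squareStep).Spec I s (1 + κ * 5) fun s' =>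
      s' fwd 0 = pack (fun l => l) (A * (1 + A) ^ (R - 1)) (s base 2) (s base 0) := by
  subst hR
  have htotal := total_pow_le A (1 + A) (N + total A) (by omega) (by rw [total_add, total_one])
  refine (Spec.loop (fun t s' =>
    s' fwd 0 = pack (fun l => l) (A * (1 + A) ^ (2 ^ t - 1)) (s base (6 * (κ - t) + 2))
      (s base (6 * (κ - t))) ∧
    s' bwd 0 = pack (fun l => 2 ^ κ - l) ((1 + A) ^ 2 ^ t) (s base (6 * (κ - t) + 2))
      (s base (6 * (κ - t)))) κ 4 (by simp [hκ]) (by simp [hfwd, hbwd]) ?_).mono (by omega) ?_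
  · intro t ht s' hs' ⟨h1, h2⟩
    have e1 := hs' rank (by simp [writes, squareStep])
    have e2 := hs' base (by simp [writes, squareStep])
    obtain ⟨l, hl⟩ : ∃ l, κ - t = l + 1 := ⟨κ - t - 1, by omega⟩
    have hl' : κ - (t + 1) = l := by omega
    have hpow : ∀ u, u + 2 ≤ 6 * κ + 2 → s base (u + 2) = s base u ^ (2 ^ κ * 2 ^ κ) := by
      intro u hu
      rw [hbase _ hu, hbase u (by omega), ← pow_mul w]
      congr 1
      generalize 2 ^ κ = R
      ring
    have hpow1 : s base (6 * l + 5) = s base (6 * l + 4) ^ 2 ^ κ := by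
      rw [hbase _ (by omega), hbase _ (by omega), ← pow_mul w]
      congr 1
    have hlarge : ∀ M : Matrix (Fin N) (Fin N) ℕ, total M ≤ (N + total A) ^ 2 ^ t →
        total M ≤ s base (6 * l) := by
      intro M hM
      rw [hbase _ (by omega)]
      refine hM.trans ((Nat.pow_le_pow_left (by omega) _).trans
        (Nat.pow_le_pow_right (n := w) (by omega) ?_))
      exact (Nat.pow_le_pow_right (by omega) ht.le).trans (Nat.le_self_pow (by omega) _)
    have hz' : 2 ≤ s base (6 * l) := by
      rw [hbase _ (by omega)]
      exact (show 2 ≤ w by omega).trans (Nat.le_self_pow (by positivity) _)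
    have hprod : ∀ (φ : ℕ → ℕ) (M M' : Matrix (Fin N) (Fin N) ℕ), (∀ l < N, φ l ≤ 2 ^ κ) →
        total M ≤ (N + total A) ^ 2 ^ t → total M' ≤ (N + total A) ^ 2 ^ t →
        pack φ M (s base (6 * (l + 1) + 2)) (s base (6 * (l + 1))) %
          (s base (6 * (l + 1) + 2) - s base (6 * l + 2)) %
          (s base (6 * (l + 1)) - s base (6 * l + 4)) *
        (pack (fun l => 2 ^ κ - l) M' (s base (6 * (l + 1) + 2)) (s base (6 * (l + 1))) %
          (s base (6 * (l + 1) + 2) - s base (6 * l + 4)) %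
          (s base (6 * (l + 1)) - s base (6 * l))) / s base (6 * l + 5) % s base (6 * l + 4)
        = pack φ (M * M') (s base (6 * l + 2)) (s base (6 * l)) := by
      intro φ M M' hφ hM hM'
      rw [hpow1]
      exact pack_product hN hφ (hpow _ (by omega)) (hpow (6 * l + 2) (by omega))
        (hpow (6 * l + 4) (by omega)) (hpow (6 * l + 6) (by omega)) hz' (hlarge M hM)
        (hlarge M' hM')
    have i1 : 6 * (l + 1) - 2 = 6 * l + 4 := by omega
    have i2 : 6 * (l + 1) - 4 = 6 * l + 2 := by omega
    have i3 : 6 * (l + 1) - 1 = 6 * l + 5 := by omega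
    have i4 : 6 * (l + 1) - 6 = 6 * l := by omega
    refine Spec.set_seq (Spec.set_seq (Spec.set_seq (Spec.set ?_)))
    rw [hl] at h1 h2
    simp [Store.set, e1, e2, hκ, hl, hl', i1, i2, i3, i4, h1, h2]
    rw [hprod _ _ _ (fun l hl => by omega) (htotal t).1 (htotal t).2,
      hprod _ _ _ (fun l hl => by omega) (htotal t).2 (htotal t).2]
    have hpos := Nat.one_le_two_pow (n := t)
    constructor
    · rw [mul_assoc, ← pow_add]
      congr 3
      rw [pow_succ]
      omega
    · rw [← pow_add, ← two_mul, ← pow_succ']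
  · rintro s' - ⟨h1, -⟩
    rw [h1]
    simp

lemma sq_le_two_mul_two_pow (n : ℕ) : n * n ≤ 2 * 2 ^ n := by
  rcases Nat.lt_or_ge n 3 with h | h
  · interval_cases n <;> norm_num
  · induction n, h using Nat.le_induction with
    | base => norm_num
    | succ n hn ih =>
      rw [pow_succ]
      nlinarith

/-- The transitive closure of the graph can be read off after the execution of `closure`, which
needs linear time. -/
theorem closure_spec (s : Store Register) (hE : ∀ l < s count 0, s source l < s size 0 ∧
    s target l < s size 0) :
    closure.Spec I s (1000 * (s size 0 + s count 0 + 1)) fun s' =>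
      ∀ u < s size 0, ∀ v < s size 0,
        (s' fwd 0 / s' powX u % s' baseX 0 / s' powZ v % s' baseZ 0 ≠ 0 ↔ Relation.TransGen
          (fun a b => ∃ l < s count 0, s source l = a ∧ s target l = b) u v) := by
  set N := s size 0 with hN
  have hE' : ∀ e ∈ edges s, e.1 < N ∧ e.2 < N := by
    intro e he
    obtain ⟨l, hl, rfl⟩ := List.mem_map.1 he
    exact hE l (List.mem_range.1 hl)
  set A := adjacency N (edges s) with hA
  have htA : total A = s count 0 := by rw [hA, total_adjacency hE']; simp [edges]
  have hrel : (fun a b => (a, b) ∈ edges s)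
      = fun a b => ∃ l < s count 0, s source l = a ∧ s target l = b := by
    funext a b
    simp [edges]
  set w := N + s count 0 + 2 with hw
  -- `K` bounds the radix `2 ^ κ`, and thereby `κ` and, up to a factor, `κ * κ`.
  set K := (2 * (N + 4)) with hK
  refine Spec.mono (T := 3 + (N + 4) * 4 + (9 + 40 * K + (1 + (1 + (3 + K * 3 +
    (4 + s count 0 * 3 + N * 2 + ((1 + K * 5) + (1 + (1 + (3 + K * 3)))))))))) ?_ (by omega)
      fun _ _ h => h
  refine Spec.seq (findRadix_spec s) fun s₁ hs₁ ⟨h1, h2, h3⟩ => ?_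
  obtain ⟨κ, hκ⟩ : ∃ κ, s₁ rank 0 = κ := ⟨_, rfl⟩
  rw [hκ] at h1
  rw [h1] at h2 h3
  have hκK : κ ≤ K := Nat.lt_two_pow_self.le.trans h3
  have hκK' : κ * κ ≤ 2 * K := (sq_le_two_mul_two_pow κ).trans (Nat.mul_le_mul_left 2 h3)
  have a1 : s₁ size = s size := hs₁ _ (by simp [writes, findRadix])
  have a2 : s₁ count = s count := hs₁ _ (by simp [writes, findRadix])
  have a3 : s₁ source = s source := hs₁ _ (by simp [writes, findRadix])
  have a4 : s₁ target = s target := hs₁ _ (by simp [writes, findRadix])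
  refine Spec.seq ((findBases_spec s₁ κ hκ).mono (by nlinarith) fun _ _ h => h)
    fun s₂ hs₂ hbase => ?_
  have b1 : s₂ size = s size := (hs₂ _ (by simp [writes, findBases, raise])).trans a1
  have b2 : s₂ count = s count := (hs₂ _ (by simp [writes, findBases, raise])).trans a2
  have b3 : s₂ source = s source := (hs₂ _ (by simp [writes, findBases, raise])).trans a3
  have b4 : s₂ target = s target := (hs₂ _ (by simp [writes, findBases, raise])).trans a4
  have b5 : s₂ radix = s₁ radix := hs₂ _ (by simp [writes, findBases, raise])
  have b6 : s₂ rank = s₁ rank := hs₂ _ (by simp [writes, findBases, raise])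
  rw [a1, a2, ← hN, ← hw] at hbase
  refine Spec.set_seq (Spec.set_seq (Spec.seq ((powerTables_spec _).mono ?_ fun _ _ h => h) ?_))
  · simp [Store.set, b5, h1]
    omega
  intro s₃ hs₃ hpow
  simp [Store.set, b5, b6, h1, hκ] at hpow
  have c1 : s₃ size = s size := by rw [← b1, hs₃ _ (by simp [writes, powerTables])]; rfl
  have c2 : s₃ count = s count := by rw [← b2, hs₃ _ (by simp [writes, powerTables])]; rfl
  have c3 : s₃ source = s source := by rw [← b3, hs₃ _ (by simp [writes, powerTables])]; rfl
  have c4 : s₃ target = s target := by rw [← b4, hs₃ _ (by simp [writes, powerTables])]; rfl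
  have c5 : s₃ radix = s₁ radix := by rw [← b5, hs₃ _ (by simp [writes, powerTables])]; rfl
  have c6 : s₃ rank = s₁ rank := by rw [← b6, hs₃ _ (by simp [writes, powerTables])]; rfl
  have c7 : s₃ base = s₂ base := by rw [hs₃ _ (by simp [writes, powerTables])]; rfl
  have hedges : edges s₃ = edges s := by simp [edges, c2, c3, c4]
  refine Spec.seq ((packGraph_spec s₃ N _ _ (by rw [c1]) (by rw [c5, h1]; exact h2)
    (by rw [c5, h1]; exact hpow) (by rw [hedges]; exact hE')).mono (by rw [c2]) fun _ _ h => h) ?_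
  intro s₄ hs₄ hpack
  rw [hedges, c5, h1] at hpack
  have d1 : s₄ rank = s₁ rank := by rw [← c6, hs₄ _ (by simp [writes, packGraph])]
  have d2 : s₄ base = s₂ base := by rw [← c7, hs₄ _ (by simp [writes, packGraph])]
  have d3 : s₄ radix = s₁ radix := by rw [← c5, hs₄ _ (by simp [writes, packGraph])]
  refine Spec.seq ((squares_spec s₄ N κ (2 ^ κ) w A (by rw [d1, hκ]) rfl h2
    (by rw [htA]) (by rw [d2]; exact hbase) (by rw [d2]; exact hpack.1)
    (by rw [d2]; exact hpack.2)).mono (by omega) fun _ _ h => h) ?_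
  intro s₅ hs₅ hclosure
  have e1 : s₅ base = s₂ base := by rw [← d2, hs₅ _ (by simp [writes, squareStep])]
  have e2 : s₅ radix = s₁ radix := by rw [← d3, hs₅ _ (by simp [writes, squareStep])]
  refine Spec.set_seq (Spec.set_seq ((powerTables_spec _).mono ?_ ?_))
  · simp [Store.set, e2, h1]
    omega
  intro s₆ hs₆ hpow' u hu v hv
  simp [Store.set, e1, e2, h1] at hpow'
  have f1 : s₆ fwd 0 = s₅ fwd 0 := by rw [hs₆ _ (by simp [writes, powerTables])]; rfl
  have f2 : s₆ baseX 0 = s₂ base 2 := by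
    rw [hs₆ _ (by simp [writes, powerTables])]; simp [Store.set, e1]
  have f3 : s₆ baseZ 0 = s₂ base 0 := by
    rw [hs₆ _ (by simp [writes, powerTables])]; simp [Store.set, e1]
  have hz : s₂ base 0 = w ^ 2 ^ κ := by rw [hbase 0 (by omega)]; simp
  rw [f1, f2, f3, hclosure, (hpow' u (by omega)).1, (hpow' v (by omega)).2, d2,
    pack_entry (R := 2 ^ κ) h2 _ _ _ ⟨u, hu⟩ ⟨v, hv⟩,
    adjacency_mul_pow_ne_zero_iff hE' (by omega), hrel]
  · rw [hz, hbase 2 (by omega), ← pow_mul w]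
    congr 1
    generalize 2 ^ κ = R
    ring
  · rw [hz]
    exact (show 2 ≤ w by omega).trans (Nat.le_self_pow (by positivity) _)
  · refine lt_of_le_of_lt (total_pow_le A (1 + A) (N + total A) (by omega)
      (by rw [total_add, total_one]) κ).1 ?_
    rw [hz, htA]
    exact Nat.pow_lt_pow_left (by omega) (by positivity)

end RAM

namespace RAM

/-! ### Tests and universal quantification -/

section Tests

variable {R : Type} [DecidableEq R] {I : List ℕ} {s : Store R}

/-- The register `out` answers the question whether `φ` holds. -/
def Holds (out : R) (s : Store R) (φ : Prop) : Prop := (φ → s out 0 = 1) ∧ (¬ φ → s out 0 = 0)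

/-- A term that vanishes if and only if the values of two terms agree. -/
def Term.distance (a b : Term R) : Term R := a - b + (b - a)

omit [DecidableEq R] in
@[simp] lemma Term.distance_eq_zero (a b : Term R) :
    (a.distance b).eval I s = 0 ↔ a.eval I s = b.eval I s := by
  simp only [distance, eval_add, eval_sub]
  omega

omit [DecidableEq R] in
lemma Holds.congr {out : R} {φ ψ : Prop} (h : Holds out s φ) (hiff : φ ↔ ψ) : Holds out s ψ := by
  rwa [← propext hiff]

omit [DecidableEq R] in
lemma Holds.of_eq {out : R} {s' : Store R} {φ : Prop} (h : Holds out s φ) (hs : s' out = s out) :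
    Holds out s' φ := by
  rwa [Holds, hs]

namespace Code

/-- The rule for a loop that tests `φ i` in the round number `i`, in conjunction with a condition
`p` that has been tested before. -/
lemma Spec.forall_loop {j out : R} {n : Term R} {P : Code R} {p : Prop} (N T : ℕ) (φ : ℕ → Prop)
    (hj : out ≠ j) (hn : n.eval I s = N) (h0 : Holds out s p)
    (hstep : ∀ i < N, ∀ (p : Prop) (s' : Store R),
      (∀ k, k ∉ (Code.loop j n P).writes → s' k = s k) → Holds out (s'.set j 0 i) p →
      P.Spec I (s'.set j 0 i) T fun s'' => Holds out s'' (p ∧ φ i)) :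
    (Code.loop j n P).Spec I s (1 + N * (1 + T)) fun s' => Holds out s' (p ∧ ∀ i < N, φ i) := by
  refine (Spec.loop (fun n s' => Holds out s' (p ∧ ∀ i < n, φ i)) N T hn
    (h0.congr (by simp)) ?_)
  intro i hi s' hs' hinv
  have hset : (s'.set j 0 i) out = s' out := by
    funext u
    simp [Store.set, hj]
  refine (hstep i hi _ s' hs' (hinv.of_eq hset)).mono le_rfl fun s'' _ h => h.congr ?_
  rw [and_assoc]
  refine and_congr_right fun _ => ⟨fun h l hl => ?_, fun h => ⟨fun l hl => h l (by omega),
    h i (by omega)⟩⟩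
  rcases Nat.lt_succ_iff_lt_or_eq.1 hl with hl | rfl
  · exact h.1 l hl
  · exact h.2

/-- The rule for a test that is only made if the condition `c` holds. -/
lemma Spec.guard {out : R} {e : Term R} {P : Code R} {p c φ : Prop} {T : ℕ} (hT : 1 ≤ T)
    (hc : e.eval I s = 0 ↔ c) (h0 : Holds out s p)
    (h : c → P.Spec I s T fun s' => Holds out s' (p ∧ φ)) :
    (Code.ite e .skip P).Spec I s (1 + T) fun s' => Holds out s' (p ∧ (c → φ)) := by
  refine Spec.ite (fun he => ?_) fun he => ?_
  · refine (Spec.skip (Q := fun s' => Holds out s' (p ∧ (c → φ))) (h0.congr ?_)).mono hT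
      fun _ _ h => h
    have : ¬ c := fun h => he (hc.2 h)
    simp [this]
  · refine (h (hc.1 he)).mono le_rfl fun s' _ h' => h'.congr ?_
    simp [hc.1 he]

/-- Sets the answer to "no" if the value of `e` is not zero. -/
def require (out : R) (e : Term R) : Code R := .ite e (.set out 0 0) .skip

lemma Spec.require {out : R} {e : Term R} {p c : Prop} (hc : e.eval I s = 0 ↔ c)
    (h0 : Holds out s p) :
    (Code.require out e).Spec I s 2 fun s' => Holds out s' (p ∧ c) := by
  refine Spec.ite (T := 1) (fun he => Spec.set ?_) fun he => Spec.skip ?_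
  · have : ¬ c := fun h => he (hc.2 h)
    simp [Holds, this, Store.set]
  · simpa [hc.1 he] using h0

end Code

end Tests

/-! ### The algorithm for multiplication tables -/

open Register Code

/-- `y` is an idempotent that generates the same right ideal as the idempotent `x`. -/
def RightRelated (f : ℕ → ℕ → ℕ) (x y : ℕ) : Prop := f y y = y ∧ f x y = y ∧ f y x = x

/-- `x` is an idempotent below `e`. -/
def Below (f : ℕ → ℕ → ℕ) (e x : ℕ) : Prop := f x x = x ∧ f e x = x ∧ f x e = x

open Classical in
/-- The largest number below `n` that is related to `x`. -/
noncomputable def representative (f : ℕ → ℕ → ℕ) (n x : ℕ) : ℕ :=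
  ((Finset.range n).filter (RightRelated f x)).sup id

section Representatives

variable {f : ℕ → ℕ → ℕ} {n x y : ℕ}

lemma rightRelated_representative (hx : x < n) (hxx : f x x = x) :
    RightRelated f x (representative f n x) ∧ representative f n x < n := by
  classical
  obtain ⟨y, hy, h⟩ := Finset.exists_mem_eq_sup ((Finset.range n).filter (RightRelated f x))
    ⟨x, by simp [RightRelated, hx, hxx]⟩ id
  rw [representative, h]
  simpa [and_comm] using hy

lemma representative_succ_of_rightRelated (h : RightRelated f x n) :
    representative f (n + 1) x = n := by
  rw [representative, Finset.range_add_one, Finset.filter_insert, if_pos h, Finset.sup_insert,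
    id, sup_eq_left]
  refine Finset.sup_le fun y hy => ?_
  simp only [Finset.mem_filter, Finset.mem_range] at hy
  exact hy.1.le

lemma representative_succ_of_not_rightRelated (h : ¬ RightRelated f x n) :
    representative f (n + 1) x = representative f n x := by
  rw [representative, Finset.range_add_one, Finset.filter_insert, if_neg h, representative]

open Classical in
/-- The representatives agree if and only if the idempotents generate the same right ideal. -/
lemma representative_eq_iff (hassoc : ∀ a < n, ∀ b < n, ∀ c < n, f (f a b) c = f a (f b c))
    (hx : x < n) (hy : y < n) (hxx : f x x = x) (hyy : f y y = y) :
    representative f n x = representative f n y ↔ f x y = y ∧ f y x = x := by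
  constructor
  · intro h
    obtain ⟨⟨-, h1, h2⟩, hz⟩ := rightRelated_representative hx hxx
    obtain ⟨⟨-, h3, h4⟩, -⟩ := rightRelated_representative hy hyy
    rw [← h] at h3 h4
    generalize representative f n x = z at h1 h2 h3 h4 hz
    constructor
    · rw [← h4, ← hassoc x hx z hz y hy, h1]
    · rw [← h2, ← hassoc y hy z hz x hx, h3]
  · rintro ⟨h1, h2⟩
    refine congrArg (fun A : Finset ℕ => A.sup id) (Finset.filter_congr fun z hz => ?_)
    rw [Finset.mem_range] at hz
    refine and_congr_right fun _ => ⟨fun ⟨h3, h4⟩ => ⟨?_, ?_⟩, fun ⟨h3, h4⟩ => ⟨?_, ?_⟩⟩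
    · rw [← h3, ← hassoc y hy x hx z hz, h2]
    · rw [← h1, ← hassoc z hz x hx y hy, h4]
    · rw [← h3, ← hassoc x hx y hy z hz, h1]
    · rw [← h2, ← hassoc z hz y hy x hx, h4]

end Representatives

section TableProgram

variable (m : Term Register → Term Register → Term Register)

/-- Vanishes if and only if the idempotents `p` and `q` are related. -/
def relatedTerm : Term Register :=
  (m q.val q.val).distance q.val + ((m p.val q.val).distance q.val +
    (m q.val p.val).distance p.val)

/-- Vanishes if and only if `p` is an idempotent below `e`. -/
def belowTerm : Term Register :=
  (m p.val p.val).distance p.val + ((m e.val p.val).distance p.val +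
    (m p.val e.val).distance p.val)

/-- Computes the representatives of all classes of related idempotents. -/
def findRepresentatives : Code Register :=
  .loop p (.input 0) <| .seq (.set rep p.val 0) <|
    .loop q (.input 0) <| .ite (relatedTerm m) .skip (.set rep p.val q.val)

/-- Decides by means of a multiplication table, which is given by `m`, whether all elements of the
local submonoids are idempotent and related idempotents of local submonoids are equal. -/
def tableCode : Code Register :=
  .seq (.set out 0 1) <| .seq (findRepresentatives m) <|
  .loop e (.input 0) <| .ite ((m e.val e.val).distance e.val) .skip <|
    .seq (.loop p (.input 0) <| .require out <|
      (m (m (m e.val p.val) e.val) (m (m e.val p.val) e.val)).distance (m (m e.val p.val) e.val)) <|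
    .seq (.loop p (.input 0) <| .ite (belowTerm m) .skip (.set mark (rep.get p.val) p.val)) <|
    .loop p (.input 0) <| .ite (belowTerm m) .skip <|
      .require out ((mark.get (rep.get p.val)).distance p.val)

variable {m} {I : List ℕ} {f : ℕ → ℕ → ℕ} {k : ℕ}

lemma relatedTerm_eq_zero (hm : ∀ a b s, (m a b).eval I s = f (a.eval I s) (b.eval I s))
    (s : Store Register) : (relatedTerm m).eval I s = 0 ↔ RightRelated f (s p 0) (s q 0) := by
  simp [relatedTerm, RightRelated, hm]

lemma belowTerm_eq_zero (hm : ∀ a b s, (m a b).eval I s = f (a.eval I s) (b.eval I s))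
    (s : Store Register) : (belowTerm m).eval I s = 0 ↔ Below f (s e 0) (s p 0) := by
  simp [belowTerm, Below, hm]

lemma findRepresentatives_spec (hk : I.getD 0 0 = k)
    (hm : ∀ a b s, (m a b).eval I s = f (a.eval I s) (b.eval I s)) (s : Store Register) :
    (findRepresentatives m).Spec I s (1 + k * (1 + (1 + (1 + k * 3)))) fun s' =>
      ∀ x < k, s' rep x = representative f k x := by
  refine Spec.loop (fun n s' => ∀ x < n, s' rep x = representative f k x) k _ hk
    (by simp) ?_
  intro x hx s' _ hinv
  refine Spec.set_seq ((Spec.loop (fun n s'' => s'' p 0 = x ∧ s'' rep x = representative f n x ∧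
    ∀ y < x, s'' rep y = representative f k y) k 2 (by exact hk) ?_ ?_).mono le_rfl ?_)
  · refine ⟨by simp [Store.set], by simp [Store.set, representative], fun y hy => ?_⟩
    simp [Store.set, hy.ne, hinv y hy]
  · intro y hy s'' _ ⟨h1, h2, h3⟩
    have hrel := relatedTerm_eq_zero hm (s''.set q 0 y)
    simp only [Store.set, reduceCtorEq, false_and, if_false, true_and, if_true, h1] at hrel
    refine Spec.ite (T := 1) (fun h => Spec.skip ?_) fun h => Spec.set ?_
    · refine ⟨by simp [Store.set, h1], ?_, fun z hz => by simp [Store.set, h3 z hz]⟩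
      rw [representative_succ_of_not_rightRelated fun h' => h (hrel.2 h')]
      simp [Store.set, h2]
    · refine ⟨by simp [Store.set, h1], ?_, fun z hz => by simp [Store.set, h1, hz.ne, h3 z hz]⟩
      rw [representative_succ_of_rightRelated (hrel.1 h)]
      simp [Store.set, h1]
  · intro s'' _ ⟨_, h2, h3⟩ y hy
    rcases Nat.lt_succ_iff_lt_or_eq.1 hy with hy | rfl
    · exact h3 y hy
    · exact h2

/-- The condition that is tested by `tableCode`. -/
def TableCondition (f : ℕ → ℕ → ℕ) (k : ℕ) : Prop :=
  ∀ e < k, f e e = e → (∀ x < k, f (f (f e x) e) (f (f e x) e) = f (f e x) e) ∧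
    ∀ x < k, Below f e x → ∀ y < k, Below f e y → f x y = y → f y x = x → x = y

/-- The test takes quadratic time. Idempotents below `e` that generate the same right ideal leave
their marks in the same cell, so they are equal if and only if each of them finds its own mark
there. -/
theorem tableCode_spec (hk : I.getD 0 0 = k)
    (hm : ∀ a b s, (m a b).eval I s = f (a.eval I s) (b.eval I s))
    (hassoc : ∀ a < k, ∀ b < k, ∀ c < k, f (f a b) c = f a (f b c)) (s : Store Register) :
    (tableCode m).Spec I s (3 + 8 * k + 13 * (k * k)) fun s' =>
      Holds out s' (TableCondition f k) := by
  refine Spec.mono (T := 1 + ((1 + k * (1 + (1 + (1 + k * 3)))) + (1 + k * (1 + (1 + ((1 + k * 3) +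
    ((1 + k * 3) + (1 + k * 4)))))))) ?_ (by nlinarith) fun _ _ h => h
  refine Spec.set_seq (Spec.seq (findRepresentatives_spec hk hm _) ?_)
  intro s₁ hs₁ hrep
  have hout := hs₁ out (by simp [writes, findRepresentatives])
  refine (Spec.forall_loop (p := True) k _ _ (by simp) (by exact hk)
    (by simp [Holds, hout, Store.set]) ?_).mono le_rfl fun s' _ h =>
      h.congr (iff_of_eq (true_and _))
  intro e' he' p₀ s₂ hs₂ h₂
  have hrep₂ := hs₂ rep (by simp [writes, require])
  refine Spec.guard (by omega) (by simp [hm, Store.set]) h₂ fun hidem => ?_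
  refine Spec.seq (Spec.forall_loop k 2 (fun x => f (f (f e' x) e') (f (f e' x) e') =
    f (f e' x) e') (by simp) (by exact hk) h₂ ?_) ?_
  · intro x hx p₁ s₃ hs₃ h₃
    have he := congrFun (hs₃ e (by simp [writes, require])) 0
    refine Spec.require ?_ h₃
    simp [Store.set, hm, he]
  intro s₃ hs₃ h₃
  have he₃ := congrFun (hs₃ e (by simp [writes, require])) 0
  have hrep₃ := hs₃ rep (by simp [writes, require])
  simp only [Store.set, true_and, if_true] at he₃
  replace hrep₃ : s₃ rep = s₂ rep := hrep₃
  refine Spec.seq (Spec.loop (fun n s' => ∀ x < n, Below f e' x → ∃ y < k, Below f e' y ∧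
    representative f k x = representative f k y ∧ s' mark (representative f k x) = y) k 2
    (by exact hk) (by simp) ?_) ?_
  · intro x hx s₄ hs₄ hinv
    have he₄ := congrFun (hs₄ e (by simp [writes])) 0
    have hrep₄ := hs₄ rep (by simp [writes])
    have hbelow := belowTerm_eq_zero hm (s₄.set p 0 x)
    simp only [Store.set, reduceCtorEq, false_and, if_false, true_and, if_true, he₄, he₃]
      at hbelow
    refine Spec.ite (T := 1) (fun h => Spec.skip ?_) fun h => Spec.set ?_
    · intro y hy hby
      rcases Nat.lt_succ_iff_lt_or_eq.1 hy with hy | rfl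
      · simpa [Store.set] using hinv y hy hby
      · exact absurd (hbelow.2 hby) h
    · intro y hy hby
      by_cases hyx : representative f k y = representative f k x
      · refine ⟨x, hx, hbelow.1 h, hyx, ?_⟩
        simp [Store.set, hrep₄, hrep₃, hrep₂, hrep x hx, hyx]
      · rcases Nat.lt_succ_iff_lt_or_eq.1 hy with hy | rfl
        · simpa [Store.set, hrep₄, hrep₃, hrep₂, hrep x hx, hyx] using hinv y hy hby
        · exact absurd rfl hyx
  intro s₄ hs₄ hmark
  have he₄ := congrFun (hs₄ e (by simp [writes])) 0
  have hrep₄ := hs₄ rep (by simp [writes])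
  have h₄ := h₃.of_eq (hs₄ out (by simp [writes]))
  refine (Spec.forall_loop k 3 (fun x => Below f e' x → s₄ mark (representative f k x) = x)
    (by simp) (by exact hk) h₄ ?_).mono le_rfl ?_
  · intro x hx p₁ s₅ hs₅ h₅
    have he₅ := congrFun (hs₅ e (by simp [writes, require])) 0
    have hrep₅ := hs₅ rep (by simp [writes, require])
    have hmark₅ := hs₅ mark (by simp [writes, require])
    refine Spec.guard (T := 2) (by omega) ?_ h₅ fun h => Spec.require ?_ h₅
    · rw [belowTerm_eq_zero hm]
      simp [Store.set, he₅, he₄, he₃]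
    · simp [Store.set, hmark₅, hrep₅, hrep₄, hrep₃, hrep₂, hrep x hx]
  · intro s' _ h
    refine h.congr ?_
    rw [and_assoc]
    refine and_congr_right fun _ => and_congr_right fun _ => ⟨fun h x hx hbx y hy hby h1 h2 => ?_,
      fun h x hx hbx => ?_⟩
    · rw [← h x hx hbx, ← h y hy hby,
        (representative_eq_iff hassoc hx hy hbx.1 hby.1).2 ⟨h1, h2⟩]
    · obtain ⟨y, hy, hby, hxy, hmk⟩ := hmark x hx hbx
      obtain ⟨h1, h2⟩ := (representative_eq_iff hassoc hx hy hbx.1 hby.1).1 hxy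
      rw [hmk, h x hx hbx y hy hby h1 h2]

end TableProgram

end RAM

/-- An entry of a list that is composed of blocks of the same length. -/
lemma List.getD_flatMap_of_length {α : Type} {g : α → List ℕ} {n : ℕ} : ∀ {l : List α},
    (∀ x ∈ l, (g x).length = n) → ∀ (a : ℕ) (ha : a < l.length) (b : ℕ), b < n →
      (l.flatMap g).getD (a * n + b) 0 = (g l[a]).getD b 0
  | [], _, a, ha, _, _ => absurd ha (Nat.not_lt_zero a)
  | x :: l, h, a, ha, b, hb => by
    have hx : (g x).length = n := h x List.mem_cons_self
    rw [List.flatMap_cons]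
    cases a with
    | zero =>
      rw [zero_mul, zero_add, List.getD_append _ _ _ _ (by omega)]
      rfl
    | succ a =>
      have e1 : (a + 1) * n + b = a * n + b + n := by ring
      rw [List.getD_append_right _ _ _ _ (by rw [e1]; omega), hx, e1, Nat.add_sub_cancel]
      exact List.getD_flatMap_of_length (fun y hy => h y (List.mem_cons_of_mem _ hy)) a
        (by simpa using ha) b hb

namespace LocalTestability

/-! ### Multiplication tables of finite semigroups -/

variable {S : Type} [Semigroup S]

/-- In a locally left regular semigroup, the local submonoids are bands whose Green relation `R` is
trivial, and conversely. -/
theorem locallyLeftRegular_iff_idempotents : LocallyLeftRegular S ↔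
    ∀ e : S, e * e = e → (∀ x, e * x * e * (e * x * e) = e * x * e) ∧
      ∀ x, (x * x = x ∧ e * x = x ∧ x * e = x) → ∀ y, (y * y = y ∧ e * y = y ∧ y * e = y) →
        x * y = y → y * x = x → x = y := by
  constructor
  · intro h e he
    refine ⟨fun x => ?_, ?_⟩
    · have := h e he x e
      have hee : e * e * e = e := by rw [he, he]
      have h1 : e * x * e * e = e * x * e := by rw [mul_assoc (e * x), he]
      rwa [hee, h1] at this
    · rintro x ⟨-, hx1, hx2⟩ y ⟨-, hy1, hy2⟩ hxy hyx
      have := h e he x y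
      rw [hx1, hx2, hy1, hy2, hxy, hyx] at this
      exact this
  · intro h e he s t
    obtain ⟨hband, huniq⟩ := h e he
    set a := e * s * e with ha
    set b := e * t * e with hb
    have hea : e * a = a := by rw [ha, ← mul_assoc, ← mul_assoc, he]
    have hae : a * e = a := by rw [ha, mul_assoc, he]
    have heb : e * b = b := by rw [hb, ← mul_assoc, ← mul_assoc, he]
    have hbe : b * e = b := by rw [hb, mul_assoc, he]
    have haa : a * a = a := hband s
    have hidem : ∀ c, e * c = c → c * e = c → c * c = c := fun c h1 h2 => by
      have := hband c
      rwa [h1, h2] at this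
    have h1 : e * (a * b) = a * b := by rw [← mul_assoc, hea]
    have h2 : a * b * e = a * b := by rw [mul_assoc, hbe]
    have h3 : e * (a * b * a) = a * b * a := by rw [← mul_assoc, h1]
    have h4 : a * b * a * e = a * b * a := by rw [mul_assoc, hae]
    have h5 := hidem _ h1 h2
    refine huniq _ ⟨hidem _ h3 h4, h3, h4⟩ _ ⟨h5, h1, h2⟩ ?_ ?_
    · rw [mul_assoc (a * b), ← mul_assoc a a b, haa, h5]
    · rw [← mul_assoc, h5]

/-- The condition that is tested on the numbers below `k` is the identity `xyx = xy` in the local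
monoids. -/
lemma tableCondition_iff {k : ℕ} (ν : Fin k ≃ S) {f : ℕ → ℕ → ℕ}
    (hf : ∀ a b : Fin k, f a b = (ν.symm (ν a * ν b) : Fin k)) :
    RAM.TableCondition f k ↔ LocallyLeftRegular S := by
  have hf' : ∀ x y : S, f (ν.symm x) (ν.symm y) = ((ν.symm (x * y) : Fin k) : ℕ) := by
    intro x y
    rw [hf, ν.apply_symm_apply, ν.apply_symm_apply]
  have hall : ∀ P : ℕ → Prop, (∀ a < k, P a) ↔ ∀ x : S, P (ν.symm x) := by
    intro P
    refine ⟨fun h x => h _ (ν.symm x).2, fun h a ha => ?_⟩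
    have := h (ν ⟨a, ha⟩)
    rwa [ν.symm_apply_apply] at this
  have hinj : ∀ x y : S, ((ν.symm x : Fin k) : ℕ) = ν.symm y ↔ x = y := by
    intro x y
    rw [Fin.val_inj, ν.symm.injective.eq_iff]
  rw [locallyLeftRegular_iff_idempotents]
  simp only [RAM.TableCondition, RAM.Below, hall, hf', hinj]

lemma table_assoc {k : ℕ} (ν : Fin k ≃ S) {f : ℕ → ℕ → ℕ}
    (hf : ∀ a b : Fin k, f a b = (ν.symm (ν a * ν b) : Fin k)) :
    ∀ a < k, ∀ b < k, ∀ c < k, f (f a b) c = f a (f b c) := by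
  intro a ha b hb c hc
  rw [hf ⟨a, ha⟩ ⟨b, hb⟩, hf ⟨b, hb⟩ ⟨c, hc⟩, hf _ ⟨c, hc⟩, hf ⟨a, ha⟩ _]
  simp [mul_assoc]

lemma getD_encodeSemigroup {k : ℕ} (ν : Fin k ≃ S) (a b : Fin k) :
    (encodeSemigroup ν).getD (1 + a * k + b) 0 = (ν.symm (ν a * ν b) : Fin k) := by
  rw [encodeSemigroup, show 1 + (a : ℕ) * k + b = (a * k + b) + 1 by ring, List.getD_cons_succ,
    List.getD_flatMap_of_length (n := k) (by simp) a (by simp) b b.2]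
  simp [List.getD_eq_getElem?_getD]

lemma length_encodeSemigroup {k : ℕ} (ν : Fin k ≃ S) :
    (encodeSemigroup ν).length = 1 + k * k := by
  simp [encodeSemigroup, List.length_flatMap, add_comm]

end LocalTestability

namespace RAM

open LocalTestability

/-- The number of the cells of an input that describes a finite semigroup. -/
def tableBase : Expression := .add (.const 1) (.mul (.cell (.const 0)) (.cell (.const 0)))

variable {S : Type} [Semigroup S]

lemma isBase_tableBase {k : ℕ} (ν : Fin k ≃ S) : IsBase tableBase (encodeSemigroup ν) := by
  intro m hm
  have h0 : m 0 = k := hm 0 (by simp [encodeSemigroup])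
  simp [tableBase, Expression.eval, h0, length_encodeSemigroup]

/-- The product of two elements, in the multiplication table of the input. -/
def product (a b : Term Register) : Term Register := .input (1 + a * .input 0 + b)

theorem answers_rightLocallyTestable : ∃ (P : Program) (C : ℕ), ∀ (S : Type) [Semigroup S] (k : ℕ)
    (ν : Fin k ≃ S), 0 < k →
      Answers P (encodeSemigroup ν) (RightLocallyTestable S) (C * k ^ 2) := by
  refine ⟨(tableCode product).program tableBase .out,
    ((tableCode product).weight tableBase + tableBase.cost + 20) * 25, ?_⟩
  intro S _ k ν hk
  have : Finite S := Finite.of_equiv _ ν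
  have hI : (encodeSemigroup ν).getD 0 0 = k := rfl
  obtain ⟨f, hf₀⟩ : ∃ f : ℕ → ℕ → ℕ, ∀ a b, (encodeSemigroup ν).getD (1 + a * k + b) 0 = f a b :=
    ⟨_, fun _ _ => rfl⟩
  have hf : ∀ a b : Fin k, f a b = (ν.symm (ν a * ν b) : Fin k) := fun a b =>
    (hf₀ a b).symm.trans (getD_encodeSemigroup ν a b)
  have hspec := tableCode_spec (m := product) (f := f) hI
    (fun a b s => by simp only [product, Term.eval_input, Term.eval_add, Term.eval_mul,
      Term.eval_ofNat, hI, hf₀]) (table_assoc ν hf) fun _ _ => 0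
  have := Code.answers (isBase_tableBase ν) _ _ (RightLocallyTestable S) _
    (hspec.mono le_rfl fun s _ h => h.congr
      ((tableCondition_iff ν hf).trans (rightLocallyTestable_iff S).symm))
  refine this.mono ?_
  rw [mul_assoc]
  exact Nat.mul_le_mul_left _ (by nlinarith)

theorem answers_leftLocallyTestable : ∃ (P : Program) (C : ℕ), ∀ (S : Type) [Semigroup S] (k : ℕ)
    (ν : Fin k ≃ S), 0 < k →
      Answers P (encodeSemigroup ν) (LeftLocallyTestable S) (C * k ^ 2) := by
  refine ⟨(tableCode fun a b => product b a).program tableBase .out,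
    ((tableCode fun a b => product b a).weight tableBase + tableBase.cost + 20) * 25, ?_⟩
  intro S _ k ν hk
  have : Finite S := Finite.of_equiv _ ν
  have hI : (encodeSemigroup ν).getD 0 0 = k := rfl
  have : Finite Sᵐᵒᵖ := Finite.of_equiv _ MulOpposite.opEquiv
  -- The opposite semigroup has the transposed multiplication table.
  set ν' : Fin k ≃ Sᵐᵒᵖ := ν.trans MulOpposite.opEquiv with hν'
  obtain ⟨f, hf₀⟩ : ∃ f : ℕ → ℕ → ℕ, ∀ a b, (encodeSemigroup ν).getD (1 + b * k + a) 0 = f a b :=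
    ⟨_, fun _ _ => rfl⟩
  have hf : ∀ a b : Fin k, f a b = (ν'.symm (ν' a * ν' b) : Fin k) := fun a b =>
    (hf₀ a b).symm.trans (getD_encodeSemigroup ν b a)
  have hspec := tableCode_spec (m := fun a b => product b a) (f := f) hI
    (fun a b s => by simp only [product, Term.eval_input, Term.eval_add, Term.eval_mul,
      Term.eval_ofNat, hI, hf₀]) (table_assoc ν' hf)
    fun _ _ => 0
  have := Code.answers (isBase_tableBase ν) _ _ (LeftLocallyTestable S) _
    (hspec.mono le_rfl fun s _ h => h.congr ((tableCondition_iff ν' hf).trans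
      ((rightLocallyTestable_iff Sᵐᵒᵖ).symm.trans leftLocallyTestable_iff_op.symm)))
  refine this.mono ?_
  rw [mul_assoc]
  exact Nat.mul_le_mul_left _ (by nlinarith)

end RAM

namespace LocalTestability.TransitionGraph

variable {G : TransitionGraph}

/-! ### Paths in the powers of a transition graph -/

/-- The number that stands for a node, or for the dead state. -/
def code (a : Option (Fin G.nodes)) : ℕ := a.elim 0 fun p => p + 1

@[simp] lemma code_none : code (none : Option (Fin G.nodes)) = 0 := rfl

@[simp] lemma code_some (p : Fin G.nodes) : code (some p) = p + 1 := rfl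

lemma code_lt (a : Option (Fin G.nodes)) : code a < G.nodes + 1 := by
  cases a with
  | none => exact Nat.succ_pos _
  | some p => exact Nat.succ_lt_succ p.2

lemma exists_code_eq {b : ℕ} (hb : b < G.nodes + 1) : ∃ a : Option (Fin G.nodes), code a = b := by
  cases b with
  | zero => exact ⟨none, rfl⟩
  | succ b => exact ⟨some ⟨b, by omega⟩, rfl⟩

lemma code_injective : Function.Injective (code (G := G)) := by
  rintro (_ | p) (_ | q) h
  · rfl
  · simp at h
  · simp at h
  · simpa [Fin.ext_iff] using h

/-- A step to a live state in a system on which the letters act. -/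
def Step {X : Type} (act : X → Fin G.alphabet → X) (alive : X → Prop) (x y : X) : Prop :=
  ∃ σ, y = act x σ ∧ alive y

/-- Connections by steps to live states are given by nonempty words; all states on the way are live,
since dead states stay dead. -/
lemma transGen_step_iff {X : Type} {act : X → Fin G.alphabet → X} {alive : X → Prop}
    (hdead : ∀ x σ, alive (act x σ) → alive x) (x y : X) :
    Relation.TransGen (Step act alive) x y ↔
      ∃ w : List (Fin G.alphabet), w ≠ [] ∧ w.foldl act x = y ∧ alive y := by
  constructor
  · intro h
    induction h with
    | single h =>
      obtain ⟨σ, rfl, h⟩ := h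
      exact ⟨[σ], by simp, rfl, h⟩
    | tail _ h ih =>
      obtain ⟨σ, rfl, h⟩ := h
      obtain ⟨w, hw, rfl, _⟩ := ih
      exact ⟨w ++ [σ], by simp, by simp, h⟩
  · rintro ⟨w, hw, rfl, h⟩
    induction w using List.reverseRecOn with
    | nil => exact absurd rfl hw
    | append_singleton w σ ih =>
      rw [List.foldl_append] at h ⊢
      rcases eq_or_ne w [] with rfl | hne
      · exact .single ⟨σ, rfl, h⟩
      · exact .tail (ih hne (hdead _ _ h)) ⟨σ, rfl, h⟩

/-- A graph on numbers that is a copy of a relation has the corresponding connections. -/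
lemma transGen_copy_iff {X : Type} {f : X → ℕ} (hf : Function.Injective f) {r : X → X → Prop}
    {r' : ℕ → ℕ → Prop} (h : ∀ a b, r' a b ↔ ∃ x y, f x = a ∧ f y = b ∧ r x y) (x y : X) :
    Relation.TransGen r' (f x) (f y) ↔ Relation.TransGen r x y := by
  constructor
  · intro hxy
    have key : ∀ b, Relation.TransGen r' (f x) b → ∃ y, f y = b ∧ Relation.TransGen r x y := by
      intro b hb
      induction hb with
      | single hb =>
        obtain ⟨x', y, hx, hy, hr⟩ := (h _ _).1 hb
        obtain rfl := hf hx
        exact ⟨y, hy, .single hr⟩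
      | tail _ hb ih =>
        obtain ⟨z, rfl, hz⟩ := ih
        obtain ⟨x', y, hx, hy, hr⟩ := (h _ _).1 hb
        obtain rfl := hf hx
        exact ⟨y, hy, .tail hz hr⟩
    obtain ⟨y', hy, hr⟩ := key _ hxy
    rwa [← hf hy]
  · exact fun hxy => hxy.lift f fun a b hab => (h _ _).2 ⟨a, b, rfl, rfl, hab⟩

/-- The action on pairs of states. -/
def next₂ (x : Option (Fin G.nodes) × Option (Fin G.nodes)) (σ : Fin G.alphabet) :
    Option (Fin G.nodes) × Option (Fin G.nodes) := (G.next x.1 σ, G.next x.2 σ)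

/-- The action on triples of states. -/
def next₃ (x : Option (Fin G.nodes) × Option (Fin G.nodes) × Option (Fin G.nodes))
    (σ : Fin G.alphabet) : Option (Fin G.nodes) × Option (Fin G.nodes) × Option (Fin G.nodes) :=
  (G.next x.1 σ, G.next x.2.1 σ, G.next x.2.2 σ)

lemma foldl_next₂ (w : List (Fin G.alphabet)) (a b : Option (Fin G.nodes)) :
    w.foldl next₂ (a, b) = (G.read a w, G.read b w) := by
  induction w generalizing a b with
  | nil => rfl
  | cons σ w ih => exact ih _ _

lemma foldl_next₃ (w : List (Fin G.alphabet)) (a b c : Option (Fin G.nodes)) :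
    w.foldl next₃ (a, b, c) = (G.read a w, G.read b w, G.read c w) := by
  induction w generalizing a b c with
  | nil => rfl
  | cons σ w ih => exact ih _ _ _

lemma exists_of_next_eq_some {a : Option (Fin G.nodes)} {σ : Fin G.alphabet} {q : Fin G.nodes}
    (h : G.next a σ = some q) : ∃ p, a = some p ∧ G.step p σ = some q :=
  Option.bind_eq_some_iff.1 h

lemma isSome_of_next {a : Option (Fin G.nodes)} {σ : Fin G.alphabet}
    (h : (G.next a σ).isSome) : a.isSome := by
  cases a with
  | none => exact h
  | some p => rfl

/-- The steps between pairs of states with a live first component. -/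
abbrev Step₂ (G : TransitionGraph) := Step (G := G) next₂ fun x => x.1.isSome

/-- The steps between triples of states with a live first component. -/
abbrev Step₃ (G : TransitionGraph) := Step (G := G) next₃ fun x => x.1.isSome

lemma transGen_step₂_iff (a b b' : Option (Fin G.nodes)) (p : Fin G.nodes) :
    Relation.TransGen G.Step₂ (a, b) (some p, b') ↔
      ∃ w : List (Fin G.alphabet), w ≠ [] ∧ G.read a w = some p ∧ G.read b w = b' := by
  rw [transGen_step_iff fun x σ => isSome_of_next]
  simp [foldl_next₂]

lemma transGen_step₃_iff (a b c b' c' : Option (Fin G.nodes)) (p : Fin G.nodes) :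
    Relation.TransGen G.Step₃ (a, b, c) (some p, b', c') ↔
      ∃ w : List (Fin G.alphabet), w ≠ [] ∧ G.read a w = some p ∧ G.read b w = b' ∧
        G.read c w = c' := by
  rw [transGen_step_iff fun x σ => isSome_of_next]
  simp [foldl_next₃]

/-! ### The description of a transition graph -/

section Encoding

variable {L : List (Fin G.nodes × Fin G.alphabet × Fin G.nodes)}

lemma length_encode (G : TransitionGraph)
    (L : List (Fin G.nodes × Fin G.alphabet × Fin G.nodes)) :
    (G.encode L).length = 2 + 3 * L.length := by
  simp [encode, List.length_flatMap]
  omega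

lemma getD_encode {l : ℕ} (hl : l < L.length) :
    (G.encode L).getD (2 + 3 * l) 0 = L[l].1 ∧ (G.encode L).getD (3 + 3 * l) 0 = L[l].2.1 ∧
      (G.encode L).getD (4 + 3 * l) 0 = L[l].2.2 := by
  have h : ∀ b < 3, (G.encode L).getD (2 + 3 * l + b) 0
      = ([(L[l].1 : ℕ), (L[l].2.1 : ℕ), (L[l].2.2 : ℕ)] : List ℕ).getD b 0 := by
    intro b hb
    rw [encode, show 2 + 3 * l + b = l * 3 + b + 1 + 1 by ring, List.getD_cons_succ,
      List.getD_cons_succ, List.getD_flatMap_of_length (n := 3) (by simp) l hl b hb]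
  refine ⟨h 0 (by omega), ?_, ?_⟩
  · have := h 1 (by omega)
    rwa [show 2 + 3 * l + 1 = 3 + 3 * l by ring] at this
  · have := h 2 (by omega)
    rwa [show 2 + 3 * l + 2 = 4 + 3 * l by ring] at this

lemma step_of_isEdgeList (hL : G.IsEdgeList L) {l : ℕ} (hl : l < L.length) :
    G.step L[l].1 L[l].2.1 = some L[l].2.2 := (hL.2 _ _ _).1 (List.getElem_mem hl)

lemma exists_edge_of_step (hL : G.IsEdgeList L) {p q : Fin G.nodes} {σ : Fin G.alphabet}
    (h : G.step p σ = some q) : ∃ l, ∃ hl : l < L.length, L[l] = (p, σ, q) :=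
  List.getElem_of_mem ((hL.2 _ _ _).2 h)

end Encoding

end LocalTestability.TransitionGraph

namespace RAM

open Register Code LocalTestability LocalTestability.TransitionGraph

/-- The number of the cells of an input that describes a transition graph. -/
def graphBase : Expression := .add (.const 2) (.mul (.const 3) (.cell (.const 1)))

/-- The number of the states, including the dead state. -/
def states : Term Register := .input 0 + 1

/-- The state before the transition along an edge of the input. -/
def edgeSource (a : Term Register) : Term Register := .input (2 + 3 * a) + 1

/-- The label of an edge of the input. -/
def edgeLabel (a : Term Register) : Term Register := .input (3 + 3 * a)

/-- The state after the transition along an edge of the input. -/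
def edgeTarget (a : Term Register) : Term Register := .input (4 + 3 * a) + 1

/-- The state after the transition from the state `b` by the letter `a`. -/
def nextState (a b : Term Register) : Term Register := table.get (a * states + b)

/-- Writes the transition table. -/
def buildTable : Code Register :=
  .loop i (.input 1) <|
    .set table (edgeLabel i.val * states + edgeSource i.val) (edgeTarget i.val)

/-- The array `table` holds the transition table. -/
def HasTable (G : TransitionGraph) (s : Store Register) : Prop :=
  ∀ (a : Option (Fin G.nodes)) (σ : Fin G.alphabet),
    s table (σ * (G.nodes + 1) + code a) = code (G.next a σ)

section Input

variable {G : TransitionGraph} {L : List (Fin G.nodes × Fin G.alphabet × Fin G.nodes)}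

lemma isBase_graphBase : IsBase graphBase (G.encode L) := by
  intro m hm
  have h0 : m 1 = L.length := hm 1 (by rw [length_encode]; omega)
  simp [graphBase, Expression.eval, h0, length_encode]

@[simp] lemma eval_states (s : Store Register) : states.eval (G.encode L) s = G.nodes + 1 := rfl

@[simp] lemma eval_edges (s : Store Register) :
    (Term.input 1 : Term Register).eval (G.encode L) s = L.length := rfl

lemma eval_edgeSource (s : Store Register) {a : Term Register} {l : ℕ} (hl : l < L.length)
    (ha : a.eval (G.encode L) s = l) :
    (edgeSource a).eval (G.encode L) s = code (some L[l].1) := by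
  simp only [edgeSource, Term.eval_add, Term.eval_input, Term.eval_mul, Term.eval_ofNat, ha,
    (getD_encode hl).1, code_some]

lemma eval_edgeLabel (s : Store Register) {a : Term Register} {l : ℕ} (hl : l < L.length)
    (ha : a.eval (G.encode L) s = l) : (edgeLabel a).eval (G.encode L) s = L[l].2.1 := by
  simp only [edgeLabel, Term.eval_add, Term.eval_input, Term.eval_mul, Term.eval_ofNat, ha,
    (getD_encode hl).2.1]

lemma eval_edgeTarget (s : Store Register) {a : Term Register} {l : ℕ} (hl : l < L.length)
    (ha : a.eval (G.encode L) s = l) :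
    (edgeTarget a).eval (G.encode L) s = code (some L[l].2.2) := by
  simp only [edgeTarget, Term.eval_add, Term.eval_input, Term.eval_mul, Term.eval_ofNat, ha,
    (getD_encode hl).2.2, code_some]

lemma address_inj {n a b a' b' : ℕ} (hb : b < n) (hb' : b' < n) (h : a * n + b = a' * n + b') :
    a = a' ∧ b = b' := by
  have h1 := congrArg (· / n) h
  have h2 := congrArg (· % n) h
  have hn : 0 < n := Nat.zero_lt_of_lt hb
  simp only [Nat.mul_add_mod', Nat.mod_eq_of_lt hb, Nat.mod_eq_of_lt hb'] at h2
  simp only [Nat.add_comm _ b, Nat.add_comm _ b', Nat.add_mul_div_right _ _ hn,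
    Nat.div_eq_of_lt hb, Nat.div_eq_of_lt hb', zero_add] at h1
  exact ⟨h1, h2⟩

/-- The transition table is written in linear time. The cells of missing transitions keep their
initial value `0`, the number of the dead state. -/
lemma buildTable_spec (hL : G.IsEdgeList L) (s : Store Register) (hs : ∀ u, s table u = 0) :
    buildTable.Spec (G.encode L) s (1 + L.length * 2) (HasTable G) := by
  refine (Spec.loop (fun n s' => (∀ (l : ℕ) (hl : l < L.length), l < n →
      s' table (L[l].2.1 * (G.nodes + 1) + code (some L[l].1)) = code (some L[l].2.2)) ∧
    ∀ u, (∀ (l : ℕ) (hl : l < L.length), l < n →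
      u ≠ L[l].2.1 * (G.nodes + 1) + code (some L[l].1)) → s' table u = 0) L.length 1
    (eval_edges s) (by simp [hs]) ?_).mono le_rfl ?_
  · intro n hn s' _ ⟨h1, h2⟩
    refine Spec.set ?_
    have hi : i.val.eval (G.encode L) (s'.set i 0 n) = n := by simp [Store.set]
    rw [Term.eval_add, Term.eval_mul, eval_edgeLabel _ hn hi, eval_edgeSource _ hn hi,
      eval_edgeTarget _ hn hi, eval_states]
    constructor
    · intro l hl hln
      by_cases hne : L[l].2.1 * (G.nodes + 1) + code (some L[l].1)
          = L[n].2.1 * (G.nodes + 1) + code (some L[n].1)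
      · obtain ⟨e1, e2⟩ := address_inj (code_lt _) (code_lt _) hne
        have e3 := code_injective e2
        have e4 := step_of_isEdgeList hL hl
        rw [Fin.ext e1, Option.some_injective _ e3, step_of_isEdgeList hL hn] at e4
        simp only [Store.set, hne, e4, and_self, if_true]
      · have : l ≠ n := by rintro rfl; exact hne rfl
        simpa [Store.set, hne, -code_some] using h1 l hl (by omega)
    · intro u hu
      have := hu n hn (by omega)
      simpa [Store.set, this, -code_some] using h2 u fun l hl hln => hu l hl (by omega)
  · rintro s' - ⟨h1, h2⟩ a σ
    cases ha : G.next a σ with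
    | none =>
      refine h2 _ fun l hl _ hne => ?_
      obtain ⟨e1, e2⟩ := address_inj (code_lt _) (code_lt _) hne
      rw [code_injective e2, Fin.ext e1] at ha
      have := step_of_isEdgeList hL hl
      simp [next, this] at ha
    | some q =>
      obtain ⟨p, rfl, hstep⟩ := exists_of_next_eq_some ha
      obtain ⟨l, hl, hLl⟩ := exists_edge_of_step hL hstep
      have := h1 l hl hl
      rwa [hLl] at this

end Input

end RAM

namespace LocalTestability.TransitionGraph

/-! ### Numbers of triples of states -/

variable {G : TransitionGraph}

/-- The number of a triple of states. -/
def code₃ (x : Option (Fin G.nodes) × Option (Fin G.nodes) × Option (Fin G.nodes)) : ℕ :=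
  (code x.1 * (G.nodes + 1) + code x.2.1) * (G.nodes + 1) + code x.2.2

lemma code₃_lt (x : Option (Fin G.nodes) × Option (Fin G.nodes) × Option (Fin G.nodes)) :
    code₃ x < (G.nodes + 1) * (G.nodes + 1) * (G.nodes + 1) := by
  have h1 := code_lt x.1
  have h2 := code_lt x.2.1
  have h3 := code_lt x.2.2
  rw [code₃]
  generalize G.nodes + 1 = W at *
  nlinarith [Nat.mul_le_mul_right W h1, Nat.mul_le_mul_right W h2,
    Nat.mul_le_mul_right (W * W) h1]

lemma code₃_injective : Function.Injective (code₃ (G := G)) := by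
  rintro ⟨a, b, c⟩ ⟨a', b', c'⟩ h
  obtain ⟨h1, h2⟩ := RAM.address_inj (code_lt _) (code_lt _) h
  obtain ⟨h3, h4⟩ := RAM.address_inj (code_lt _) (code_lt _) h1
  exact Prod.ext (code_injective h3) (Prod.ext (code_injective h4) (code_injective h2))

/-- A loop at three states, as a path in the third power of the graph. -/
lemma loop_iff_transGen (p : Fin G.nodes) (b c : Option (Fin G.nodes)) :
    G.Loop (some p) b c ↔ Relation.TransGen G.Step₃ (some p, b, c) (some p, b, c) := by
  rw [transGen_step₃_iff, Loop]

/-- In the presence of a loop, paths between pairs can be taken nonempty. A pair of states is a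
triple with a dead third component. -/
lemma pairPath_iff_transGen {a b y : Option (Fin G.nodes)}
    (q : Fin G.nodes) {v : List (Fin G.alphabet)} (hv : v ≠ []) (ha : G.read a v = a)
    (hb : G.read b v = b) : G.PairPath a b (some q) y ↔
      Relation.TransGen G.Step₃ (a, b, none) (some q, y, none) := by
  rw [transGen_step₃_iff]
  constructor
  · rintro ⟨w, h1, h2⟩
    exact ⟨v ++ w, by simp [hv], by simp [ha, h1], by simp [hb, h2], by simp⟩
  · rintro ⟨w, _, h1, h2, _⟩
    exact ⟨w, h1, h2⟩

end LocalTestability.TransitionGraph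

namespace RAM

open Register Code LocalTestability LocalTestability.TransitionGraph

/-! ### The algorithms that use triples of states -/

lemma eval_connected {I : List ℕ} (s : Store Register) (u v : Term Register) :
    (connected u v).eval I s = s fwd 0 / s powX (u.eval I s) % s baseX 0 /
      s powZ (v.eval I s) % s baseZ 0 := by
  simp [connected]

/-- The number of the edge of the input from which an edge of the graph of triples is built. -/
def tripleEdge : Term Register := i.val / (states * states)

/-- The number of a triple of states. -/
def triple (a b c : Term Register) : Term Register := (a * states + b) * states + c

/-- Builds the graph of the steps between triples of states. -/
def buildTriples : Code Register :=
  .seq (.set size 0 (states * states * states)) <|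
  .seq (.set count 0 (.input 1 * (states * states))) <|
  .loop i (.input 1 * (states * states)) <|
    .seq (.set source i.val
      (triple (edgeSource tripleEdge) (i.val / states % states) (i.val % states)))
    (.set target i.val (triple (edgeTarget tripleEdge)
      (nextState (edgeLabel tripleEdge) (i.val / states % states))
      (nextState (edgeLabel tripleEdge) (i.val % states))))

section Triples

variable {G : TransitionGraph} {L : List (Fin G.nodes × Fin G.alphabet × Fin G.nodes)}

lemma buildTriples_spec (s : Store Register) (hs : HasTable G s) :
    buildTriples.Spec (G.encode L) s
      (3 + L.length * ((G.nodes + 1) * (G.nodes + 1)) * 3) fun s' =>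
      s' size 0 = (G.nodes + 1) * (G.nodes + 1) * (G.nodes + 1) ∧
      s' count 0 = L.length * ((G.nodes + 1) * (G.nodes + 1)) ∧
      ∀ l, ∀ hl : l < L.length, ∀ b c : Option (Fin G.nodes), ∀ u,
        u = l * ((G.nodes + 1) * (G.nodes + 1)) + (code b * (G.nodes + 1) + code c) →
        s' source u = code₃ (some L[l].1, b, c) ∧
        s' target u = code₃ (some L[l].2.2, G.next b L[l].2.1, G.next c L[l].2.1) := by
  obtain ⟨W, hW⟩ : ∃ W, G.nodes + 1 = W := ⟨_, rfl⟩
  have hW0 : 0 < W := by omega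
  refine Spec.mono (T := 1 + (1 + (1 + L.length * ((G.nodes + 1) * (G.nodes + 1)) * (1 + 2))))
    ?_ (by omega) fun _ _ h => h
  refine Spec.set_seq (Spec.set_seq ((Spec.loop (fun n s' => ∀ l, ∀ hl : l < L.length,
    ∀ b c : Option (Fin G.nodes), ∀ u,
        u = l * ((G.nodes + 1) * (G.nodes + 1)) + (code b * (G.nodes + 1) + code c) → u < n →
        s' source u = code₃ (some L[l].1, b, c) ∧
        s' target u = code₃ (some L[l].2.2, G.next b L[l].2.1, G.next c L[l].2.1))
    (L.length * ((G.nodes + 1) * (G.nodes + 1))) 2 (by simp) (by simp) ?_).mono le_rfl ?_))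
  · intro n hn s' hs' hinv
    have htab : s' table = s table := by
      rw [hs' table (by simp [writes])]
      rfl
    refine Spec.set_seq (Spec.set ?_)
    intro l hl b c u hu hun
    rcases Nat.lt_succ_iff_lt_or_eq.1 hun with hlt | heq
    · simpa [Store.set, hlt.ne] using hinv l hl b c u hu hlt
    · subst heq
      have hb := code_lt b
      have hc := code_lt c
      have e1 : u / ((G.nodes + 1) * (G.nodes + 1)) = l := by
        rw [hu, Nat.mul_comm l, Nat.mul_add_div (by positivity), Nat.div_eq_of_lt, add_zero]
        nlinarith
      have e2 : u / (G.nodes + 1) % (G.nodes + 1) = code b := by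
        rw [hu, ← mul_assoc, ← add_assoc, ← add_mul, Nat.mul_comm _ (G.nodes + 1),
          Nat.mul_add_div (by omega), Nat.div_eq_of_lt hc, add_zero, Nat.mul_comm l,
          Nat.mul_add_mod, Nat.mod_eq_of_lt hb]
      have e3 : u % (G.nodes + 1) = code c := by
        rw [hu, ← mul_assoc, ← add_assoc, ← add_mul, Nat.mul_comm _ (G.nodes + 1),
          Nat.mul_add_mod, Nat.mod_eq_of_lt hc]
      have hte : ∀ s'' : Store Register, s'' i 0 = u →
          (edgeSource tripleEdge).eval (G.encode L) s'' = code (some L[l].1) ∧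
          (edgeLabel tripleEdge).eval (G.encode L) s'' = L[l].2.1 ∧
          (edgeTarget tripleEdge).eval (G.encode L) s'' = code (some L[l].2.2) := by
        intro s'' h
        have : tripleEdge.eval (G.encode L) s'' = l := by simp [tripleEdge, h, e1]
        exact ⟨eval_edgeSource _ hl this, eval_edgeLabel _ hl this, eval_edgeTarget _ hl this⟩
      constructor
      · simp [Store.set, triple, e2, e3, hte, code₃]
      · simp [Store.set, triple, nextState, e2, e3, hte, code₃, htab, hs b, hs c]
  · intro s' hs' h
    refine ⟨?_, ?_, fun l hl b c u hu => h l hl b c u hu ?_⟩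
    · rw [hs' size (by simp [writes])]
      simp [Store.set]
    · rw [hs' count (by simp [writes])]
      simp [Store.set]
    · have hb := code_lt b
      have hc := code_lt c
      rw [hu]
      nlinarith [Nat.mul_le_mul_right ((G.nodes + 1) * (G.nodes + 1)) hl]

/-- Computes the connections between triples of states. -/
def connectTriples : Code Register := .seq buildTable <| .seq buildTriples closure

/-- The graph of triples has cubic size, and its transitive closure is computed in linear time. -/
lemma connectTriples_spec (hL : G.IsEdgeList L) (s : Store Register) (hs : ∀ u, s table u = 0) :
    connectTriples.Spec (G.encode L) s (40000 * (G.nodes + L.length + 1) ^ 3) fun s' =>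
      ∀ x y, s' fwd 0 / s' powX (code₃ x) % s' baseX 0 / s' powZ (code₃ y) % s' baseZ 0 ≠ 0 ↔
        Relation.TransGen G.Step₃ x y := by
  obtain ⟨W, hW⟩ : ∃ W, G.nodes + 1 = W := ⟨_, rfl⟩
  refine Spec.mono (T := (1 + L.length * 2) + ((3 + L.length * (W * W) * 3) +
    1000 * (W * W * W + L.length * (W * W) + 1))) ?_ ?_ fun _ _ h => h
  · refine Spec.seq (buildTable_spec hL s hs) fun s₁ hs₁ h₁ => ?_
    subst hW
    refine Spec.seq (buildTriples_spec s₁ h₁) fun s₂ hs₂ ⟨h2, h3, h4⟩ => ?_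
    have hcode : ∀ l < s₂ count 0, ∃ l', ∃ hl : l' < L.length, ∃ b c : Option (Fin G.nodes),
        l = l' * ((G.nodes + 1) * (G.nodes + 1)) + (code b * (G.nodes + 1) + code c) := by
      intro l hl
      rw [h3] at hl
      have hW := Nat.succ_pos G.nodes
      obtain ⟨b, hb⟩ := exists_code_eq (Nat.mod_lt (l / (G.nodes + 1)) hW)
      obtain ⟨c, hc⟩ := exists_code_eq (Nat.mod_lt l hW)
      refine ⟨l / ((G.nodes + 1) * (G.nodes + 1)), ?_, b, c, ?_⟩
      · exact Nat.div_lt_of_lt_mul (by rwa [mul_comm])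
      · rw [hb, hc, ← Nat.div_div_eq_div_mul]
        have e1 := Nat.div_add_mod' l (G.nodes + 1)
        have e2 := Nat.div_add_mod' (l / (G.nodes + 1)) (G.nodes + 1)
        calc l = (l / (G.nodes + 1) / (G.nodes + 1) * (G.nodes + 1) +
              l / (G.nodes + 1) % (G.nodes + 1)) * (G.nodes + 1) + l % (G.nodes + 1) := by
              rw [e2, e1]
          _ = _ := by ring
    refine (closure_spec s₂ ?_).mono (by rw [h2, h3]) ?_
    · intro l hl
      obtain ⟨l', hl', b, c, hu⟩ := hcode l hl
      obtain ⟨e1, e2⟩ := h4 l' hl' b c l hu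
      rw [e1, e2, h2]
      exact ⟨code₃_lt _, code₃_lt _⟩
    · intro s' _ h x y
      rw [h2] at h
      rw [h _ (code₃_lt x) _ (code₃_lt y), transGen_copy_iff code₃_injective]
      intro u v
      constructor
      · rintro ⟨l, hl, rfl, rfl⟩
        obtain ⟨l', hl', b, c, hu⟩ := hcode l hl
        obtain ⟨e1, e2⟩ := h4 l' hl' b c l hu
        exact ⟨_, _, e1.symm, e2.symm, L[l'].2.1,
          by simp [next₃, next, step_of_isEdgeList hL hl'], rfl⟩
      · rintro ⟨⟨a, b, c⟩, y, rfl, rfl, σ, rfl, hy⟩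
        obtain ⟨q, hq⟩ := Option.isSome_iff_exists.1 hy
        obtain ⟨p, hp, hstep⟩ := exists_of_next_eq_some hq
        simp only at hp
        subst hp
        obtain ⟨l, hl, hLl⟩ := exists_edge_of_step hL hstep
        obtain ⟨e1, e2⟩ := h4 l hl b c _ rfl
        rw [hLl] at e1 e2
        refine ⟨_, ?_, e1, ?_⟩
        · rw [h3]
          have hb := code_lt b
          have hc := code_lt c
          nlinarith [Nat.mul_le_mul_right ((G.nodes + 1) * (G.nodes + 1)) hl]
        · rw [e2]
          have : G.next (some p) σ = some q := hq
          simp [next₃, this]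
  · have h1 : W ≤ G.nodes + L.length + 1 := by omega
    have h2 : L.length ≤ G.nodes + L.length + 1 := by omega
    have h3 : 1 ≤ G.nodes + L.length + 1 := by omega
    generalize G.nodes + L.length + 1 = n at *
    have h4 : W * W * W ≤ n ^ 3 := by
      rw [pow_three']; exact Nat.mul_le_mul (Nat.mul_le_mul h1 h1) h1
    have h5 : L.length * (W * W) ≤ n ^ 3 := by
      rw [pow_three]; exact Nat.mul_le_mul h2 (Nat.mul_le_mul h1 h1)
    have h6 : n ≤ n ^ 3 := Nat.le_self_pow (by norm_num) n
    omega

/-- The number of the state that is the node in a register. -/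
def node (j : Register) : Term Register := j.val + 1

/-- Vanishes unless some nonempty word fixes the states `p`, `q`, `r`. -/
def loopTerm : Term Register :=
  connected (triple (node p) (node q) r.val) (triple (node p) (node q) r.val)

/-- Vanishes unless some nonempty word leads from the pair `a`, `b` to the pair `c`, `d`. -/
def pathTerm (a b c d : Term Register) : Term Register :=
  connected (triple a b 0) (triple c d 0)

/-- Requires for all nodes `p`, `q` and all states `r` that a term vanishes. -/
def checkTriples (t : Term Register) : Code Register :=
  .loop p (.input 0) <| .loop q (.input 0) <| .loop r states <| .require out t

lemma checkTriples_spec (t : Term Register) (s : Store Register) (h0 : Holds out s True)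
    (φ : Fin G.nodes → Fin G.nodes → Option (Fin G.nodes) → Prop)
    (ht : ∀ s' : Store Register, (∀ j, j ∉ (checkTriples t).writes → s' j = s j) →
      ∀ (a b : Fin G.nodes) (c : Option (Fin G.nodes)), s' p 0 = a → s' q 0 = b →
        s' r 0 = code c → (t.eval (G.encode L) s' = 0 ↔ φ a b c)) :
    (checkTriples t).Spec (G.encode L) s
      (1 + G.nodes * (1 + (1 + G.nodes * (1 + (1 + (G.nodes + 1) * (1 + 2)))))) fun s' =>
      Holds out s' (∀ a b c, φ a b c) := by
  refine (Spec.forall_loop G.nodes _ (fun a => ∀ ha : a < G.nodes, ∀ b, ∀ hb : b < G.nodes,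
    ∀ d < G.nodes + 1, ∀ c, code c = d → φ ⟨a, ha⟩ ⟨b, hb⟩ c) (by simp) rfl h0 ?_).mono le_rfl ?_
  · intro a ha p₁ s₁ hs₁ h₁
    refine (Spec.forall_loop G.nodes _ (fun b => ∀ hb : b < G.nodes,
      ∀ d < G.nodes + 1, ∀ c, code c = d → φ ⟨a, ha⟩ ⟨b, hb⟩ c) (by simp) rfl h₁ ?_).mono
        le_rfl fun s' _ h => h.congr ?_
    · intro b hb p₂ s₂ hs₂ h₂
      refine (Spec.forall_loop (G.nodes + 1) _ (fun d =>
        ∀ c, code c = d → φ ⟨a, ha⟩ ⟨b, hb⟩ c) (by simp) (eval_states _) h₂ ?_).mono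
          le_rfl fun s' _ h => h.congr ?_
      · intro d hd p₃ s₃ hs₃ h₃
        refine Spec.require ?_ h₃
        obtain ⟨c, rfl⟩ := exists_code_eq hd
        have e1 := congrFun (hs₃ p (by simp [writes, require])) 0
        have e2 := congrFun (hs₃ q (by simp [writes, require])) 0
        have e3 := congrFun (hs₂ p (by simp [writes, require])) 0
        rw [ht _ ?_ ⟨a, ha⟩ ⟨b, hb⟩ c]
        · refine ⟨fun h c' hc' => ?_, fun h => h c rfl⟩
          rwa [code_injective hc']
        · simp [Store.set, e1, e3]
        · simp [Store.set, e2]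
        · simp [Store.set]
        · intro j hj
          have hj' := hj
          simp only [checkTriples, writes, require, List.mem_cons, List.mem_append, not_or] at hj'
          obtain ⟨j1, j2, j3, j4, -⟩ := hj'
          rw [Store.set_of_ne j3, hs₃ j (by simp [writes, require, j3, j4]), Store.set_of_ne j2,
            hs₂ j (by simp [writes, require, j2, j3, j4]), Store.set_of_ne j1, hs₁ j hj]
      · exact and_congr_right fun _ => ⟨fun h _ => h, fun h => h hb⟩
    · exact and_congr_right fun _ => ⟨fun h _ b hb => h b hb hb, fun h b hb _ => h ha b hb⟩
  · intro s' _ h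
    refine h.congr ?_
    simp only [true_and]
    exact ⟨fun h a b c => h a a.2 a.2 b b.2 _ (code_lt c) c rfl,
      fun h a _ ha b hb d _ c _ => h ⟨a, ha⟩ ⟨b, hb⟩ c⟩

/-- Requires for all nodes `p`, `q` and all states `r` that a term vanishes that depends on the
connections between triples of states. -/
def tripleCode (t : Term Register) : Code Register :=
  .seq connectTriples <| .seq (.set out 0 1) <| checkTriples t

/-- The connections between triples of states can be read off. -/
def TripleConnects (G : TransitionGraph) (s : Store Register) : Prop :=
  ∀ x y, s fwd 0 / s powX (code₃ x) % s baseX 0 / s powZ (code₃ y) % s baseZ 0 ≠ 0 ↔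
    Relation.TransGen G.Step₃ x y

lemma triple_time {V n : ℕ} (hV : V ≤ n) (hn : 1 ≤ n) :
    40000 * (n + 1) ^ 3 + (1 + (1 + V * (1 + (1 + V * (1 + (1 + (V + 1) * (1 + 2))))))) + 1 ≤
      400000 * n ^ 3 := by
  have h1 : n + 1 ≤ 2 * n := by omega
  have h2 := Nat.pow_le_pow_left h1 3
  rw [mul_pow] at h2
  have h5 : V * V * V ≤ n ^ 3 := by
    rw [pow_three']; exact Nat.mul_le_mul (Nat.mul_le_mul hV hV) hV
  have h6 : V * V ≤ n ^ 3 := by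
    rw [pow_three']; nlinarith [Nat.mul_le_mul hV hV]
  have h7 : n ≤ n ^ 3 := Nat.le_self_pow (by norm_num) n
  nlinarith

/-- Properties of all triples `p`, `q`, `r` that are expressed by a term over the connections
between triples of states are decided in cubic time; the program depends only on the term. -/
lemma tripleCode_answers (t : Term Register) : ∃ C : ℕ, ∀ (G : TransitionGraph)
    (L : List (Fin G.nodes × Fin G.alphabet × Fin G.nodes)), 0 < G.nodes → G.IsEdgeList L →
    ∀ (φ : Fin G.nodes → Fin G.nodes → Option (Fin G.nodes) → Prop) (Q : Prop),
    (∀ s : Store Register, TripleConnects G s →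
      ∀ (a b : Fin G.nodes) (c : Option (Fin G.nodes)), s p 0 = a → s q 0 = b →
        s r 0 = code c → (t.eval (G.encode L) s = 0 ↔ φ a b c)) → ((∀ a b c, φ a b c) ↔ Q) →
    Answers ((tripleCode t).program graphBase .out) (G.encode L) Q
      (C * (G.nodes + L.length) ^ 3) := by
  refine ⟨((tripleCode t).weight graphBase + graphBase.cost + 20) * 400000, ?_⟩
  intro G L hG hL φ Q ht hQ
  have hspec : (tripleCode t).Spec (G.encode L) (fun _ _ => 0)
      (40000 * (G.nodes + L.length + 1) ^ 3 + (1 + (1 + G.nodes * (1 + (1 + G.nodes *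
        (1 + (1 + (G.nodes + 1) * (1 + 2)))))))) fun s => Holds out s Q := by
    refine Spec.seq (connectTriples_spec hL _ fun _ => rfl) fun s₁ hs₁ h₁ => Spec.set_seq ?_
    refine (checkTriples_spec t _ (by simp [Holds, Store.set]) φ ?_).mono le_rfl
      fun s' _ h => h.congr hQ
    intro s' hs'
    refine ht s' ?_
    have e1 := hs' fwd (by simp [checkTriples, writes, require])
    have e2 := hs' powX (by simp [checkTriples, writes, require])
    have e3 := hs' powZ (by simp [checkTriples, writes, require])
    have e4 := hs' baseX (by simp [checkTriples, writes, require])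
    have e5 := hs' baseZ (by simp [checkTriples, writes, require])
    rw [TripleConnects, e1, e2, e3, e4, e5]
    exact h₁
  refine (Code.answers isBase_graphBase _ _ Q _ hspec).mono ?_
  rw [mul_assoc]
  refine Nat.mul_le_mul_left _ ?_
  exact triple_time (by omega) (by omega)

section Meaning

variable {s : Store Register} {a b : Fin G.nodes} {c : Option (Fin G.nodes)}

lemma loopTerm_ne_zero (hs : TripleConnects G s) (ha : s p 0 = a) (hb : s q 0 = b)
    (hc : s r 0 = code c) :
    loopTerm.eval (G.encode L) s ≠ 0 ↔ G.Loop (some a) (some b) c := by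
  rw [loop_iff_transGen, ← hs]
  simp [loopTerm, eval_connected, triple, node, code₃, ha, hb, hc]

/-- Paths between pairs of states with a common loop can be read off. -/
lemma pathTerm_ne_zero (hs : TripleConnects G s) {t₁ t₂ t₃ t₄ : Term Register}
    {x y y' : Option (Fin G.nodes)} {x' : Fin G.nodes} (h₁ : t₁.eval (G.encode L) s = code x)
    (h₂ : t₂.eval (G.encode L) s = code y) (h₃ : t₃.eval (G.encode L) s = code (some x'))
    (h₄ : t₄.eval (G.encode L) s = code y') {v : List (Fin G.alphabet)} (hv : v ≠ [])
    (hx : G.read x v = x) (hy : G.read y v = y) :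
    (pathTerm t₁ t₂ t₃ t₄).eval (G.encode L) s ≠ 0 ↔ G.PairPath x y (some x') y' := by
  rw [pairPath_iff_transGen _ hv hx hy, ← hs]
  simp only [pathTerm, eval_connected, triple, Term.eval_add, Term.eval_mul, eval_states, h₁, h₂,
    h₃, h₄, Term.eval_ofNat, code₃, code_none]

lemma distance_node_eq_zero (hb : s q 0 = b) (hc : s r 0 = code c) :
    (r.val.distance (node q)).eval (G.encode L) s = 0 ↔ c = some b := by
  rw [Term.distance_eq_zero, ← code_injective.eq_iff (b := some b)]
  simp [node, hb, hc]

end Meaning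

/-- The term of the test vanishes if there is no loop, no path, or if `r = q`. -/
theorem answers_locallyIdempotent : ∃ (P : Program) (C : ℕ), ∀ (G : TransitionGraph)
    (L : List (Fin G.nodes × Fin G.alphabet × Fin G.nodes)), 0 < G.nodes → G.IsEdgeList L →
    Answers P (G.encode L) (LocallyIdempotent G.transitionSemigroup)
      (C * (G.nodes + L.length) ^ 3) := by
  obtain ⟨C, hC⟩ := tripleCode_answers (loopTerm *
    pathTerm (node p) (node q) (node q) r.val * r.val.distance (node q))
  refine ⟨_, C, fun G L hG hL => hC G L hG hL _ _ ?_ locallyIdempotent_iff.symm⟩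
  intro s hs a b c ha hb hc
  rw [Term.eval_mul, Term.eval_mul, mul_eq_zero, mul_eq_zero, distance_node_eq_zero hb hc]
  by_cases hloop : G.Loop (some a) (some b) c
  · have h1 := (loopTerm_ne_zero (L := L) hs ha hb hc).2 hloop
    obtain ⟨v, hv, h2, h3, h4⟩ := hloop
    have ea : (node p).eval (G.encode L) s = code (some a) := by simp [node, ha]
    have eb : (node q).eval (G.encode L) s = code (some b) := by simp [node, hb]
    have ec : r.val.eval (G.encode L) s = code c := hc
    have hloop : G.Loop (some a) (some b) c := ⟨v, hv, h2, h3, h4⟩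
    rw [← pathTerm_ne_zero hs ea eb eb ec hv h2 h3]
    tauto
  · have := (loopTerm_ne_zero (L := L) hs ha hb hc).not.2 hloop
    tauto

/-- Both conditions of `locallyRightRegular_iff` concern the same triples `p`, `q`, `r`, and are
tested together. -/
theorem answers_leftLocallyTestable_transitionSemigroup : ∃ (P : Program) (C : ℕ),
    ∀ (G : TransitionGraph) (L : List (Fin G.nodes × Fin G.alphabet × Fin G.nodes)),
    0 < G.nodes → G.IsEdgeList L →
    Answers P (G.encode L) (LeftLocallyTestable G.transitionSemigroup)
      (C * (G.nodes + L.length) ^ 3) := by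
  obtain ⟨C, hC⟩ := tripleCode_answers (loopTerm * (pathTerm (node p) (node q) (node q) r.val +
    pathTerm (node p) r.val (node q) r.val * pathTerm (node q) (node p) (node q) r.val) *
      r.val.distance (node q))
  refine ⟨_, C, fun G L hG hL => hC G L hG hL (fun a b c => G.Loop (some a) (some b) c →
    (G.PairPath (some a) (some b) (some b) c ∨ (G.PairPath (some a) c (some b) c ∧
      G.PairPath (some b) (some a) (some b) c)) → c = some b) _ ?_ ?_⟩
  · intro s hs a b c ha hb hc
    rw [Term.eval_mul, Term.eval_mul, mul_eq_zero, mul_eq_zero, distance_node_eq_zero hb hc]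
    by_cases hloop : G.Loop (some a) (some b) c
    · have h1 := (loopTerm_ne_zero (L := L) hs ha hb hc).2 hloop
      obtain ⟨v, hv, h2, h3, h4⟩ := hloop
      have hloop : G.Loop (some a) (some b) c := ⟨v, hv, h2, h3, h4⟩
      have ea : (node p).eval (G.encode L) s = code (some a) := by simp [node, ha]
      have eb : (node q).eval (G.encode L) s = code (some b) := by simp [node, hb]
      have ec : r.val.eval (G.encode L) s = code c := hc
      rw [← pathTerm_ne_zero hs ea eb eb ec hv h2 h3,
        ← pathTerm_ne_zero hs ea ec eb ec hv h2 h4, ← pathTerm_ne_zero hs eb ea eb ec hv h3 h2]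
      simp only [Term.eval_add, Term.eval_mul, Nat.add_eq_zero_iff, mul_eq_zero]
      tauto
    · have := (loopTerm_ne_zero (L := L) hs ha hb hc).not.2 hloop
      tauto
  · rw [leftLocallyTestable_iff, locallyRightRegular_iff, locallyIdempotent_iff]
    constructor
    · intro h
      exact ⟨fun p q r h1 h2 => h p q r h1 (Or.inl h2), fun p q r h1 h2 h3 =>
        h p q r h1 (Or.inr ⟨h2, h3⟩)⟩
    · rintro ⟨h, h'⟩ p q r h1 (h2 | ⟨h2, h3⟩)
      · exact h p q r h1 h2
      · exact h' p q r h1 h2 h3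

end Triples

end RAM

namespace LocalTestability.TransitionGraph

variable {G : TransitionGraph}

/-! ### Right local testability of a transition semigroup as a property of a graph of pairs -/

/-- The second state can be reached from the first, and the dead state only from itself. -/
def LiveReaches (G : TransitionGraph) (a b : Option (Fin G.nodes)) : Prop :=
  G.Reaches a b ∧ (b = none → a = none)

lemma Reaches.trans {a b c : Option (Fin G.nodes)} (h : G.Reaches a b) (h' : G.Reaches b c) :
    G.Reaches a c := by
  obtain ⟨w, rfl⟩ := h
  obtain ⟨v, rfl⟩ := h'
  exact ⟨w ++ v, read_append ..⟩

lemma Reaches.isSome {a : Option (Fin G.nodes)} {q : Fin G.nodes} (h : G.Reaches a (some q)) :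
    a ≠ none := by
  rintro rfl
  obtain ⟨w, hw⟩ := h
  simp at hw

lemma liveReaches_iff {a b : Option (Fin G.nodes)} (hb : b ≠ none) :
    G.LiveReaches a b ↔ G.Reaches a b := by
  simp [LiveReaches, hb]

open Classical in
/-- The beginning of the edge of the test graph that belongs to a pair of states and a letter. The
vertex `none` is the state of failure. -/
noncomputable def testSource (a b : Option (Fin G.nodes)) (σ : Fin G.alphabet) :
    Option (Option (Fin G.nodes) × Option (Fin G.nodes)) :=
  if G.LiveReaches (G.next a σ) b then some (a, b) else none

open Classical in
/-- The end of the edge of the test graph that belongs to a pair of states and a letter. -/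
noncomputable def testTarget (a b : Option (Fin G.nodes)) (σ : Fin G.alphabet) :
    Option (Option (Fin G.nodes) × Option (Fin G.nodes)) :=
  if G.LiveReaches (G.next a σ) b ∧ G.LiveReaches (G.next b σ) b then
    some (G.next a σ, G.next b σ) else none

/-- The edges of the test graph. From a pair `(a, b)` a letter leads on only if `b` can be reached
after the transition of `a`. Then the pair that follows is reached if `b` stays in its strongly
connected component, and failure if not. -/
def TestStep (G : TransitionGraph) (x y : Option (Option (Fin G.nodes) × Option (Fin G.nodes))) :
    Prop :=
  ∃ a b σ, G.next a σ ≠ none ∧ testSource a b σ = x ∧ testTarget a b σ = y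

lemma testStep_some_iff {a b : Option (Fin G.nodes)}
    {y : Option (Option (Fin G.nodes) × Option (Fin G.nodes))} :
    G.TestStep (some (a, b)) y ↔ ∃ σ, G.next a σ ≠ none ∧ G.LiveReaches (G.next a σ) b ∧
      (G.LiveReaches (G.next b σ) b ∧ y = some (G.next a σ, G.next b σ) ∨
        ¬ G.LiveReaches (G.next b σ) b ∧ y = none) := by
  constructor
  · rintro ⟨a', b', σ, h1, h2, rfl⟩
    rw [testSource] at h2
    split_ifs at h2 with h3
    obtain ⟨rfl, rfl⟩ := Prod.ext_iff.1 (Option.some_injective _ h2)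
    refine ⟨σ, h1, h3, ?_⟩
    by_cases h4 : G.LiveReaches (G.next b' σ) b'
    · exact Or.inl ⟨h4, by simp [testTarget, h3, h4]⟩
    · exact Or.inr ⟨h4, by simp [testTarget, h4]⟩
  · rintro ⟨σ, h1, h3, ⟨h4, rfl⟩ | ⟨h4, rfl⟩⟩
    · exact ⟨a, b, σ, h1, by simp [testSource, h3], by simp [testTarget, h3, h4]⟩
    · exact ⟨a, b, σ, h1, by simp [testSource, h3], by simp [testTarget, h4]⟩

lemma not_testStep_none_some (x : Option (Fin G.nodes) × Option (Fin G.nodes)) :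
    ¬ G.TestStep none (some x) := by
  rintro ⟨a, b, σ, -, h2, h3⟩
  rw [testSource] at h2
  split_ifs at h2 with h
  simp [testTarget, h] at h3

/-- What a path of the test graph from a pair of nodes says about the words read along it. -/
lemma of_transGen_testStep {p q : Fin G.nodes}
    {y : Option (Option (Fin G.nodes) × Option (Fin G.nodes))}
    (h : Relation.TransGen G.TestStep (some (some p, some q)) y) :
    G.Reaches (some p) (some q) ∧ ∃ w : List (Fin G.alphabet), w ≠ [] ∧
      (∀ x, y = some x → G.read (some p) w = x.1 ∧ G.read (some q) w = x.2 ∧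
        G.Reaches x.2 (some q)) ∧
      (y = none → ∃ v, G.Reaches (G.read (some p) v) (some q) ∧
        ¬ G.Reaches (G.read (some q) v) (some q)) := by
  have key : ∀ (w : List (Fin G.alphabet)) y, G.Reaches (G.read (some q) w) (some q) →
      G.TestStep (some (G.read (some p) w, G.read (some q) w)) y → ∃ σ,
        G.Reaches (G.read (some p) (w ++ [σ])) (some q) ∧
        (∀ x, y = some x → G.read (some p) (w ++ [σ]) = x.1 ∧ G.read (some q) (w ++ [σ]) = x.2 ∧
          G.Reaches x.2 (some q)) ∧
        (y = none → ¬ G.Reaches (G.read (some q) (w ++ [σ])) (some q)) := by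
    intro w y hw hy
    obtain ⟨σ, h1, h2, h3⟩ := testStep_some_iff.1 hy
    have hlive := hw.isSome
    rw [liveReaches_iff hlive] at h2 h3
    refine ⟨σ, ?_, ?_, ?_⟩
    · rw [read_append]
      exact h2.trans hw
    · rintro x rfl
      rcases h3 with ⟨h3, h4⟩ | ⟨-, h4⟩
      · obtain rfl := Option.some_injective _ h4
        exact ⟨read_append .., read_append .., h3.trans hw⟩
      · simp at h4
    · rintro rfl h
      rcases h3 with ⟨-, h4⟩ | ⟨h3, -⟩
      · simp at h4
      · rw [read_append] at h
        exact h3 (h.trans ⟨w, rfl⟩)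
  induction h with
  | single h =>
    obtain ⟨σ, h1, h2, h3⟩ := key [] _ ⟨[], rfl⟩ h
    exact ⟨.trans ⟨[σ], rfl⟩ h1, [σ], by simp, h2, fun hy => ⟨[σ], h1, h3 hy⟩⟩
  | @tail y z _ h ih =>
    obtain ⟨hpq, w, hw, ih1, ih2⟩ := ih
    refine ⟨hpq, ?_⟩
    cases y with
    | none =>
      obtain rfl : z = none := by
        cases z with
        | none => rfl
        | some x => exact absurd h (not_testStep_none_some x)
      exact ⟨w, hw, by simp, fun _ => ih2 rfl⟩
    | some x =>
      obtain ⟨e1, e2, e3⟩ := ih1 x rfl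
      obtain ⟨a, b⟩ := x
      subst e1 e2
      obtain ⟨σ, h1, h2, h3⟩ := key w _ e3 h
      exact ⟨w ++ [σ], by simp, h2, fun hy => ⟨_, h1, h3 hy⟩⟩

/-- Reading a word from a pair `(p, q)` of nodes gives a path of the test graph or a path to
failure, if `q` can be reached after the word has been read from `p`. -/
lemma testStep_path {p q : Fin G.nodes} (w : List (Fin G.alphabet))
    (h : G.Reaches (G.read (some p) w) (some q)) :
    (G.Reaches (G.read (some q) w) (some q) ∧ Relation.ReflTransGen G.TestStep
      (some (some p, some q)) (some (G.read (some p) w, G.read (some q) w))) ∨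
    Relation.ReflTransGen G.TestStep (some (some p, some q)) none := by
  induction w using List.reverseRecOn with
  | nil => exact Or.inl ⟨⟨[], rfl⟩, .refl⟩
  | append_singleton w σ ih =>
    rw [read_append] at h
    rcases ih (.trans ⟨[σ], rfl⟩ h) with ⟨h1, h2⟩ | h
    · have hlive := h1.isSome
      have h3 : G.LiveReaches (G.next (G.read (some p) w) σ) (G.read (some q) w) :=
        (liveReaches_iff hlive).2 (h.trans ⟨w, rfl⟩)
      by_cases h4 : G.LiveReaches (G.next (G.read (some q) w) σ) (G.read (some q) w)
      · left
        rw [read_append, read_append]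
        exact ⟨((liveReaches_iff hlive).1 h4).trans h1,
          h2.tail (testStep_some_iff.2 ⟨σ, h.isSome, h3, Or.inl ⟨h4, rfl⟩⟩)⟩
      · exact Or.inr (h2.tail (testStep_some_iff.2 ⟨σ, h.isSome, h3, Or.inr ⟨h4, rfl⟩⟩))
    · exact Or.inr h

/-- A loop at two nodes, of which the second can be reached from the first, is a loop of the test
graph. -/
lemma transGen_of_loop {p q : Fin G.nodes} (h : G.Loop (some p) (some q) none)
    (hpq : G.Reaches (some p) (some q)) :
    Relation.TransGen G.TestStep (some (some p, some q)) (some (some p, some q)) := by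
  obtain ⟨w, hw, hp, hq, -⟩ := h
  -- All states on the loop can be reached from each other.
  have key : ∀ u v, u ++ v = w → u ≠ [] → Relation.TransGen G.TestStep (some (some p, some q))
      (some (G.read (some p) u, G.read (some q) u)) := by
    intro u
    induction u using List.reverseRecOn with
    | nil => exact fun _ _ h => absurd rfl h
    | append_singleton u σ ih =>
      intro v huv _
      have hp' : G.Reaches (G.next (G.read (some p) u) σ) (some p) :=
        ⟨v, by rw [← huv] at hp; simpa using hp⟩
      have hq' : G.Reaches (G.next (G.read (some q) u) σ) (some q) :=
        ⟨v, by rw [← huv] at hq; simpa using hq⟩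
      have hqu : G.Reaches (G.read (some q) u) (some q) := .trans ⟨[σ], rfl⟩ hq'
      have hstep : G.TestStep (some (G.read (some p) u, G.read (some q) u))
          (some (G.read (some p) (u ++ [σ]), G.read (some q) (u ++ [σ]))) := by
        rw [read_append, read_append]
        exact testStep_some_iff.2 ⟨σ, hp'.isSome,
          (liveReaches_iff hqu.isSome).2 ((hp'.trans hpq).trans ⟨u, rfl⟩),
          Or.inl ⟨(liveReaches_iff hqu.isSome).2 (hq'.trans ⟨u, rfl⟩), rfl⟩⟩
      rcases eq_or_ne u [] with rfl | hu
      · exact .single hstep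
      · exact .tail (ih (σ :: v) (by simpa using huv) hu) hstep
  have := key w [] (by simp) hw
  rwa [hp, hq] at this

/-- The transition semigroup is locally left regular iff in the test graph, pairs of different
nodes in a strongly connected component of `G` have no loops, and loops do not lead to failure. -/
theorem locallyLeftRegular_iff_testStep : LocallyLeftRegular G.transitionSemigroup ↔
    ∀ p q : Fin G.nodes,
      Relation.TransGen G.TestStep (some (some p, some q)) (some (some p, some q)) →
      (G.LiveReaches (some q) (some p) → p = q) ∧
        ¬ Relation.TransGen G.TestStep (some (some p, some q)) none := by
  rw [locallyLeftRegular_iff]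
  constructor
  · rintro ⟨h1, h2⟩ p q h
    obtain ⟨hpq, w, hw, hfix, -⟩ := of_transGen_testStep h
    obtain ⟨hp, hq, -⟩ := hfix _ rfl
    have hloop : G.Loop (some p) (some q) none := ⟨w, hw, hp, hq, by simp⟩
    refine ⟨fun hqp => h1 p q hloop hpq hqp.1, fun hbad => ?_⟩
    obtain ⟨-, _, -, -, hv⟩ := of_transGen_testStep hbad
    obtain ⟨v, hv1, hv2⟩ := hv rfl
    exact hv2 (h2 p q hloop v hv1)
  · intro h
    constructor
    · intro p q hloop hpq hqp
      exact (h p q (transGen_of_loop hloop hpq)).1 ((liveReaches_iff (by simp)).2 hqp)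
    · intro p q hloop w hw
      by_contra hq
      have hpq : G.Reaches (some p) (some q) := .trans ⟨w, rfl⟩ hw
      rcases testStep_path w hw with ⟨h1, -⟩ | h1
      · exact hq h1
      · refine (h p q (transGen_of_loop hloop hpq)).2 ?_
        rcases Relation.reflTransGen_iff_eq_or_transGen.1 h1 with h1 | h1
        · simp at h1
        · exact h1

/-- The number of a pair of states. -/
def code₂ (x : Option (Fin G.nodes) × Option (Fin G.nodes)) : ℕ :=
  code x.1 * (G.nodes + 1) + code x.2

lemma code₂_lt (x : Option (Fin G.nodes) × Option (Fin G.nodes)) :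
    code₂ x < (G.nodes + 1) * (G.nodes + 1) := by
  have h1 := code_lt x.1
  have h2 := code_lt x.2
  rw [code₂]
  nlinarith [Nat.mul_le_mul_right (G.nodes + 1) h1]

lemma code₂_injective : Function.Injective (code₂ (G := G)) := by
  rintro ⟨a, b⟩ ⟨a', b'⟩ h
  obtain ⟨h1, h2⟩ := RAM.address_inj (code_lt _) (code_lt _) h
  exact Prod.ext (code_injective h1) (code_injective h2)

/-- The number of a vertex of the test graph. -/
def testCode (x : Option (Option (Fin G.nodes) × Option (Fin G.nodes))) : ℕ :=
  x.elim ((G.nodes + 1) * (G.nodes + 1)) code₂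

@[simp] lemma testCode_none : testCode (none : Option (Option (Fin G.nodes) × _))
    = (G.nodes + 1) * (G.nodes + 1) := rfl

@[simp] lemma testCode_some (x : Option (Fin G.nodes) × Option (Fin G.nodes)) :
    testCode (some x) = code₂ x := rfl

lemma testCode_lt (x : Option (Option (Fin G.nodes) × Option (Fin G.nodes))) :
    testCode x < (G.nodes + 1) * (G.nodes + 1) + 1 := by
  cases x with
  | none => exact Nat.lt_succ_self _
  | some x => exact (code₂_lt x).trans (Nat.lt_succ_self _)

lemma testCode_injective : Function.Injective (testCode (G := G)) := by
  rintro (_ | x) (_ | y) h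
  · rfl
  · exact absurd h (code₂_lt y).ne'
  · exact absurd h (code₂_lt x).ne
  · rw [code₂_injective h]

/-- The states that can be reached from a given state, in terms of the graph of pairs. -/
lemma liveReaches_iff_transGen (a b : Option (Fin G.nodes)) :
    G.LiveReaches a b ↔ Relation.TransGen G.Step₂ (a, none) (b, none) ∨ a = b := by
  cases b with
  | none =>
    rw [transGen_step_iff fun x σ => isSome_of_next]
    constructor
    · exact fun h => Or.inr (h.2 rfl)
    · rintro (h | rfl)
      · obtain ⟨_, _, _, h⟩ := h
        simp at h
      · exact ⟨⟨[], rfl⟩, id⟩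
  | some q =>
    rw [transGen_step₂_iff, liveReaches_iff (by simp)]
    constructor
    · rintro ⟨w, hw⟩
      rcases eq_or_ne w [] with rfl | hne
      · exact Or.inr hw
      · exact Or.inl ⟨w, hne, hw, by simp⟩
    · rintro (⟨w, _, hw, _⟩ | rfl)
      · exact ⟨w, hw⟩
      · exact ⟨[], rfl⟩

end LocalTestability.TransitionGraph

namespace RAM

open Register Code LocalTestability LocalTestability.TransitionGraph

/-! ### The algorithm that uses pairs of states -/

/-- The number of the edge of the input from which an edge of a graph of pairs is built. -/
def pairEdge : Term Register := i.val / states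

/-- The second state from which an edge of a graph of pairs is built. -/
def pairState : Term Register := i.val % states

/-- Builds a graph with `n` vertices that has an edge from `a` to `b` for every edge of the input
and every state, and computes the connections. -/
def connectPairs (n a b : Term Register) : Code Register :=
  .seq (.set size 0 n) <| .seq (.set count 0 (.input 1 * states)) <|
  .seq (.loop i (.input 1 * states) (.seq (.set tmp 0 b) <|
    .seq (.set source i.val a) (.set target i.val tmp.val))) closure

section Pairs

variable {G : TransitionGraph} {L : List (Fin G.nodes × Fin G.alphabet × Fin G.nodes)}

/-- The connections in a graph on a type `X` whose edges lead from `A a b σ` to `B a b σ`, one for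
each edge of the transition graph with the beginning `a` and the label `σ` and each state `b`, are
computed in linear time. -/
lemma connectPairs_spec (hL : G.IsEdgeList L) {X : Type} {f : X → ℕ} (hf : Function.Injective f)
    {N : ℕ} (hN : ∀ x, f x < N)
    (A B : Option (Fin G.nodes) → Option (Fin G.nodes) → Fin G.alphabet → X)
    {n a b : Term Register} (s : Store Register) (hn : n.eval (G.encode L) s = N)
    (hab : ∀ s' : Store Register, s' table = s table → s' reach = s reach →
      ∀ (l : ℕ) (hl : l < L.length) (c : Option (Fin G.nodes)),
      s' i 0 = l * (G.nodes + 1) + code c →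
      a.eval (G.encode L) s' = f (A (some L[l].1) c L[l].2.1) ∧
      b.eval (G.encode L) s' = f (B (some L[l].1) c L[l].2.1)) :
    (connectPairs n a b).Spec (G.encode L) s
      (3 + L.length * (G.nodes + 1) * 4 + 1000 * (N + L.length * (G.nodes + 1) + 1)) fun s' =>
      ∀ x y, s' fwd 0 / s' powX (f x) % s' baseX 0 / s' powZ (f y) % s' baseZ 0 ≠ 0 ↔
        Relation.TransGen (fun x y => ∃ a c σ, G.next a σ ≠ none ∧ A a c σ = x ∧ B a c σ = y)
          x y := by
  have hdecode : ∀ u < L.length * (G.nodes + 1), ∃ l, ∃ hl : l < L.length,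
      ∃ c : Option (Fin G.nodes), u = l * (G.nodes + 1) + code c := by
    intro u hu
    obtain ⟨c, hc⟩ := exists_code_eq (Nat.mod_lt u (Nat.succ_pos G.nodes))
    refine ⟨u / (G.nodes + 1), Nat.div_lt_of_lt_mul (by rwa [mul_comm]), c, ?_⟩
    rw [hc]
    exact (Nat.div_add_mod' u (G.nodes + 1)).symm
  refine Spec.mono (T := 1 + (1 + ((1 + L.length * (G.nodes + 1) * (1 + 3)) +
    1000 * (N + L.length * (G.nodes + 1) + 1)))) ?_ (by omega) fun _ _ h => h
  refine Spec.set_seq (Spec.set_seq (Spec.seq (Spec.loop (fun n s' => ∀ (l : ℕ)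
    (hl : l < L.length) (c : Option (Fin G.nodes)), ∀ u < n, u = l * (G.nodes + 1) + code c →
      s' source u = f (A (some L[l].1) c L[l].2.1) ∧
      s' target u = f (B (some L[l].1) c L[l].2.1))
    (L.length * (G.nodes + 1)) 3 (by simp) (by simp) ?_) ?_))
  · intro m hm s' hs' hinv
    have h1 : s' table = s table := by
      rw [hs' table (by simp [writes]), Store.set_of_ne (by simp), Store.set_of_ne (by simp)]
    have h2 : s' reach = s reach := by
      rw [hs' reach (by simp [writes]), Store.set_of_ne (by simp), Store.set_of_ne (by simp)]
    refine Spec.set_seq (Spec.set_seq (Spec.set ?_))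
    intro l hl c u hu hul
    rcases Nat.lt_succ_iff_lt_or_eq.1 hu with hlt | heq
    · simpa [Store.set, hlt.ne] using hinv l hl c u hlt hul
    · subst heq
      constructor
      · rw [← (hab (((s'.set i 0 u).set tmp 0 (b.eval (G.encode L) (s'.set i 0 u)))) (by
          rw [Store.set_of_ne (by simp), Store.set_of_ne (by simp), h1]) (by
          rw [Store.set_of_ne (by simp), Store.set_of_ne (by simp), h2]) l hl c
          (by simpa [Store.set] using hul)).1]
        simp [Store.set]
      · rw [← (hab (s'.set i 0 u) (by rw [Store.set_of_ne (by simp), h1]) (by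
          rw [Store.set_of_ne (by simp), h2]) l hl c (by simpa [Store.set] using hul)).2]
        simp [Store.set]
  · intro s₁ hs₁ h₁
    have hsize : s₁ size 0 = N := by
      rw [hs₁ size (by simp [writes])]
      simpa [Store.set] using hn
    have hcount : s₁ count 0 = L.length * (G.nodes + 1) := by
      rw [hs₁ count (by simp [writes])]
      simp [Store.set]
    refine (closure_spec s₁ ?_).mono (by rw [hsize, hcount]) ?_
    · intro u hu
      rw [hcount] at hu
      obtain ⟨l, hl, c, hul⟩ := hdecode u hu
      obtain ⟨e1, e2⟩ := h₁ l hl c u hu hul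
      rw [e1, e2, hsize]
      exact ⟨hN _, hN _⟩
    · intro s' _ h x y
      rw [hsize] at h
      rw [h _ (hN x) _ (hN y), transGen_copy_iff hf]
      intro u v
      constructor
      · rintro ⟨u, hu, rfl, rfl⟩
        rw [hcount] at hu
        obtain ⟨l, hl, c, hul⟩ := hdecode u hu
        obtain ⟨e1, e2⟩ := h₁ l hl c u hu hul
        exact ⟨_, _, e1.symm, e2.symm, _, _, _, by simp [next, step_of_isEdgeList hL hl],
          rfl, rfl⟩
      · rintro ⟨_, _, rfl, rfl, a, c, σ, hne, rfl, rfl⟩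
        obtain ⟨q, hq⟩ := Option.ne_none_iff_exists'.1 hne
        obtain ⟨p, rfl, hstep⟩ := exists_of_next_eq_some hq
        obtain ⟨l, hl, hLl⟩ := exists_edge_of_step hL hstep
        have hu : l * (G.nodes + 1) + code c < L.length * (G.nodes + 1) := by
          have := code_lt c
          nlinarith [Nat.mul_le_mul_right (G.nodes + 1) hl]
        obtain ⟨e1, e2⟩ := h₁ l hl c _ hu rfl
        rw [hLl] at e1 e2
        exact ⟨_, by rwa [hcount], e1, e2⟩

/-- The number of a pair of states. -/
def pair (a b : Term Register) : Term Register := a * states + b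

lemma eval_pair (s : Store Register) {t t' : Term Register} {a b : Option (Fin G.nodes)}
    (h : t.eval (G.encode L) s = code a) (h' : t'.eval (G.encode L) s = code b) :
    (pair t t').eval (G.encode L) s = code₂ (a, b) := by
  simp [pair, h, h', code₂]

/-- Tabulates the states that can be reached from a state. -/
def buildReach : Code Register :=
  .loop i (states * states) <| .set reach i.val <|
    1 - (1 - (connected (pair pairEdge 0) (pair pairState 0) +
      (1 - pairEdge.distance pairState)))

/-- The array `reach` holds the table of the states that can be reached from a state. -/
def HasReach (G : TransitionGraph) (s : Store Register) : Prop :=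
  ∀ a b : Option (Fin G.nodes), (G.LiveReaches a b → s reach (code₂ (a, b)) = 1) ∧
    (¬ G.LiveReaches a b → s reach (code₂ (a, b)) = 0)

/-- An indicator of a disjunction in terms of truncated subtraction. -/
lemma indicator_eq (e d : ℕ) : (e ≠ 0 ∨ d = 0 → 1 - (1 - (e + (1 - d))) = 1) ∧
    (¬ (e ≠ 0 ∨ d = 0) → 1 - (1 - (e + (1 - d))) = 0) := by
  omega

lemma buildReach_spec (s : Store Register)
    (hs : ∀ x y, s fwd 0 / s powX (code₂ x) % s baseX 0 / s powZ (code₂ y) % s baseZ 0 ≠ 0 ↔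
      Relation.TransGen G.Step₂ x y) :
    buildReach.Spec (G.encode L) s (1 + (G.nodes + 1) * (G.nodes + 1) * 2) (HasReach G) := by
  refine (Spec.loop (fun n s' => ∀ a b : Option (Fin G.nodes), code₂ (a, b) < n →
    (G.LiveReaches a b → s' reach (code₂ (a, b)) = 1) ∧
      (¬ G.LiveReaches a b → s' reach (code₂ (a, b)) = 0)) _ 1 (by simp) (by simp) ?_).mono le_rfl
      fun s' _ h a b => h a b (code₂_lt _)
  intro n hn s' hs' hinv
  have e1 := hs' fwd (by simp [writes])
  have e2 := hs' powX (by simp [writes])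
  have e3 := hs' powZ (by simp [writes])
  have e4 := hs' baseX (by simp [writes])
  have e5 := hs' baseZ (by simp [writes])
  refine Spec.set ?_
  intro a b hab
  rcases Nat.lt_succ_iff_lt_or_eq.1 hab with hlt | heq
  · simpa [Store.set, hlt.ne] using hinv a b hlt
  · subst heq
    have hb := code_lt b
    have h1 : code₂ (a, b) / (G.nodes + 1) = code a := by
      rw [code₂, Nat.mul_comm, Nat.mul_add_div (by omega), Nat.div_eq_of_lt hb, add_zero]
    have h2 : code₂ (a, b) % (G.nodes + 1) = code b := by
      rw [code₂, Nat.mul_comm, Nat.mul_add_mod, Nat.mod_eq_of_lt hb]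
    have h3 := hs (a, none) (b, none)
    have h4 : (pairEdge.distance pairState).eval (G.encode L) (s'.set i 0 (code₂ (a, b))) = 0 ↔
        a = b := by
      rw [Term.distance_eq_zero, ← code_injective.eq_iff]
      simp [pairEdge, pairState, Store.set, h1, h2]
    rw [liveReaches_iff_transGen, ← h3, ← h4]
    have p1 : pairEdge.eval (G.encode L) (s'.set i 0 (code₂ (a, b))) = code a := by
      simp [pairEdge, Store.set, h1]
    have p2 : pairState.eval (G.encode L) (s'.set i 0 (code₂ (a, b))) = code b := by
      simp [pairState, Store.set, h2]
    have hset : ∀ v, (s'.set i 0 (code₂ (a, b))).set reach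
        (i.val.eval (G.encode L) (s'.set i 0 (code₂ (a, b)))) v reach (code₂ (a, b)) = v := by
      simp [Store.set]
    rw [hset, Term.eval_sub, Term.eval_sub, Term.eval_add, Term.eval_sub, eval_connected,
      eval_pair (b := none) _ p1 rfl, eval_pair (b := none) _ p2 rfl,
      Store.set_of_ne (by simp), Store.set_of_ne (by simp), Store.set_of_ne (by simp),
      Store.set_of_ne (by simp), Store.set_of_ne (by simp), e1, e2, e3, e4, e5, Term.eval_ofNat]
    exact indicator_eq _ _

/-- The second component of the pair that follows in a graph of pairs. -/
def pairNext : Term Register := nextState (edgeLabel pairEdge) pairState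

/-- Requires for all nodes `p` and `q` that a term vanishes. -/
def checkPairs (t : Term Register) : Code Register :=
  .loop p (.input 0) <| .loop q (.input 0) <| .require out t

/-- The vertex of the test graph from which an edge starts. -/
def testSourceTerm : Term Register :=
  states * states - reach.get (pair (edgeTarget pairEdge) pairState) *
    (states * states - pair (edgeSource pairEdge) pairState)

/-- The vertex of the test graph in which an edge ends. -/
def testTargetTerm : Term Register :=
  states * states - reach.get (pair (edgeTarget pairEdge) pairState) *
    reach.get (pair pairNext pairState) *
    (states * states - pair (edgeTarget pairEdge) pairNext)

/-- Vanishes if the pair `p`, `q` violates no condition. -/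
def violation : Term Register :=
  connected (pair (node p) (node q)) (pair (node p) (node q)) *
    (reach.get (pair (node q) (node p)) * p.val.distance q.val +
      connected (pair (node p) (node q)) (states * states))

/-- Decides whether the transition semigroup is right locally testable. -/
def pairCode : Code Register :=
  .seq buildTable <|
  .seq (connectPairs (states * states) (pair (edgeSource pairEdge) pairState)
    (pair (edgeTarget pairEdge) pairNext)) <|
  .seq buildReach <|
  .seq (connectPairs (states * states + 1) testSourceTerm testTargetTerm) <|
  .seq (.set out 0 1) <| checkPairs violation

lemma checkPairs_spec (t : Term Register) (s : Store Register) (h0 : Holds out s True)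
    (φ : Fin G.nodes → Fin G.nodes → Prop)
    (ht : ∀ s' : Store Register, (∀ j, j ∉ (checkPairs t).writes → s' j = s j) →
      ∀ a b : Fin G.nodes, s' p 0 = a → s' q 0 = b → (t.eval (G.encode L) s' = 0 ↔ φ a b)) :
    (checkPairs t).Spec (G.encode L) s (1 + G.nodes * (1 + (1 + G.nodes * (1 + 2)))) fun s' =>
      Holds out s' (∀ a b, φ a b) := by
  refine (Spec.forall_loop G.nodes _ (fun a => ∀ ha : a < G.nodes, ∀ b, ∀ hb : b < G.nodes,
    φ ⟨a, ha⟩ ⟨b, hb⟩) (by simp) rfl h0 ?_).mono le_rfl ?_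
  · intro a ha p₁ s₁ hs₁ h₁
    refine (Spec.forall_loop G.nodes _ (fun b => ∀ hb : b < G.nodes,
      φ ⟨a, ha⟩ ⟨b, hb⟩) (by simp) rfl h₁ ?_).mono le_rfl fun s' _ h => h.congr ?_
    · intro b hb p₂ s₂ hs₂ h₂
      refine Spec.require ?_ h₂
      have e1 := congrFun (hs₂ p (by simp [writes, require])) 0
      rw [ht _ ?_ ⟨a, ha⟩ ⟨b, hb⟩]
      · exact ⟨fun h _ => h, fun h => h hb⟩
      · simp [Store.set, e1]
      · simp [Store.set]
      · intro j hj
        have hj' := hj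
        simp only [checkPairs, writes, require, List.mem_cons, List.mem_append, not_or] at hj'
        obtain ⟨j1, j2, j3, -⟩ := hj'
        rw [Store.set_of_ne j2, hs₂ j (by simp [writes, require, j2, j3]), Store.set_of_ne j1,
          hs₁ j hj]
    · exact and_congr_right fun _ => ⟨fun h _ b hb => h b hb hb, fun h b hb _ => h ha b hb⟩
  · intro s' _ h
    refine h.congr ?_
    simp only [true_and]
    exact ⟨fun h a b => h a a.2 a.2 b b.2, fun h a _ ha b hb => h ⟨a, ha⟩ ⟨b, hb⟩⟩

lemma eval_pairState (s : Store Register) {l : ℕ} {c : Option (Fin G.nodes)}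
    (h : s i 0 = l * (G.nodes + 1) + code c) : pairState.eval (G.encode L) s = code c := by
  simp only [pairState, Term.eval_mod, eval_val, eval_states, h, Nat.mul_comm l,
    Nat.mul_add_mod, Nat.mod_eq_of_lt (code_lt c)]

lemma eval_pairEdge (s : Store Register) {l : ℕ} {c : Option (Fin G.nodes)}
    (h : s i 0 = l * (G.nodes + 1) + code c) : pairEdge.eval (G.encode L) s = l := by
  rw [pairEdge, Term.eval_div, eval_val, eval_states, h, Nat.mul_comm l,
    Nat.mul_add_div (by omega), Nat.div_eq_of_lt (code_lt c), add_zero]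

lemma eval_pairNext (s : Store Register) (hs : HasTable G s) {l : ℕ} (hl : l < L.length)
    {c : Option (Fin G.nodes)} (h : s i 0 = l * (G.nodes + 1) + code c) :
    pairNext.eval (G.encode L) s = code (G.next c L[l].2.1) := by
  rw [← hs, pairNext, nextState, eval_get, Term.eval_add, Term.eval_mul,
    eval_edgeLabel s hl (eval_pairEdge s h), eval_pairState s h, eval_states]

lemma pair_time {V l W n : ℕ} (hW : W = V + 1) (hn : n = V + l + 1) :
    (1 + l * 2) + ((3 + l * W * 4 + 1000 * (W * W + l * W + 1)) + ((1 + W * W * 2) +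
      ((3 + l * W * 4 + 1000 * (W * W + 1 + l * W + 1)) +
        (1 + (1 + V * (1 + (1 + V * (1 + 2)))))))) ≤ 8000 * n ^ 2 := by
  subst hW hn
  nlinarith [Nat.zero_le (V * l), Nat.zero_le (V * V), Nat.zero_le (l * l)]

/-- The number of the vertex of failure is the square of the number of states; a factor that is `0`
or `1` selects between this vertex and another one. -/
lemma eval_testTerms (hL : G.IsEdgeList L) (s : Store Register) (htab : HasTable G s)
    (hreach : HasReach G s) {l : ℕ} (hl : l < L.length) {c : Option (Fin G.nodes)}
    (hi : s i 0 = l * (G.nodes + 1) + code c) :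
    testSourceTerm.eval (G.encode L) s = testCode (testSource (some L[l].1) c L[l].2.1) ∧
    testTargetTerm.eval (G.encode L) s = testCode (testTarget (some L[l].1) c L[l].2.1) := by
  have hnext : G.next (some L[l].1) L[l].2.1 = some L[l].2.2 := step_of_isEdgeList hL hl
  have e1 := eval_pair s (eval_edgeTarget s hl (eval_pairEdge s hi)) (eval_pairState s hi)
  have e2 := eval_pair s (eval_edgeSource s hl (eval_pairEdge s hi)) (eval_pairState s hi)
  have e3 := eval_pair s (eval_pairNext s htab hl hi) (eval_pairState s hi)
  have e4 := eval_pair s (eval_edgeTarget s hl (eval_pairEdge s hi))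
    (eval_pairNext s htab hl hi)
  have l1 := code₂_lt (some L[l].1, c)
  have l2 := code₂_lt (some L[l].2.2, G.next c L[l].2.1)
  have r1 := hreach (some L[l].2.2) c
  have r2 := hreach (G.next c L[l].2.1) c
  have hiff : G.LiveReaches (G.next (some L[l].1) L[l].2.1) c ↔
      G.LiveReaches (some L[l].2.2) c := by rw [hnext]
  simp only [testSourceTerm, testTargetTerm, Term.eval_sub, Term.eval_mul, eval_get, eval_states,
    e1, e2, e3, e4]
  by_cases h1 : G.LiveReaches (some L[l].2.2) c
  · by_cases h2 : G.LiveReaches (G.next c L[l].2.1) c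
    · rw [testSource, testTarget, if_pos (hiff.2 h1), if_pos ⟨hiff.2 h1, h2⟩, r1.1 h1, r2.1 h2,
        testCode_some, testCode_some, hnext]
      omega
    · rw [testSource, testTarget, if_pos (hiff.2 h1), if_neg (fun h => h2 h.2), r1.1 h1, r2.2 h2,
        testCode_some, testCode_none]
      omega
  · rw [testSource, testTarget, if_neg (hiff.not.2 h1), if_neg (fun h => h1 (hiff.1 h.1)),
      r1.2 h1, testCode_none]
    omega

/-- The connections between pairs yield the table of reachable states, from which the test graph is
built; its connections decide the condition of `locallyLeftRegular_iff_testStep`. -/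
lemma pairCode_spec (hL : G.IsEdgeList L) : pairCode.Spec (G.encode L) (fun _ _ => 0)
    (8000 * (G.nodes + L.length + 1) ^ 2)
    fun s => Holds out s (LocallyLeftRegular G.transitionSemigroup) := by
  obtain ⟨W, hW⟩ : ∃ W, W = G.nodes + 1 := ⟨_, rfl⟩
  refine Spec.mono (T := (1 + L.length * 2) + ((3 + L.length * W * 4 +
    1000 * (W * W + L.length * W + 1)) + ((1 + W * W * 2) + ((3 + L.length * W * 4 +
    1000 * (W * W + 1 + L.length * W + 1)) + (1 + (1 + G.nodes * (1 + (1 + G.nodes *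
      (1 + 2)))))))))
    ?_ ?_ fun _ _ h => h
  swap
  · exact pair_time (by omega) (by omega)
  subst hW
  refine Spec.seq (buildTable_spec hL _ fun _ => rfl) fun s₁ hs₁ htab₁ => ?_
  refine Spec.seq (connectPairs_spec hL code₂_injective code₂_lt (fun a b _ => (a, b))
    (fun a b σ => next₂ (a, b) σ) s₁ (by simp) ?_) fun s₂ hs₂ hconn => ?_
  · intro s' htab' _ l hl c hi
    have htab : HasTable G s' := fun a σ => by rw [htab', htab₁ a σ]
    have hnext : G.next (some L[l].1) L[l].2.1 = some L[l].2.2 := step_of_isEdgeList hL hl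
    refine ⟨eval_pair s' (eval_edgeSource s' hl (eval_pairEdge s' hi)) (eval_pairState s' hi), ?_⟩
    rw [next₂, hnext]
    exact eval_pair s' (eval_edgeTarget s' hl (eval_pairEdge s' hi)) (eval_pairNext s' htab hl hi)
  have htab₂ : s₂ table = s₁ table := hs₂ _ (by
    simp [connectPairs, writes, closure, findRadix, findBases, raise, powerTables, packGraph,
      squareStep])
  have hrel : (fun x y : Option (Fin G.nodes) × Option (Fin G.nodes) => ∃ a c σ,
      G.next a σ ≠ none ∧ (a, c) = x ∧ next₂ (a, c) σ = y) = G.Step₂ := by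
    funext ⟨a, c⟩ y
    refine propext ⟨?_, ?_⟩
    · rintro ⟨a', c', σ, h1, h2, rfl⟩
      obtain ⟨rfl, rfl⟩ := Prod.ext_iff.1 h2
      exact ⟨σ, rfl, Option.isSome_iff_ne_none.2 h1⟩
    · rintro ⟨σ, rfl, h⟩
      exact ⟨a, c, σ, Option.isSome_iff_ne_none.1 h, rfl, rfl⟩
  rw [hrel] at hconn
  refine Spec.seq (buildReach_spec s₂ hconn) fun s₃ hs₃ hreach₃ => ?_
  have htab₃ : s₃ table = s₁ table := (hs₃ _ (by simp [buildReach, writes])).trans htab₂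
  refine Spec.seq (connectPairs_spec hL testCode_injective testCode_lt testSource testTarget s₃
    (by simp) ?_) fun s₄ hs₄ htest => ?_
  · intro s' htab' hreach' l hl c hi
    have htab : HasTable G s' := fun a σ => by rw [htab', htab₃, htab₁ a σ]
    have hreach : HasReach G s' := fun a b => by rw [hreach']; exact hreach₃ a b
    exact eval_testTerms hL s' htab hreach hl hi
  have hreach₄ : HasReach G s₄ := fun a b => by
    rw [hs₄ reach (by simp [connectPairs, writes, closure, findRadix, findBases, raise,
      powerTables, packGraph, squareStep])]
    exact hreach₃ a b
  refine Spec.set_seq ((checkPairs_spec violation _ (by simp [Holds, Store.set]) (fun a b =>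
    Relation.TransGen G.TestStep (some (some a, some b)) (some (some a, some b)) →
      (G.LiveReaches (some b) (some a) → a = b) ∧
        ¬ Relation.TransGen G.TestStep (some (some a, some b)) none) ?_).mono le_rfl
    fun s' _ h => h.congr locallyLeftRegular_iff_testStep.symm)
  intro s' hs' a b ha hb
  have e1 : s' fwd = s₄ fwd := hs' _ (by simp [checkPairs, writes, require])
  have e2 : s' powX = s₄ powX := hs' _ (by simp [checkPairs, writes, require])
  have e3 : s' powZ = s₄ powZ := hs' _ (by simp [checkPairs, writes, require])
  have e4 : s' baseX = s₄ baseX := hs' _ (by simp [checkPairs, writes, require])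
  have e5 : s' baseZ = s₄ baseZ := hs' _ (by simp [checkPairs, writes, require])
  have e6 : s' reach = s₄ reach := hs' _ (by simp [checkPairs, writes, require])
  have ep : (node p).eval (G.encode L) s' = code (some a) := by simp [node, ha]
  have eq : (node q).eval (G.encode L) s' = code (some b) := by simp [node, hb]
  have hd : (p.val.distance q.val).eval (G.encode L) s' = 0 ↔ a = b := by
    rw [Term.distance_eq_zero, Fin.ext_iff]
    simp [ha, hb]
  have h1 := htest (some (some a, some b)) (some (some a, some b))
  have h2 := htest (some (some a, some b)) none
  have h3 := hreach₄ (some b) (some a)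
  have h3' : s₄ reach (code₂ (some b, some a)) = 0 ↔ ¬ G.LiveReaches (some b) (some a) :=
    ⟨fun h h' => by simp [h3.1 h'] at h, h3.2⟩
  rw [violation, Term.eval_mul, Term.eval_add, Term.eval_mul, eval_connected, eval_connected,
    eval_get, eval_pair s' ep eq, eval_pair s' eq ep, e1, e2, e3, e4, e5, e6, mul_eq_zero,
    Nat.add_eq_zero_iff, mul_eq_zero, hd, h3', Term.eval_mul, eval_states]
  rw [testCode_some] at h1 h2
  rw [testCode_none] at h2
  change _ ↔ Relation.TransGen G.TestStep _ _ at h1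
  change _ ↔ Relation.TransGen G.TestStep _ _ at h2
  rw [← h1, ← h2]
  tauto

end Pairs

theorem answers_rightLocallyTestable_transitionSemigroup : ∃ (P : Program) (C : ℕ),
    ∀ (G : TransitionGraph) (L : List (Fin G.nodes × Fin G.alphabet × Fin G.nodes)),
    0 < G.nodes → G.IsEdgeList L →
    Answers P (G.encode L) (RightLocallyTestable G.transitionSemigroup)
      (C * (G.nodes + L.length) ^ 2) := by
  refine ⟨pairCode.program graphBase .out,
    (pairCode.weight graphBase + graphBase.cost + 20) * 40000, fun G L hG hL => ?_⟩
  refine (Code.answers isBase_graphBase _ _ _ _ ((pairCode_spec hL).mono le_rfl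
    fun s _ h => h.congr (rightLocallyTestable_iff _).symm)).mono ?_
  rw [mul_assoc]
  refine Nat.mul_le_mul_left _ ?_
  have h1 : 1 ≤ G.nodes + L.length := by omega
  generalize G.nodes + L.length = n at *
  nlinarith

end RAM

theorem mainTheorem5 :
    (∃ (P : RAM.Program) (C : ℕ), ∀ (S : Type) [Semigroup S] (k : ℕ) (ν : Fin k ≃ S), 0 < k →
      RAM.Answers P (LocalTestability.encodeSemigroup ν)
        (LocalTestability.RightLocallyTestable S) (C * k ^ 2)) ∧
    (∃ (P : RAM.Program) (C : ℕ), ∀ (S : Type) [Semigroup S] (k : ℕ) (ν : Fin k ≃ S), 0 < k →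
      RAM.Answers P (LocalTestability.encodeSemigroup ν)
        (LocalTestability.LeftLocallyTestable S) (C * k ^ 2)) ∧
    (∃ (P : RAM.Program) (C : ℕ), ∀ (G : LocalTestability.TransitionGraph)
      (L : List (Fin G.nodes × Fin G.alphabet × Fin G.nodes)), 0 < G.nodes → G.IsEdgeList L →
      RAM.Answers P (G.encode L)
        (LocalTestability.RightLocallyTestable G.transitionSemigroup)
        (C * (G.nodes + L.length) ^ 2)) ∧
    (∃ (P : RAM.Program) (C : ℕ), ∀ (G : LocalTestability.TransitionGraph)
      (L : List (Fin G.nodes × Fin G.alphabet × Fin G.nodes)), 0 < G.nodes → G.IsEdgeList L →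
      RAM.Answers P (G.encode L)
        (LocalTestability.LeftLocallyTestable G.transitionSemigroup)
        (C * (G.nodes + L.length) ^ 3)) ∧
    (∃ (P : RAM.Program) (C : ℕ), ∀ (G : LocalTestability.TransitionGraph)
      (L : List (Fin G.nodes × Fin G.alphabet × Fin G.nodes)), 0 < G.nodes → G.IsEdgeList L →
      RAM.Answers P (G.encode L)
        (LocalTestability.LocallyIdempotent G.transitionSemigroup)
        (C * (G.nodes + L.length) ^ 3)) :=

  ⟨RAM.answers_rightLocallyTestable, RAM.answers_leftLocallyTestable,
    RAM.answers_rightLocallyTestable_transitionSemigroup,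
    RAM.answers_leftLocallyTestable_transitionSemigroup, RAM.answers_locallyIdempotent⟩
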